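/- **Setting.** A board is an $m\times n$ grid of unit cells containing exactly three sinks, one of each of three colors, in distinct cells, and nothing else. A layout puts into some of the non-sink cells one arrow each, which has one of the three colors and points in one of the four cardinal directions. A packet has a color. It enters the board through a boundary edge, moving perpendicularly to that edge, and moves straight from cell to cell, except that on entering a cell with an arrow of its own color it turns to the direction of that arrow (arrows of other colors are ignored). On entering a sink it disappears, and it is lost if it leaves the grid or enters a sink of another color. A layout is *perfect* if for every color and every boundary edge, the packet of that color entering through that edge reaches the sink of its own color (after finitely many steps). A cell is *two cells away* (respectively *at least two cells away*) from one of the four sides of the board if exactly (respectively at least) two cells lie strictly between it and that side. Two cells are *adjacent* if they share an edge. The *type* of a board is the one of the following six patterns (rows are separated by $|$, a sink is $X$, an empty cell is $\cdot$) from which its set of sinks arises by inserting empty rows and columns, rotating and reflecting, regardless of colors: $$\begin{array}{llll} C: & X\cdot X\ |\ \cdot X\cdot & I: & X\ |\ X\ |\ X\\ J: & \cdot X\ |\ \cdot X\ |\ X\cdot & L: & X\cdot\ |\ XX\\ Y: & X\cdot\cdot\ |\ \cdot\cdot X\ |\ \cdot X\cdot & /: & \cdot\cdot X\ |\ \cdot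 X\cdot\ |\ X\cdot\cdot \end{array}$$ A board has size *at least* $a\times b$ if it has at least $a$ rows and at least $b$ columns, or at least $b$ rows and at least $a$ columns. **Theorem.** A board with three sinks (one per color) has a perfect layout if and only if the following three conditions all hold. 1. Every sink is at least two cells away from each of the four sides of the board. 2. None of the following four configurations occurs: (a) a sink is two cells away from three sides of the board and adjacent to another sink; (b) a sink is two cells away from two incident sides and adjacent to two other sinks; (c) a sink is two cells away from two opposite sides and adjacent to two other sinks; (d) a sink $s$ is two cells away from three sides and one blank cell away from a pair of adjacent sinks, that is, in the row or column of $s$ there are consecutive cells $s, x, t$ with $x$ not a sink and $t$ a sink, and $t$ is adjacent to the third sink. 3. The size of the board is at least $7\times 8$ if its type is $Y$ or $/$; at least $7\times 8$ or at least $6\times 9$ if its type is $C$ or $J$; at least $7\times 7$ or at least $6\times 9$ if its type is $L$; at least $7\times 7$, at least $6\times 9$ or at least $5\times 11$ if its type is $I$. -/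

import Mathlib

namespace LoadingGame

/-- A cell of the infinite square grid, as (row, column); rows grow downwards. -/
abbrev Cell := ℤ × ℤ

/-- The three colors. -/
abbrev Color := Fin 3

/-- The four cardinal directions. -/
inductive Dir where
  | up | down | left | right
  deriving DecidableEq

/-- The unit displacement of a direction. -/
def Dir.vec : Dir → Cell
  | .up => (-1, 0)
  | .down => (1, 0)
  | .left => (0, -1)
  | .right => (0, 1)

/-- The opposite direction. -/
def Dir.opp : Dir → Dir
  | .up => .down
  | .down => .up
  | .left => .right
  | .right => .left

/-- An arrow tile. -/
structure Arrow where
  color : Color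
  dir : Dir

/-- A rectangular board, empty except for one sink of each color, in distinct cells.
The cells of the board are the `(r, c)` with `0 ≤ r < rows` and `0 ≤ c < cols`. -/
structure Board where
  rows : ℕ
  cols : ℕ
  sink : Color → Cell
  sink_mem : ∀ i, (0 ≤ (sink i).1 ∧ (sink i).1 < rows) ∧ (0 ≤ (sink i).2 ∧ (sink i).2 < cols)
  sink_injective : Function.Injective sink

namespace Board

/-- The cell `x` belongs to the board. -/
def InGrid (B : Board) (x : Cell) : Prop :=
  (0 ≤ x.1 ∧ x.1 < B.rows) ∧ (0 ≤ x.2 ∧ x.2 < B.cols)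

/-- The cell `x` contains a sink (of any color). -/
def IsSink (B : Board) (x : Cell) : Prop := ∃ j, x = B.sink j

end Board

/-- A layout: every cell holds at most one arrow, and arrows lie in cells of the board that
are not sinks. -/
structure Layout (B : Board) where
  arrow : Cell → Option Arrow
  arrow_mem : ∀ x, arrow x ≠ none → B.InGrid x ∧ ¬ B.IsSink x

namespace Layout

variable {B : Board}

/-- The direction in which a packet of color `i` leaves the (non-sink) cell `x` if it enters
that cell moving in direction `d`: only arrows of its own color affect it. -/
def turn (L : Layout B) (i : Color) (x : Cell) (d : Dir) : Dir :=
  match L.arrow x with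
  | none => d
  | some a => if a.color = i then a.dir else d

/-- `L.Delivered i x d`: a packet of color `i` that enters the cell `x` moving in direction `d`
reaches the sink of color `i` after finitely many steps.  A packet that leaves the board or enters
a sink of another color disappears, so it can move on only from a cell of the board that contains
no sink. -/
inductive Delivered (L : Layout B) (i : Color) : Cell → Dir → Prop
  | arrive (d : Dir) : Delivered L i (B.sink i) d
  | move (x : Cell) (d : Dir) (hx : B.InGrid x) (hs : ¬ B.IsSink x)
      (h : Delivered L i (x + (L.turn i x d).vec) (L.turn i x d)) : Delivered L i x d

/-- A layout is perfect if every packet of every color, entering the board through any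
boundary edge, is delivered.  The boundary edges are the edges between a cell `x` of the board and
a neighboring cell `x - d.vec` outside of it; a packet entering there moves in direction `d`. -/
def IsPerfect (L : Layout B) : Prop :=
  ∀ (i : Color) (x : Cell) (d : Dir), B.InGrid x → ¬ B.InGrid (x - d.vec) → L.Delivered i x d

end Layout

namespace Board

/-- The board has a perfect layout. -/
def HasPerfectLayout (B : Board) : Prop := ∃ L : Layout B, L.IsPerfect

/-- The number of cells strictly between the cell `x` and the boundary in direction `d`. -/
def distBoundary (B : Board) (x : Cell) : Dir → ℤ
  | .up => x.1
  | .down => B.rows - 1 - x.1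
  | .left => x.2
  | .right => B.cols - 1 - x.2

/-- All sinks are at least two cells away from the boundary. -/
def SinksAwayFromBoundary (B : Board) : Prop :=
  ∀ (i : Color) (d : Dir), 2 ≤ B.distBoundary (B.sink i) d

/-- Two cells are adjacent if they share an edge. -/
def Adjacent (x y : Cell) : Prop := ∃ d : Dir, y = x + d.vec

/-- The sink of color `i` is two cells away from (at least) three boundaries. -/
def TwoFromThree (B : Board) (i : Color) : Prop :=
  ∃ e : Dir, ∀ d : Dir, d ≠ e → B.distBoundary (B.sink i) d = 2

/-- A sink is two cells away from three boundaries and adjacent to another sink. -/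
def ForbiddenA (B : Board) : Prop :=
  ∃ i j : Color, B.TwoFromThree i ∧ Adjacent (B.sink i) (B.sink j)

/-- A sink is two cells away from two incident boundaries and adjacent to two other sinks. -/
def ForbiddenB (B : Board) : Prop :=
  ∃ i j k : Color, j ≠ k ∧
    (∃ d e : Dir, d ≠ e ∧ d ≠ e.opp ∧
      B.distBoundary (B.sink i) d = 2 ∧ B.distBoundary (B.sink i) e = 2) ∧
    Adjacent (B.sink i) (B.sink j) ∧ Adjacent (B.sink i) (B.sink k)

/-- A sink is two cells away from two opposite boundaries and adjacent to two other sinks. -/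
def ForbiddenC (B : Board) : Prop :=
  ∃ i j k : Color, j ≠ k ∧
    (∃ d : Dir, B.distBoundary (B.sink i) d = 2 ∧ B.distBoundary (B.sink i) d.opp = 2) ∧
    Adjacent (B.sink i) (B.sink j) ∧ Adjacent (B.sink i) (B.sink k)

/-- A sink is two cells away from three boundaries and one blank cell away from a pair of
adjacent sinks: next to the sink, in some direction, is a blank cell, the next cell is the
sink `j`, and `j` is adjacent to the third sink `k`. -/
def ForbiddenD (B : Board) : Prop :=
  ∃ i j k : Color, i ≠ k ∧ B.TwoFromThree i ∧
    (∃ d : Dir, ¬ B.IsSink (B.sink i + d.vec) ∧ B.sink j = B.sink i + d.vec + d.vec) ∧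
    Adjacent (B.sink j) (B.sink k)

/-- The board contains none of the four forbidden configurations. -/
def NoForbiddenConfiguration (B : Board) : Prop :=
  ¬ B.ForbiddenA ∧ ¬ B.ForbiddenB ∧ ¬ B.ForbiddenC ∧ ¬ B.ForbiddenD

end Board

/-- The six types of configurations of three sinks. -/
inductive SinkType where
  | C | I | J | L | Y | slash
  deriving DecidableEq

/-- Positions (row, column) of the three sinks in the standard picture of each type:
```
  C       I     J      L      Y        slash
  X . X   X     . X    X .    X . .    . . X
  . X .   X     . X    X X    . . X    . X .
          X     X .           . X .    X . .
``` -/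
def SinkType.pattern : SinkType → Fin 3 → Fin 3 × Fin 3
  | .C => ![(0, 0), (0, 2), (1, 1)]
  | .I => ![(0, 0), (1, 0), (2, 0)]
  | .J => ![(0, 1), (1, 1), (2, 0)]
  | .L => ![(0, 0), (1, 0), (1, 1)]
  | .Y => ![(0, 0), (1, 2), (2, 1)]
  | .slash => ![(0, 2), (1, 1), (2, 0)]

namespace Board

/-- The board has type `T`: its sinks arise from the pattern of `T` by inserting empty rows and
columns (strictly increasing `f` and `g`), reflections (strictly decreasing `f` or `g`),
possibly interchanging rows and columns (together with the reflections this gives all rotations),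
and recoloring (`σ`). -/
def HasType (B : Board) (T : SinkType) : Prop :=
  ∃ (σ : Equiv.Perm (Fin 3)) (f g : Fin 3 → ℤ),
    (StrictMono f ∨ StrictAnti f) ∧ (StrictMono g ∨ StrictAnti g) ∧
    ((∀ k, B.sink (σ k) = (f (T.pattern k).1, g (T.pattern k).2)) ∨
     (∀ k, B.sink (σ k) = (g (T.pattern k).2, f (T.pattern k).1)))

/-- The board has at least `m` rows and at least `n` columns, or vice versa. -/
def SizeAtLeast (B : Board) (m n : ℕ) : Prop :=
  (m ≤ B.rows ∧ n ≤ B.cols) ∨ (n ≤ B.rows ∧ m ≤ B.cols)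

/-- The size bounds that a board of type `T` has to satisfy. -/
def SizeBound (B : Board) : SinkType → Prop
  | .Y => B.SizeAtLeast 7 8
  | .slash => B.SizeAtLeast 7 8
  | .C => B.SizeAtLeast 7 8 ∨ B.SizeAtLeast 6 9
  | .J => B.SizeAtLeast 7 8 ∨ B.SizeAtLeast 6 9
  | .L => B.SizeAtLeast 7 7 ∨ B.SizeAtLeast 6 9
  | .I => B.SizeAtLeast 7 7 ∨ B.SizeAtLeast 6 9 ∨ B.SizeAtLeast 5 11

/-- The board obeys the size bounds for its type. -/
def ObeysSizeBounds (B : Board) : Prop := ∀ T : SinkType, B.HasType T → B.SizeBound T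

end Board

end LoadingGame

/-! Necessity rests on three observations about a perfect layout. A packet that flies straight at a
sink of another color must be turned aside on the way. On the ray from a sink to a side each of the
two foreign colors needs a cell for this, so there are at least two cells, and if there are exactly
two, they hold no arrow of the sink's own color (`arrow_of_dist_eq_two`). On the other hand every
sink needs a feed: an arrow of its own color pointing at it with no sink in between (`exists_feed`).
A side at distance two admits no feed, nor does an adjacent sink. In configurations (a) to (c) this
closes all four sides of a sink; in (d) two sinks would have to be fed from the same cell. Finally,
arrows are counted. A packet that enters along a row must be turned off this row by a vertical
arrow, so every row has three vertical arrows, and four if it contains a sink: two foreign colors on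
either side. With the same for columns, an m × n board whose sinks occupy R rows and S columns
satisfies 3m + R + 3n + S + 3 ≤ mn, that is, (m - 3)(n - 3) ≥ 12 + R + S (`area_bound`). Together
with m ≥ R + 4 and n ≥ S + 4 this gives the size bounds.

For sufficiency, layouts of small boards are stretched. Suppose that packets of the three colors
cross a horizontal grid line in three distinct columns. Then a row can be inserted there, with an
arrow of the right color in each of these columns that continues the crossing. A packet entering
along the new row runs into the arrow of its color and joins a successful trajectory. The old
packets are undisturbed, because no edge is crossed in both directions by packets of one color
(`not_reach_opp`). Old crossings persist, so the insertion can be repeated (`exists_insertRow`), and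
one rich layout yields layouts of all boards obtained by widening the gaps between sinks and sides
(`Rich.stretch`). Up to symmetry, every admissible board arises in this way from finitely many small
ones, whose layouts are listed in tables and verified by evaluation. The forbidden configurations
have to be excluded only for the types I and L. -/

namespace LoadingGame

/-! ### Directions, distances and packet trajectories -/

instance : Fintype Dir := ⟨{.up, .down, .left, .right}, by intro d; cases d <;> decide⟩

theorem Dir.vec_opp (d : Dir) : d.opp.vec = -d.vec := by cases d <;> rfl

@[simp] theorem Dir.opp_opp (d : Dir) : d.opp.opp = d := by cases d <;> rfl

theorem Dir.opp_ne (d : Dir) : d.opp ≠ d := by cases d <;> decide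

namespace Board

variable {B : Board}

theorem inGrid_iff_distBoundary (x : Cell) : B.InGrid x ↔ ∀ d, 0 ≤ B.distBoundary x d := by
  constructor
  · rintro ⟨⟨_, _⟩, _, _⟩ d
    cases d <;> simp only [distBoundary] <;> omega
  · intro h
    have h1 := h .up
    have h2 := h .down
    have h3 := h .left
    have h4 := h .right
    simp only [distBoundary] at h1 h2 h3 h4
    exact ⟨⟨h1, by omega⟩, h3, by omega⟩

theorem distBoundary_add_self (x : Cell) (d : Dir) :
    B.distBoundary (x + d.vec) d = B.distBoundary x d - 1 := by
  cases d <;> simp [distBoundary, Dir.vec] <;> ring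

theorem distBoundary_add_of_ne (x : Cell) {d e : Dir} (h : d ≠ e) (h' : d ≠ e.opp) :
    B.distBoundary (x + e.vec) d = B.distBoundary x d := by
  cases d <;> cases e <;> simp_all [distBoundary, Dir.vec, Dir.opp]

end Board

namespace Layout

variable {B : Board} {L : Layout B}

theorem turn_of_arrow {i : Color} {x : Cell} {e : Dir} (h : L.arrow x = some ⟨i, e⟩) (d : Dir) :
    L.turn i x d = e := by
  simp [turn, h]

theorem turn_of_forall_ne {i : Color} {x : Cell} (h : ∀ e, L.arrow x ≠ some ⟨i, e⟩) (d : Dir) :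
    L.turn i x d = d := by
  unfold turn
  split
  · rfl
  · next a ha =>
    split
    · next hc => exact absurd (by rw [ha, ← hc]) (h a.dir)
    · rfl

theorem arrow_of_turn_ne {i : Color} {x : Cell} {d : Dir} (h : L.turn i x d ≠ d) :
    L.arrow x = some ⟨i, L.turn i x d⟩ := by
  by_contra hc
  refine h (turn_of_forall_ne (fun e he => ?_) d)
  rw [turn_of_arrow he] at hc
  exact hc he

theorem turn_eq_turn_of_ne {i : Color} {x : Cell} {d : Dir} (h : L.turn i x d ≠ d) (e : Dir) :
    L.turn i x e = L.turn i x d :=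
  turn_of_arrow (arrow_of_turn_ne h) e

theorem Delivered.eq_or_move {i : Color} {x : Cell} {d : Dir} (h : L.Delivered i x d) :
    x = B.sink i ∨ B.InGrid x ∧ ¬ B.IsSink x ∧
      L.Delivered i (x + (L.turn i x d).vec) (L.turn i x d) := by
  cases h with
  | arrive => exact .inl rfl
  | move _ _ hx hs h => exact .inr ⟨hx, hs, h⟩

theorem Delivered.inGrid {i : Color} {x : Cell} {d : Dir} (h : L.Delivered i x d) :
    B.InGrid x := by
  rcases h.eq_or_move with rfl | h
  · exact B.sink_mem i
  · exact h.1

theorem Delivered.ne_sink {i j : Color} (hij : i ≠ j) {x : Cell} {d : Dir}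
    (h : L.Delivered i x d) : x ≠ B.sink j := by
  rintro rfl
  rcases h.eq_or_move with h | h
  · exact hij (B.sink_injective h).symm
  · exact h.2.1 ⟨j, rfl⟩

/-- The states (entered cell, direction of motion) through which some packet of color `i` that
entered the board through its boundary passes. -/
inductive Reach (L : Layout B) (i : Color) : Cell → Dir → Prop
  | entry (x : Cell) (d : Dir) (hx : B.InGrid x) (hd : ¬ B.InGrid (x - d.vec)) : Reach L i x d
  | step (x : Cell) (d : Dir) (h : Reach L i x d) (hx : B.InGrid x) (hs : ¬ B.IsSink x) :
      Reach L i (x + (L.turn i x d).vec) (L.turn i x d)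

theorem IsPerfect.delivered (hL : L.IsPerfect) {i : Color} {x : Cell} {d : Dir}
    (h : L.Reach i x d) : L.Delivered i x d := by
  induction h with
  | entry x d hx hd => exact hL i x d hx hd
  | step x d _ hx hs ih =>
    rcases ih.eq_or_move with rfl | ih
    · exact absurd ⟨i, rfl⟩ hs
    · exact ih.2.2

/-- In a perfect layout no edge is crossed in both directions by packets of the same color. -/
theorem IsPerfect.not_reach_opp (hL : L.IsPerfect) {i : Color} {x : Cell} {d : Dir}
    (h : L.Reach i x d) : ¬ L.Reach i (x - d.vec) d.opp := by
  have key : ∀ y e, L.Reach i y e → B.InGrid (y - e.vec) → ∃ e', L.Reach i (y - e.vec) e' ∧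
      ¬ B.IsSink (y - e.vec) ∧ L.turn i (y - e.vec) e' = e := by
    intro y e h hy
    cases h with
    | entry _ _ _ hd => exact absurd hy hd
    | step z e' h hz hs =>
      rw [add_sub_cancel_right]
      exact ⟨e', h, hs, rfl⟩
  intro h'
  have hD := hL.delivered h
  -- Follow the first packet forwards. The opposite crossing of its edge comes out of the cell just
  -- entered. If this cell does not turn the first packet, the opposite one came straight through
  -- it, and the next edge is crossed both ways too. If it does, its arrow points back, and the same
  -- edge is crossed with the roles exchanged. The delivery ends at a sink, out of which nothing
  -- comes.
  induction hD with
  | arrive d =>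
    obtain ⟨e, -, hs, -⟩ := key _ _ h' (by
      rw [Dir.vec_opp, sub_neg_eq_add, sub_add_cancel]; exact B.sink_mem i)
    rw [Dir.vec_opp, sub_neg_eq_add, sub_add_cancel] at hs
    exact hs ⟨i, rfl⟩
  | move x d hx hs _ ih =>
    obtain ⟨e, he, -, hte⟩ := key _ _ h' (by
      rw [Dir.vec_opp, sub_neg_eq_add, sub_add_cancel]; exact hx)
    rw [Dir.vec_opp, sub_neg_eq_add, sub_add_cancel] at he hte
    refine ih (.step _ _ h hx hs) ?_
    rw [add_sub_cancel_right]
    by_cases ht : L.turn i x d = d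
    · rw [ht]
      have h2 : L.turn i x e = e := by
        by_contra hne
        have := turn_eq_turn_of_ne hne d
        rw [ht, hte] at this
        exact d.opp_ne this.symm
      rw [← hte, h2]
      exact he
    · have h2 := turn_eq_turn_of_ne ht e
      rw [hte] at h2
      rw [← h2, Dir.opp_opp]
      exact h

end Layout

/-! ### Symmetries of boards -/

/-- A symmetry between two boards: a bijection of cells and directions that respects motion, the
distances to the four sides, and, up to a recoloring, the sinks. -/
structure Board.Iso (B B' : Board) where
  cell : Cell ≃ Cell
  dir : Dir ≃ Dir
  color : Equiv.Perm Color
  cell_add : ∀ x d, cell (x + Dir.vec d) = cell x + (dir d).vec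
  dir_opp : ∀ d, dir (Dir.opp d) = (dir d).opp
  sink : ∀ i, B'.sink (color i) = cell (B.sink i)
  dist : ∀ x d, B'.distBoundary (cell x) (dir d) = B.distBoundary x d

namespace Board.Iso

variable {B B' : Board}

theorem inGrid (φ : Board.Iso B B') (x : Cell) : B'.InGrid (φ.cell x) ↔ B.InGrid x := by
  rw [inGrid_iff_distBoundary, inGrid_iff_distBoundary]
  refine ⟨fun h d => ?_, fun h d => ?_⟩
  · rw [← φ.dist]; exact h _
  · obtain ⟨d, rfl⟩ := φ.dir.surjective d
    rw [φ.dist]; exact h _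

theorem isSink (φ : Board.Iso B B') (x : Cell) : B'.IsSink (φ.cell x) ↔ B.IsSink x := by
  constructor
  · rintro ⟨j, hj⟩
    obtain ⟨j, rfl⟩ := φ.color.surjective j
    rw [φ.sink] at hj
    exact ⟨j, φ.cell.injective hj⟩
  · rintro ⟨j, rfl⟩
    exact ⟨φ.color j, (φ.sink j).symm⟩

theorem cell_sub (φ : Board.Iso B B') (x : Cell) (d : Dir) : φ.cell (x - d.vec) = φ.cell x - (φ.dir d).vec := by
  rw [eq_sub_iff_add_eq, ← φ.cell_add, sub_add_cancel]

theorem adjacent (φ : Board.Iso B B') (x y : Cell) : Adjacent (φ.cell x) (φ.cell y) ↔ Adjacent x y := by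
  constructor
  · rintro ⟨d, h⟩
    obtain ⟨d, rfl⟩ := φ.dir.surjective d
    rw [← φ.cell_add] at h
    exact ⟨d, φ.cell.injective h⟩
  · rintro ⟨d, rfl⟩
    exact ⟨φ.dir d, φ.cell_add _ _⟩

/-- The image of a layout. -/
def layout (φ : Board.Iso B B') (L : Layout B) : Layout B' where
  arrow y := (L.arrow (φ.cell.symm y)).map fun a => ⟨φ.color a.color, φ.dir a.dir⟩
  arrow_mem y hy := by
    obtain ⟨x, rfl⟩ := φ.cell.surjective y
    rw [Equiv.symm_apply_apply] at hy
    rw [φ.inGrid, φ.isSink]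
    exact L.arrow_mem x fun h => hy (by rw [h]; rfl)

theorem layout_arrow (φ : Board.Iso B B') (L : Layout B) (x : Cell) : (φ.layout L).arrow (φ.cell x) =
    (L.arrow x).map fun a => ⟨φ.color a.color, φ.dir a.dir⟩ := by
  simp [layout]

theorem turn (φ : Board.Iso B B') (L : Layout B) (i : Color) (x : Cell) (d : Dir) :
    (φ.layout L).turn (φ.color i) (φ.cell x) (φ.dir d) = φ.dir (L.turn i x d) := by
  unfold Layout.turn
  rw [layout_arrow]
  cases L.arrow x with
  | none => rfl
  | some a =>
    simp only [Option.map_some, EmbeddingLike.apply_eq_iff_eq]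
    split <;> rfl

theorem delivered (φ : Board.Iso B B') {L : Layout B} {i : Color} {x : Cell} {d : Dir} (h : L.Delivered i x d) :
    (φ.layout L).Delivered (φ.color i) (φ.cell x) (φ.dir d) := by
  induction h with
  | arrive d => rw [← φ.sink]; exact .arrive _
  | move x d hx hs _ ih =>
    refine .move _ _ ((φ.inGrid x).2 hx) (mt (φ.isSink x).1 hs) ?_
    rw [φ.turn, ← φ.cell_add]
    exact ih

theorem reach (φ : Board.Iso B B') {L : Layout B} {i : Color} {x : Cell} {d : Dir} (h : L.Reach i x d) :
    (φ.layout L).Reach (φ.color i) (φ.cell x) (φ.dir d) := by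
  induction h with
  | entry x d hx hd =>
    refine .entry _ _ ((φ.inGrid x).2 hx) ?_
    rwa [← φ.cell_sub, φ.inGrid]
  | step x d _ hx hs ih =>
    rw [φ.cell_add, ← φ.turn]
    exact .step _ _ ih ((φ.inGrid x).2 hx) (mt (φ.isSink x).1 hs)

theorem isPerfect (φ : Board.Iso B B') {L : Layout B} (hL : L.IsPerfect) : (φ.layout L).IsPerfect := by
  intro i x d hx hd
  obtain ⟨i, rfl⟩ := φ.color.surjective i
  obtain ⟨x, rfl⟩ := φ.cell.surjective x
  obtain ⟨d, rfl⟩ := φ.dir.surjective d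
  rw [φ.inGrid] at hx
  rw [← φ.cell_sub, φ.inGrid] at hd
  exact φ.delivered (hL i x d hx hd)

theorem hasPerfectLayout (φ : Board.Iso B B') (h : B.HasPerfectLayout) : B'.HasPerfectLayout :=
  let ⟨_, hL⟩ := h
  ⟨_, φ.isPerfect hL⟩

/-- The inverse symmetry. -/
def symm (φ : Board.Iso B B') : Board.Iso B' B where
  cell := φ.cell.symm
  dir := φ.dir.symm
  color := φ.color.symm
  cell_add x d := by
    rw [Equiv.symm_apply_eq, φ.cell_add, Equiv.apply_symm_apply, Equiv.apply_symm_apply]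
  dir_opp d := by rw [Equiv.symm_apply_eq, φ.dir_opp, Equiv.apply_symm_apply]
  sink i := by
    rw [Equiv.eq_symm_apply, ← φ.sink, Equiv.apply_symm_apply]
  dist x d := by rw [← φ.dist, Equiv.apply_symm_apply, Equiv.apply_symm_apply]

theorem sinksAwayFromBoundary (φ : Board.Iso B B') (h : B.SinksAwayFromBoundary) : B'.SinksAwayFromBoundary := by
  intro i d
  obtain ⟨i, rfl⟩ := φ.color.surjective i
  obtain ⟨d, rfl⟩ := φ.dir.surjective d
  rw [φ.sink, φ.dist]
  exact h i d

theorem twoFromThree (φ : Board.Iso B B') {i : Color} (h : B.TwoFromThree i) : B'.TwoFromThree (φ.color i) := by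
  obtain ⟨e, he⟩ := h
  refine ⟨φ.dir e, fun d hd => ?_⟩
  obtain ⟨d, rfl⟩ := φ.dir.surjective d
  rw [φ.sink, φ.dist]
  exact he d fun h => hd (by rw [h])

theorem forbiddenA (φ : Board.Iso B B') (h : B.ForbiddenA) : B'.ForbiddenA := by
  obtain ⟨i, j, h, h'⟩ := h
  refine ⟨φ.color i, φ.color j, φ.twoFromThree h, ?_⟩
  rwa [φ.sink, φ.sink, φ.adjacent]

theorem forbiddenB (φ : Board.Iso B B') (h : B.ForbiddenB) : B'.ForbiddenB := by
  obtain ⟨i, j, k, hjk, ⟨d, e, hde, hde', h1, h2⟩, h3, h4⟩ := h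
  refine ⟨φ.color i, φ.color j, φ.color k, φ.color.injective.ne hjk,
    ⟨φ.dir d, φ.dir e, φ.dir.injective.ne hde, ?_, ?_, ?_⟩, ?_, ?_⟩
  · rw [← φ.dir_opp]; exact φ.dir.injective.ne hde'
  · rw [φ.sink, φ.dist, h1]
  · rw [φ.sink, φ.dist, h2]
  · rwa [φ.sink, φ.sink, φ.adjacent]
  · rwa [φ.sink, φ.sink, φ.adjacent]

theorem forbiddenC (φ : Board.Iso B B') (h : B.ForbiddenC) : B'.ForbiddenC := by
  obtain ⟨i, j, k, hjk, ⟨d, h1, h2⟩, h3, h4⟩ := h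
  refine ⟨φ.color i, φ.color j, φ.color k, φ.color.injective.ne hjk, ⟨φ.dir d, ?_, ?_⟩, ?_, ?_⟩
  · rw [φ.sink, φ.dist, h1]
  · rw [← φ.dir_opp, φ.sink, φ.dist, h2]
  · rwa [φ.sink, φ.sink, φ.adjacent]
  · rwa [φ.sink, φ.sink, φ.adjacent]

theorem forbiddenD (φ : Board.Iso B B') (h : B.ForbiddenD) : B'.ForbiddenD := by
  obtain ⟨i, j, k, hik, h1, ⟨d, h2, h3⟩, h4⟩ := h
  refine ⟨φ.color i, φ.color j, φ.color k, φ.color.injective.ne hik, φ.twoFromThree h1,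
    ⟨φ.dir d, ?_, ?_⟩, ?_⟩
  · rwa [φ.sink, ← φ.cell_add, φ.isSink]
  · rw [φ.sink, φ.sink, ← φ.cell_add, ← φ.cell_add, h3]
  · rwa [φ.sink, φ.sink, φ.adjacent]

theorem noForbiddenConfiguration (φ : Board.Iso B B') (h : B.NoForbiddenConfiguration) :
    B'.NoForbiddenConfiguration :=
  ⟨mt φ.symm.forbiddenA h.1, mt φ.symm.forbiddenB h.2.1, mt φ.symm.forbiddenC h.2.2.1,
    mt φ.symm.forbiddenD h.2.2.2⟩

end Board.Iso

/-- Reflection of directions in the main diagonal. -/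
def Dir.transpose : Dir → Dir
  | .up => .left
  | .down => .right
  | .left => .up
  | .right => .down

/-- Exchange of up and down. -/
def Dir.flip : Dir → Dir
  | .up => .down
  | .down => .up
  | .left => .left
  | .right => .right

namespace Board

/-- The board with rows and columns interchanged. -/
def transpose (B : Board) : Board where
  rows := B.cols
  cols := B.rows
  sink i := (B.sink i).swap
  sink_mem i := (B.sink_mem i).symm
  sink_injective := Prod.swap_injective.comp B.sink_injective

/-- Transposition as a symmetry. -/
def transposeIso (B : Board) : Iso B B.transpose where
  cell := Equiv.prodComm ℤ ℤ
  dir := ⟨Dir.transpose, Dir.transpose, by intro d; cases d <;> rfl, by intro d; cases d <;> rfl⟩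
  color := Equiv.refl _
  cell_add x d := by cases d <;> rfl
  dir_opp d := by cases d <;> rfl
  sink _ := rfl
  dist x d := by cases d <;> rfl

/-- The board turned upside down. -/
def flip (B : Board) : Board where
  rows := B.rows
  cols := B.cols
  sink i := (B.rows - 1 - (B.sink i).1, (B.sink i).2)
  sink_mem i := by
    have := B.sink_mem i
    dsimp only
    omega
  sink_injective i j h := by
    simp only [Prod.mk.injEq] at h
    exact B.sink_injective (Prod.ext (by omega) h.2)

/-- Reflection as a symmetry. -/
def flipIso (B : Board) : Iso B B.flip where
  cell := ⟨fun x => (B.rows - 1 - x.1, x.2), fun x => (B.rows - 1 - x.1, x.2),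
    fun x => by simp, fun x => by simp⟩
  dir := ⟨Dir.flip, Dir.flip, by intro d; cases d <;> rfl, by intro d; cases d <;> rfl⟩
  color := Equiv.refl _
  cell_add x d := by
    cases d <;> simp [Dir.vec, Dir.flip, Prod.ext_iff] <;> ring
  dir_opp d := by cases d <;> rfl
  sink _ := rfl
  dist x d := by cases d <;> simp [distBoundary, Dir.flip, flip]

/-- The board with its sinks recolored. -/
def recolor (B : Board) (σ : Equiv.Perm Color) : Board where
  rows := B.rows
  cols := B.cols
  sink i := B.sink (σ i)
  sink_mem _ := B.sink_mem _
  sink_injective := B.sink_injective.comp σ.injective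

/-- Recoloring as a symmetry. -/
def recolorIso (B : Board) (σ : Equiv.Perm Color) : Iso B (B.recolor σ) where
  cell := Equiv.refl _
  dir := Equiv.refl _
  color := σ.symm
  cell_add _ _ := rfl
  dir_opp _ := rfl
  sink i := by simp [recolor]
  dist _ _ := rfl

end Board

end LoadingGame

/-! ### Necessity: distances of the sinks and forbidden configurations -/

namespace LoadingGame

open Board Layout

variable {B : Board} {L : Layout B}

namespace Layout

theorem IsPerfect.delivered_of_dist (hL : L.IsPerfect) {x : Cell} {d : Dir} (hx : B.InGrid x)
    (h : B.distBoundary x d = 0) (i : Color) : L.Delivered i x d.opp := by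
  refine hL i x d.opp hx fun hc => ?_
  rw [inGrid_iff_distBoundary] at hc
  have := hc d
  rw [Dir.vec_opp, sub_neg_eq_add, distBoundary_add_self] at this
  omega

theorem exists_pair_ne (j : Color) : ∃ a b : Color, a ≠ b ∧ a ≠ j ∧ b ≠ j := by
  revert j; decide

theorem IsPerfect.dist_ne_zero (hL : L.IsPerfect) (j : Color) (d : Dir) :
    B.distBoundary (B.sink j) d ≠ 0 := by
  intro h
  obtain ⟨a, -, -, ha, -⟩ := exists_pair_ne j
  exact (hL.delivered_of_dist (B.sink_mem j) h a).ne_sink ha rfl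

theorem IsPerfect.dist_pos (hL : L.IsPerfect) (j : Color) (d : Dir) :
    0 < B.distBoundary (B.sink j) d :=
  lt_of_le_of_ne ((inGrid_iff_distBoundary _).1 (B.sink_mem j) d) (hL.dist_ne_zero j d).symm

/-- A packet of another color that flies towards a sink is deflected before. -/
theorem Delivered.arrow_or (i j : Color) (hij : i ≠ j) {d : Dir} (n : ℕ)
    (h : L.Delivered i (B.sink j + n • d.vec) d.opp) :
    ∃ m, m < n ∧ ∃ e, L.arrow (B.sink j + (m + 1) • d.vec) = some ⟨i, e⟩ ∨
      ∃ k, B.sink j + (m + 1) • d.vec = B.sink k := by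
  induction n with
  | zero => exact absurd (by simp) (h.ne_sink hij)
  | succ n ih =>
    rcases h.eq_or_move with h' | ⟨hx, hs, h'⟩
    -- The direction `d` is a dummy, since the alternative of a sink does not involve it.
    · exact ⟨n, n.lt_succ_self, d, .inr ⟨i, h'⟩⟩
    · by_cases ht : L.turn i (B.sink j + (n + 1) • d.vec) d.opp = d.opp
      · rw [ht, Dir.vec_opp, succ_nsmul, ← add_assoc, add_neg_cancel_right] at h'
        obtain ⟨m, hm, h⟩ := ih h'
        exact ⟨m, by omega, h⟩
      · exact ⟨n, n.lt_succ_self, _, .inl (arrow_of_turn_ne ht)⟩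

/-- Packets of both foreign colors enter through the only cell between the sink and the side, and
both must be turned there, but a cell holds one arrow. The cell is no sink itself by `dist_ne_zero`.
-/
theorem IsPerfect.dist_ne_one (hL : L.IsPerfect) (j : Color) (d : Dir) :
    B.distBoundary (B.sink j) d ≠ 1 := by
  intro h
  have key : ∀ i, i ≠ j → ∃ e, L.arrow (B.sink j + d.vec) = some ⟨i, e⟩ := by
    intro i hij
    have h0 : B.distBoundary (B.sink j + d.vec) d = 0 := by rw [distBoundary_add_self, h]; rfl
    have hg : B.InGrid (B.sink j + d.vec) := by
      have := B.sink_mem j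
      cases d <;> simp [distBoundary, Dir.vec, Board.InGrid] at * <;> omega
    have := hL.delivered_of_dist hg h0 i
    obtain ⟨m, hm, e, h⟩ := Delivered.arrow_or i j hij 1 (by simpa using this)
    obtain rfl : m = 0 := by omega
    rcases h with h | ⟨k, h⟩
    · exact ⟨e, by simpa using h⟩
    · refine absurd h0 ?_
      rw [zero_add, one_smul] at h
      rw [h]
      exact hL.dist_ne_zero k d
  obtain ⟨a, b, hab, ha, hb⟩ := exists_pair_ne j
  obtain ⟨e, he⟩ := key a ha
  obtain ⟨e', he'⟩ := key b hb
  rw [he] at he'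
  simp only [Option.some.injEq, Arrow.mk.injEq] at he'
  exact hab he'.1

theorem IsPerfect.sinksAwayFromBoundary (hL : L.IsPerfect) : B.SinksAwayFromBoundary := by
  intro i d
  have h1 := hL.dist_ne_one i d
  have h2 := hL.dist_pos i d
  omega

/-- If a sink is two cells away from a side, the two cells contain arrows of the two other
colors. -/
theorem IsPerfect.arrow_of_dist_eq_two (hL : L.IsPerfect) {j : Color} {d : Dir}
    (h : B.distBoundary (B.sink j) d = 2) (e : Dir) :
    L.arrow (B.sink j + d.vec) ≠ some ⟨j, e⟩ ∧
      L.arrow (B.sink j + 2 • d.vec) ≠ some ⟨j, e⟩ := by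
  have h1 : B.distBoundary (B.sink j + d.vec) d = 1 := by rw [distBoundary_add_self, h]; rfl
  have h0 : B.distBoundary (B.sink j + 2 • d.vec) d = 0 := by
    rw [two_nsmul, ← add_assoc, distBoundary_add_self, h1]; rfl
  have hg : B.InGrid (B.sink j + 2 • d.vec) := by
    have := B.sink_mem j
    cases d <;> simp [distBoundary, Dir.vec, Board.InGrid] at * <;> omega
  have key : ∀ i, i ≠ j → ∃ m, m < 2 ∧
      ∃ e, L.arrow (B.sink j + (m + 1) • d.vec) = some ⟨i, e⟩ := by
    intro i hij
    obtain ⟨m, hm, e, h | ⟨k, h⟩⟩ :=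
      Delivered.arrow_or i j hij 2 (hL.delivered_of_dist hg h0 i)
    · exact ⟨m, hm, e, h⟩
    · exfalso
      have h3 := hL.sinksAwayFromBoundary k d
      rw [← h] at h3
      interval_cases m
      · rw [zero_add, one_smul, h1] at h3
        omega
      · rw [h0] at h3
        omega
  -- The two foreign colors occupy both cells, which leaves none for an arrow of color `j`.
  obtain ⟨a, b, hab, ha, hb⟩ := exists_pair_ne j
  obtain ⟨m, hm, e1, h2⟩ := key a ha
  obtain ⟨m', hm', e2, h3⟩ := key b hb
  have hne : m ≠ m' := by
    rintro rfl
    rw [h2] at h3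
    simp only [Option.some.injEq, Arrow.mk.injEq] at h3
    exact hab h3.1
  constructor <;> intro h4 <;> interval_cases m <;> interval_cases m' <;>
    simp_all

/-- Some arrow of its own color points at the sink `i`, from the side `d`. -/
def Feed (L : Layout B) (i : Color) (d : Dir) : Prop :=
  ∃ n : ℕ, L.arrow (B.sink i + (n + 1) • d.vec) = some ⟨i, d.opp⟩ ∧
    ∀ m ≤ n, B.InGrid (B.sink i + (m + 1) • d.vec) ∧ ¬ B.IsSink (B.sink i + (m + 1) • d.vec)

/-- The last arrow that changes the direction of the packet is a feed. Without such an arrow the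
packet flew straight into the sink, and `n` is the length of this flight. -/
theorem Delivered.straight_or_feed {i : Color} {x : Cell} {d : Dir} (h : L.Delivered i x d) :
    (∃ n : ℕ, x = B.sink i + n • d.opp.vec ∧ ∀ m < n, B.InGrid (B.sink i + (m + 1) • d.opp.vec) ∧
      ¬ B.IsSink (B.sink i + (m + 1) • d.opp.vec)) ∨ ∃ e, L.Feed i e := by
  induction h with
  | arrive d => exact .inl ⟨0, by simp, by simp⟩
  | move x d hx hs _ ih =>
    rcases ih with ⟨n, h, hn⟩ | h
    · have hx' : x = B.sink i + (n + 1) • (L.turn i x d).opp.vec := by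
        rw [succ_nsmul, ← add_assoc, ← h, Dir.vec_opp, add_neg_cancel_right]
      have hn' : ∀ m ≤ n, B.InGrid (B.sink i + (m + 1) • (L.turn i x d).opp.vec) ∧
          ¬ B.IsSink (B.sink i + (m + 1) • (L.turn i x d).opp.vec) := by
        intro m hm
        rcases hm.lt_or_eq with hm | rfl
        · exact hn m hm
        · rw [← hx']; exact ⟨hx, hs⟩
      by_cases ht : L.turn i x d = d
      · rw [ht] at hx' hn'
        exact .inl ⟨n + 1, hx', fun m hm => hn' m (by omega)⟩
      · refine .inr ⟨(L.turn i x d).opp, n, ?_, hn'⟩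
        rw [← hx', Dir.opp_opp]
        exact arrow_of_turn_ne ht
    · exact .inr h

/-- The packet that enters at a corner along the first row must turn somewhere, since no sink lies
in this row. -/
theorem IsPerfect.exists_feed (hL : L.IsPerfect) (i : Color) : ∃ d, L.Feed i d := by
  have h1 := hL.sinksAwayFromBoundary i .up
  have h2 := B.sink_mem i
  rcases (hL i (0, 0) .right (by simp only [Board.InGrid]; omega)
    (by simp [Board.InGrid, Dir.vec])).straight_or_feed with ⟨n, h, -⟩ | h
  · simp [distBoundary, Dir.opp, Dir.vec, Prod.ext_iff] at h1 h
    omega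
  · exact h

theorem IsPerfect.not_feed_of_dist (hL : L.IsPerfect) {i : Color} {d : Dir}
    (h : B.distBoundary (B.sink i) d = 2) : ¬ L.Feed i d := by
  rintro ⟨n, hn, hg⟩
  match n with
  | 0 => exact (hL.arrow_of_dist_eq_two h d.opp).1 (by simpa using hn)
  | 1 => exact (hL.arrow_of_dist_eq_two h d.opp).2 hn
  | n + 2 =>
    have := (inGrid_iff_distBoundary _).1 (hg 2 (by omega)).1 d
    rw [succ_nsmul, two_nsmul, ← add_assoc, ← add_assoc, distBoundary_add_self,
      distBoundary_add_self, distBoundary_add_self] at this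
    omega

theorem not_feed_of_isSink {i : Color} {d : Dir} (h : B.IsSink (B.sink i + d.vec)) :
    ¬ L.Feed i d := by
  rintro ⟨n, -, hg⟩
  exact (hg 0 (by omega)).2 (by simpa using h)

theorem IsPerfect.dist_ne_two_of_adjacent (hL : L.IsPerfect) {i j : Color} {d : Dir}
    (h : B.sink j = B.sink i + d.vec) : B.distBoundary (B.sink i) d ≠ 2 := by
  intro h2
  have := hL.sinksAwayFromBoundary j d
  rw [h, distBoundary_add_self] at this
  omega

/-- The adjacent sink can only lie towards the exceptional side, as it would be too close to any of
the other three. So no side is left for a feed. -/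
theorem IsPerfect.not_forbiddenA (hL : L.IsPerfect) : ¬ B.ForbiddenA := by
  rintro ⟨i, j, ⟨e, he⟩, d, hd⟩
  have hde : d = e := by
    by_contra hne
    exact hL.dist_ne_two_of_adjacent hd (he d hne)
  subst hde
  obtain ⟨f, hf⟩ := hL.exists_feed i
  by_cases hfd : f = d
  · subst hfd
    exact not_feed_of_isSink ⟨j, hd.symm⟩ hf
  · exact hL.not_feed_of_dist (he f hfd) hf

/-- Common core of the configurations (b) and (c): the two sides at distance two and the two
adjacent sinks are in four different directions, and none of them admits a feed. -/
theorem IsPerfect.false_of_two_dist_two_adjacent (hL : L.IsPerfect) {i j k : Color} (hjk : j ≠ k)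
    {d e : Dir} (hde : d ≠ e) (hd : B.distBoundary (B.sink i) d = 2)
    (he : B.distBoundary (B.sink i) e = 2) (hj : Adjacent (B.sink i) (B.sink j))
    (hk : Adjacent (B.sink i) (B.sink k)) : False := by
  obtain ⟨f, hf⟩ := hj
  obtain ⟨g, hg⟩ := hk
  have cover : ∀ d e f g x : Dir, d ≠ e → d ≠ f → d ≠ g → e ≠ f → e ≠ g → f ≠ g →
      x = d ∨ x = e ∨ x = f ∨ x = g := by decide
  obtain ⟨x, hx⟩ := hL.exists_feed i
  have h1 := hL.dist_ne_two_of_adjacent hf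
  have h2 := hL.dist_ne_two_of_adjacent hg
  rcases cover d e f g x hde (by rintro rfl; exact h1 hd) (by rintro rfl; exact h2 hd)
    (by rintro rfl; exact h1 he) (by rintro rfl; exact h2 he)
    (by rintro rfl; exact hjk (B.sink_injective (hf.trans hg.symm))) with rfl | rfl | rfl | rfl
  · exact hL.not_feed_of_dist hd hx
  · exact hL.not_feed_of_dist he hx
  · exact not_feed_of_isSink ⟨j, hf.symm⟩ hx
  · exact not_feed_of_isSink ⟨k, hg.symm⟩ hx

/-- The sink `i` can only be fed from the cell between it and `j`, which therefore holds an arrow of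
color `i`. The sink `j` is two cells away from the two lateral sides, so `k` must lie behind it, and
`j` can only be fed from the same cell, by an arrow of color `j`. -/
theorem IsPerfect.not_forbiddenD (hL : L.IsPerfect) : ¬ B.ForbiddenD := by
  rintro ⟨i, j, k, hik, ⟨e, he⟩, ⟨d, hd, hj⟩, f, hf⟩
  have hij : i ≠ j := by
    rintro rfl
    cases d <;> simp [Dir.vec, Prod.ext_iff] at hj <;> omega
  have hde : d = e := by
    by_contra hne
    have h1 := he d hne
    have h2 := hL.sinksAwayFromBoundary j d
    rw [hj, distBoundary_add_self, distBoundary_add_self] at h2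
    omega
  subst hde
  have hi : ∃ e, L.arrow (B.sink i + d.vec) = some ⟨i, e⟩ := by
    obtain ⟨g, hg⟩ := hL.exists_feed i
    by_cases hgd : g = d
    · subst hgd
      obtain ⟨n, hn, hc⟩ := hg
      match n with
      | 0 => exact ⟨g.opp, by simpa using hn⟩
      | n + 1 =>
        refine absurd ⟨j, ?_⟩ (hc 1 (by omega)).2
        rw [hj, two_nsmul, add_assoc]
    · exact absurd hg (hL.not_feed_of_dist (he g hgd))
  obtain ⟨e, hie⟩ := hi
  have hside : ∀ g, g ≠ d → g ≠ d.opp → B.distBoundary (B.sink j) g = 2 := by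
    intro g h1 h2
    rw [hj, distBoundary_add_of_ne _ h1 h2, distBoundary_add_of_ne _ h1 h2]
    exact he g h1
  have hfd : f = d := by
    by_contra hne
    by_cases hfo : f = d.opp
    · subst hfo
      refine hd ⟨k, ?_⟩
      rw [hf, hj, Dir.vec_opp, add_neg_cancel_right]
    · exact hL.dist_ne_two_of_adjacent hf (hside f hne hfo)
  subst hfd
  obtain ⟨g, hg⟩ := hL.exists_feed j
  by_cases hgf : g = f
  · subst hgf
    exact not_feed_of_isSink ⟨k, hf.symm⟩ hg
  · by_cases hgo : g = f.opp
    · subst hgo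
      obtain ⟨n, hn, hc⟩ := hg
      match n with
      | 0 =>
        rw [hj, zero_add, one_smul, Dir.vec_opp, add_neg_cancel_right, hie] at hn
        simp only [Option.some.injEq, Arrow.mk.injEq] at hn
        exact hij hn.1
      | n + 1 =>
        refine (hc 1 (by omega)).2 ⟨i, ?_⟩
        rw [hj, Dir.vec_opp, two_nsmul]
        abel
    · exact hL.not_feed_of_dist (hside g hgf hgo) hg

theorem IsPerfect.noForbiddenConfiguration (hL : L.IsPerfect) : B.NoForbiddenConfiguration := by
  refine ⟨hL.not_forbiddenA, ?_, ?_, hL.not_forbiddenD⟩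
  · rintro ⟨i, j, k, hjk, ⟨d, e, hde, -, h1, h2⟩, h3, h4⟩
    exact hL.false_of_two_dist_two_adjacent hjk hde h1 h2 h3 h4
  · rintro ⟨i, j, k, hjk, ⟨d, h1, h2⟩, h3, h4⟩
    exact hL.false_of_two_dist_two_adjacent hjk d.opp_ne.symm h1 h2 h3 h4

end Layout

end LoadingGame

/-! ### Necessity: counting arrows and the size bounds -/

namespace LoadingGame

open Board Layout Finset

variable {B : Board} {L : Layout B}

namespace Layout

/-- A packet that enters a line of the board must be turned aside before the line ends at the
opposite side or at a sink of another color. -/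
theorem IsPerfect.exists_turning (hL : L.IsPerfect) {i : Color} {x : Cell} {d : Dir}
    (hx : B.InGrid x) (hd : ¬ B.InGrid (x - d.vec)) (N : ℕ)
    (hs : ∀ t < N, ¬ B.IsSink (x + t • d.vec))
    (he : ¬ B.InGrid (x + N • d.vec) ∨ ∃ j ≠ i, x + N • d.vec = B.sink j) :
    ∃ t < N, ∃ e, L.arrow (x + t • d.vec) = some ⟨i, e⟩ ∧ e ≠ d ∧ e ≠ d.opp := by
  by_contra! H
  -- Without a sideways turn the packet can only move back and forth on the line. Positions are
  -- measured one step ahead, so that `t = 0` is the cell before `x`, outside the board, and `t = N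
  -- + 1` is the end of the segment. The packet stays in this range until it leaves the board or
  -- hits a foreign sink, so it is never delivered.
  have key : ∀ y e, L.Delivered i y e → ∀ t : ℕ, t ≤ N + 1 → y + d.vec = x + t • d.vec →
      (e = d ∨ e = d.opp) → False := by
    intro y e h
    induction h with
    | arrive e =>
      intro t ht hy _
      match t with
      | 0 =>
        refine hd ?_
        rw [zero_smul, add_zero] at hy
        rw [← hy, add_sub_cancel_right]
        exact B.sink_mem i
      | t + 1 =>
        rw [succ_nsmul, ← add_assoc, add_left_inj] at hy
        rcases (Nat.lt_succ_iff.1 ht).lt_or_eq with h | rfl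
        · exact hs t h ⟨i, hy.symm⟩
        · rcases he with he | ⟨j, hj, he⟩
          · exact he (hy ▸ B.sink_mem i)
          · exact hj (B.sink_injective (he.symm.trans hy.symm))
    | move y e hg hns _ ih =>
      intro t ht hy hde
      match t with
      | 0 =>
        refine hd ?_
        rw [zero_smul, add_zero] at hy
        rw [← hy, add_sub_cancel_right]
        exact hg
      | t + 1 =>
        rw [succ_nsmul, ← add_assoc, add_left_inj] at hy
        subst hy
        have htN : t < N := by
          rcases (Nat.lt_succ_iff.1 ht).lt_or_eq with h | rfl
          · exact h
          · rcases he with he | ⟨j, -, he⟩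
            · exact absurd hg he
            · exact absurd ⟨j, he⟩ hns
        have hturn : L.turn i (x + t • d.vec) e = d ∨ L.turn i (x + t • d.vec) e = d.opp := by
          by_cases hne : L.turn i (x + t • d.vec) e = e
          · rwa [hne]
          · have := H t htN _ (arrow_of_turn_ne hne)
            tauto
        rcases hturn with h | h
        · refine ih (t + 2) (by omega) ?_ (.inl h)
          rw [h, succ_nsmul, succ_nsmul]
          abel
        · refine ih t (by omega) ?_ (.inr h)
          rw [h, Dir.vec_opp, neg_add_cancel_right]
  have := hL i x d hx hd
  refine key x d this 1 (by omega) (by simp) (.inl rfl)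

/-- The color of the arrow in a cell. -/
def colorAt (L : Layout B) (x : Cell) : Color := ((L.arrow x).map Arrow.color).getD 0

theorem colorAt_of_arrow {x : Cell} {a : Arrow} (h : L.arrow x = some a) :
    L.colorAt x = a.color := by
  simp [colorAt, h]

/-- Different colors need different cells because `colorAt` is a function. The default color of an
empty cell therefore does no harm. -/
theorem card_le_of_forall_colorAt (K : Finset Color) (s : Finset Cell)
    (h : ∀ i ∈ K, ∃ x ∈ s, L.colorAt x = i) : #K ≤ #s := by
  refine le_trans (card_le_card fun i hi => ?_) (card_image_le (f := L.colorAt))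
  exact mem_image.2 (h i hi)

open Classical in
/-- The cells of the board that contain a vertical arrow. -/
noncomputable def verticalCells (L : Layout B) : Finset Cell :=
  (Ico (0 : ℤ) B.rows ×ˢ Ico (0 : ℤ) B.cols).filter fun x =>
    ∃ a, L.arrow x = some a ∧ (a.dir = .up ∨ a.dir = .down)

theorem mem_verticalCells {x : Cell} : x ∈ L.verticalCells ↔
    B.InGrid x ∧ ∃ a, L.arrow x = some a ∧ (a.dir = .up ∨ a.dir = .down) := by
  simp [verticalCells, Board.InGrid]

theorem mem_verticalCells_of_arrow {x : Cell} {i : Color} {e : Dir}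
    (h : L.arrow x = some ⟨i, e⟩) (h1 : e ≠ .left) (h2 : e ≠ .right) : x ∈ L.verticalCells := by
  refine mem_verticalCells.2 ⟨(L.arrow_mem x (by rw [h]; simp)).1, _, h, ?_⟩
  cases e <;> simp_all

theorem IsPerfect.exists_vertical_right (hL : L.IsPerfect) {i : Color} {r : ℤ}
    (hr : 0 ≤ r ∧ r < B.rows) (N : ℕ)
    (hs : ∀ c : ℤ, 0 ≤ c → c < N → ¬ B.IsSink (r, c))
    (he : N = B.cols ∨ ∃ j ≠ i, (r, (N : ℤ)) = B.sink j) :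
    ∃ x ∈ L.verticalCells, (x.1 = r ∧ x.2 < N) ∧ L.colorAt x = i := by
  have hpos : (0 : ℤ) < B.cols := by have := B.sink_mem i; omega
  have hcell : ∀ t : ℕ, ((r, 0) : Cell) + t • Dir.right.vec = (r, (t : ℤ)) := by
    intro t; simp [Dir.vec]
  obtain ⟨t, ht, e, h, h1, h2⟩ := hL.exists_turning (i := i) (x := (r, 0)) (d := .right)
    ⟨hr, le_rfl, hpos⟩ (by simp [Board.InGrid, Dir.vec]) N
    (fun t ht => by rw [hcell]; exact hs t (by omega) (by omega))
    (by
      rw [hcell]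
      rcases he with he | he
      · left; simp [Board.InGrid, he]
      · exact .inr he)
  rw [hcell] at h
  exact ⟨_, mem_verticalCells_of_arrow h h2 h1, ⟨rfl, by simpa using ht⟩, colorAt_of_arrow h⟩

theorem IsPerfect.exists_vertical_left (hL : L.IsPerfect) {i j : Color} (hij : j ≠ i)
    (hs : ∀ c : ℤ, (B.sink j).2 < c → ¬ B.IsSink ((B.sink j).1, c)) :
    ∃ x ∈ L.verticalCells, (x.1 = (B.sink j).1 ∧ (B.sink j).2 < x.2) ∧ L.colorAt x = i := by
  have hj := B.sink_mem j
  obtain ⟨N, hN⟩ := Int.eq_ofNat_of_zero_le (a := B.cols - 1 - (B.sink j).2) (by omega)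
  have hcell : ∀ t : ℕ, (((B.sink j).1, (B.cols : ℤ) - 1) : Cell) + t • Dir.left.vec =
      ((B.sink j).1, (B.cols : ℤ) - 1 - t) := by
    intro t; simp [Dir.vec]; ring
  obtain ⟨t, ht, e, h, h1, h2⟩ := hL.exists_turning (i := i)
    (x := ((B.sink j).1, (B.cols : ℤ) - 1)) (d := .left)
    ⟨hj.1, by dsimp only; omega, by dsimp only; omega⟩ (by simp [Board.InGrid, Dir.vec]) N
    (fun t ht => by rw [hcell]; exact hs _ (by omega))
    (by
      refine .inr ⟨j, hij, ?_⟩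
      rw [hcell]
      exact Prod.ext rfl (by dsimp only; omega))
  rw [hcell] at h
  exact ⟨_, mem_verticalCells_of_arrow h h1 h2, ⟨rfl, by dsimp only; omega⟩, colorAt_of_arrow h⟩

-- In a row with sinks let `a` be the leftmost and `b` the rightmost one, possibly the same. The two
-- colors other than `a` need vertical arrows to the left of `a`, and the two colors other than `b`
-- to the right of `b`; this makes four. In a row without sinks every color needs one.
open Classical in
theorem IsPerfect.row_bound (hL : L.IsPerfect) {r : ℤ} (hr : 0 ≤ r ∧ r < B.rows) :
    3 + (if ∃ i, (B.sink i).1 = r then 1 else 0) ≤ #(L.verticalCells.filter (·.1 = r)) := by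
  split
  · next h =>
    have hne : (univ.filter fun i => (B.sink i).1 = r).Nonempty := by
      obtain ⟨i, hi⟩ := h
      exact ⟨i, by simpa using hi⟩
    obtain ⟨a, ha, ha'⟩ := exists_min_image _ (fun i => (B.sink i).2) hne
    obtain ⟨b, hb, hb'⟩ := exists_max_image _ (fun i => (B.sink i).2) hne
    simp only [mem_filter, mem_univ, true_and] at ha ha' hb hb'
    have hga := B.sink_mem a
    obtain ⟨N, hN⟩ := Int.eq_ofNat_of_zero_le hga.2.1
    have h1 : #(univ.erase a) ≤
        #(L.verticalCells.filter fun x => x.1 = r ∧ x.2 < (B.sink a).2) := by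
      refine card_le_of_forall_colorAt (L := L) _ _ fun i hi => ?_
      obtain ⟨x, hx, hx', hxi⟩ := hL.exists_vertical_right (i := i) hr N
        (by
          rintro c - hc ⟨j, hj⟩
          have := ha' j (by rw [← hj])
          rw [← hj] at this
          dsimp only at this
          omega)
        (.inr ⟨a, (ne_of_mem_erase hi).symm, Prod.ext ha.symm hN.symm⟩)
      exact ⟨x, by simp only [mem_filter]; exact ⟨hx, hx'.1, by rw [hN]; exact hx'.2⟩, hxi⟩
    have h2 : #(univ.erase b) ≤
        #(L.verticalCells.filter fun x => x.1 = r ∧ (B.sink b).2 < x.2) := by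
      refine card_le_of_forall_colorAt (L := L) _ _ fun i hi => ?_
      obtain ⟨x, hx, hx', hxi⟩ := hL.exists_vertical_left (i := i) (ne_of_mem_erase hi).symm
        (by
          rintro c hc ⟨j, hj⟩
          have := hb' j (by rw [← hj, hb])
          rw [← hj] at this
          dsimp only at this
          omega)
      rw [hb] at hx'
      exact ⟨x, by simp only [mem_filter]; exact ⟨hx, hx'⟩, hxi⟩
    rw [card_erase_of_mem (mem_univ _), card_univ, Fintype.card_fin] at h1 h2
    have hab := ha' b hb
    have hdisj : Disjoint (L.verticalCells.filter fun x => x.1 = r ∧ x.2 < (B.sink a).2)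
        (L.verticalCells.filter fun x => x.1 = r ∧ (B.sink b).2 < x.2) := by
      refine disjoint_filter.2 fun x _ h3 h4 => ?_
      omega
    have h3 : #((L.verticalCells.filter fun x => x.1 = r ∧ x.2 < (B.sink a).2) ∪
        (L.verticalCells.filter fun x => x.1 = r ∧ (B.sink b).2 < x.2)) ≤
        #(L.verticalCells.filter (·.1 = r)) := by
      refine card_le_card fun x hx => ?_
      simp only [mem_union, mem_filter] at hx ⊢
      tauto
    rw [card_union_of_disjoint hdisj] at h3
    omega
  · next h =>
    have h1 : #(univ : Finset Color) ≤ #(L.verticalCells.filter (·.1 = r)) := by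
      refine card_le_of_forall_colorAt (L := L) _ _ fun i _ => ?_
      obtain ⟨x, hx, hx', hxi⟩ := hL.exists_vertical_right (i := i) hr B.cols
        (fun c _ _ ⟨j, hj⟩ => h ⟨j, by rw [← hj]⟩) (.inl rfl)
      exact ⟨x, by simp only [mem_filter]; exact ⟨hx, hx'.1⟩, hxi⟩
    simpa using h1

theorem IsPerfect.vertical_bound (hL : L.IsPerfect) :
    3 * B.rows + #(univ.image fun i => (B.sink i).1) ≤ #L.verticalCells := by
  classical
  have h1 : ∀ x ∈ L.verticalCells, x.1 ∈ Ico (0 : ℤ) B.rows := by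
    intro x hx
    have := (mem_verticalCells.1 hx).1.1
    simpa using this
  rw [card_eq_sum_card_fiberwise h1]
  calc _ ≤ ∑ r ∈ Ico (0 : ℤ) B.rows, (3 + if ∃ i, (B.sink i).1 = r then 1 else 0) := by
        rw [sum_add_distrib, sum_const, Int.card_Ico, sum_boole, smul_eq_mul]
        have : #(univ.image fun i => (B.sink i).1) ≤
            #((Ico (0 : ℤ) B.rows).filter fun r => ∃ i, (B.sink i).1 = r) := by
          refine card_le_card fun r hr => ?_
          obtain ⟨i, -, rfl⟩ := mem_image.1 hr
          have := (B.sink_mem i).1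
          simp only [mem_filter, mem_Ico]
          exact ⟨this, i, rfl⟩
        simp only [sub_zero, Int.toNat_natCast, Nat.cast_id]
        omega
    _ ≤ _ := sum_le_sum fun r hr => hL.row_bound (by simpa using hr)

/-- Counting the arrows of a perfect layout. -/
theorem IsPerfect.area_bound (hL : L.IsPerfect) :
    3 * B.rows + #(univ.image fun i => (B.sink i).1) +
      (3 * B.cols + #(univ.image fun i => (B.sink i).2)) + 3 ≤ B.rows * B.cols := by
  classical
  have h1 := hL.vertical_bound
  have h2 : 3 * B.cols + #(univ.image fun i => (B.sink i).2) ≤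
      #(B.transposeIso.layout L).verticalCells := (B.transposeIso.isPerfect hL).vertical_bound
  -- Vertical arrows of the transposed layout are horizontal arrows of `L`. The cells with vertical
  -- arrows, those with horizontal arrows and the sinks are disjoint sets of cells of the board.
  set H := ((B.transposeIso.layout L).verticalCells.image Prod.swap) with hH
  have hHmem : ∀ x ∈ H, B.InGrid x ∧ ∃ a, L.arrow x = some a ∧ (a.dir = .left ∨ a.dir = .right) := by
    intro x hx
    obtain ⟨y, hy, rfl⟩ := mem_image.1 hx
    obtain ⟨hy, a, ha, hd⟩ := mem_verticalCells.1 hy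
    refine ⟨hy.symm, ?_⟩
    have : (L.arrow y.swap).map (fun a => (⟨a.color, a.dir.transpose⟩ : Arrow)) = some a := ha
    rw [Option.map_eq_some_iff] at this
    obtain ⟨b, hb, rfl⟩ := this
    refine ⟨b, hb, ?_⟩
    revert hd
    cases b.dir <;> simp [Dir.transpose]
  have hHcard : #H = #(B.transposeIso.layout L).verticalCells :=
    card_image_of_injective _ Prod.swap_injective
  have d1 : Disjoint L.verticalCells H := by
    rw [disjoint_left]
    intro x hx hx'
    obtain ⟨-, a, ha, hd⟩ := mem_verticalCells.1 hx
    obtain ⟨-, b, hb, hd'⟩ := hHmem x hx'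
    rw [ha, Option.some_inj] at hb
    subst hb
    rcases hd with hd | hd <;> rw [hd] at hd' <;> simp at hd'
  have d2 : Disjoint (L.verticalCells ∪ H) (univ.image B.sink) := by
    rw [disjoint_left]
    intro x hx hx'
    obtain ⟨i, -, rfl⟩ := mem_image.1 hx'
    have : L.arrow (B.sink i) ≠ none := by
      rcases mem_union.1 hx with hx | hx
      · obtain ⟨-, a, ha, -⟩ := mem_verticalCells.1 hx
        simp [ha]
      · obtain ⟨-, a, ha, -⟩ := hHmem _ hx
        simp [ha]
    exact (L.arrow_mem _ this).2 ⟨i, rfl⟩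
  have h3 : #(L.verticalCells ∪ H ∪ univ.image B.sink) ≤
      #(Ico (0 : ℤ) B.rows ×ˢ Ico (0 : ℤ) B.cols) := by
    refine card_le_card fun x hx => ?_
    have : B.InGrid x := by
      simp only [mem_union] at hx
      rcases hx with (hx | hx) | hx
      · exact (mem_verticalCells.1 hx).1
      · exact (hHmem x hx).1
      · obtain ⟨i, -, rfl⟩ := mem_image.1 hx
        exact B.sink_mem i
    simpa [Board.InGrid] using this
  rw [card_union_of_disjoint d2, card_union_of_disjoint d1, hHcard,
    card_image_of_injective _ B.sink_injective, card_product] at h3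
  simp only [Int.card_Ico, sub_zero, Int.toNat_natCast, card_univ, Fintype.card_fin] at h3
  omega

theorem IsPerfect.rows_bound (hL : L.IsPerfect) :
    #(univ.image fun i => (B.sink i).1) + 4 ≤ B.rows := by
  have h := hL.sinksAwayFromBoundary
  have h1 : #(univ.image fun i => (B.sink i).1) ≤ #(Ico (2 : ℤ) (B.rows - 2)) := by
    refine card_le_card fun r hr => ?_
    obtain ⟨i, -, rfl⟩ := mem_image.1 hr
    have h1 := h i .up
    have h2 := h i .down
    simp only [distBoundary] at h1 h2
    rw [mem_Ico]
    omega
  -- One sink forces at least five rows, so the cardinality of the interval is not truncated.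
  have h2 := h 0 .up
  have h3 := h 0 .down
  simp only [distBoundary] at h2 h3
  rw [Int.card_Ico] at h1
  omega

theorem IsPerfect.cols_bound (hL : L.IsPerfect) :
    #(univ.image fun i => (B.sink i).2) + 4 ≤ B.cols :=
  (B.transposeIso.isPerfect hL).rows_bound

end Layout

theorem card_image_comp {h : Color → ℤ} (σ : Equiv.Perm (Fin 3)) {f : Fin 3 → ℤ}
    (hf : Function.Injective f) (p : Fin 3 → Fin 3) (hp : ∀ k, h (σ k) = f (p k)) :
    #(univ.image h) = #(univ.image p) := by
  rw [← card_image_of_injective (univ.image p) hf, image_image]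
  congr 1
  ext x
  simp only [mem_image, mem_univ, true_and, Function.comp_apply]
  constructor
  · rintro ⟨k, rfl⟩
    exact ⟨σ.symm k, by rw [← hp, Equiv.apply_symm_apply]⟩
  · rintro ⟨k, rfl⟩
    exact ⟨σ k, hp k⟩

/-- The numbers R and S of rows and columns with sinks depend on the type only, up to exchange. What
remains is to solve (m - 3)(n - 3) ≥ 12 + R + S with m ≥ R + 4 and n ≥ S + 4 in integers. -/
theorem Layout.IsPerfect.obeysSizeBounds (hL : L.IsPerfect) : B.ObeysSizeBounds := by
  rintro T ⟨σ, f, g, hf, hg, h⟩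
  have hf' : Function.Injective f := by
    rcases hf with hf | hf
    · exact hf.injective
    · exact hf.injective
  have hg' : Function.Injective g := by
    rcases hg with hg | hg
    · exact hg.injective
    · exact hg.injective
  have h1 := hL.area_bound
  have h2 := hL.rows_bound
  have h3 := hL.cols_bound
  have key : (#(univ.image fun i => (B.sink i).1) = #(univ.image fun k => (T.pattern k).1) ∧
        #(univ.image fun i => (B.sink i).2) = #(univ.image fun k => (T.pattern k).2)) ∨
      (#(univ.image fun i => (B.sink i).1) = #(univ.image fun k => (T.pattern k).2) ∧
        #(univ.image fun i => (B.sink i).2) = #(univ.image fun k => (T.pattern k).1)) := by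
    rcases h with h | h
    · exact .inl ⟨card_image_comp σ hf' _ fun k => by rw [h],
        card_image_comp σ hg' _ fun k => by rw [h]⟩
    · exact .inr ⟨card_image_comp σ hg' _ fun k => by rw [h],
        card_image_comp σ hf' _ fun k => by rw [h]⟩
  have hI : #(univ.image fun k => (SinkType.pattern .I k).1) = 3 ∧
      #(univ.image fun k => (SinkType.pattern .I k).2) = 1 := by decide
  have hC : #(univ.image fun k => (SinkType.pattern .C k).1) = 2 ∧
      #(univ.image fun k => (SinkType.pattern .C k).2) = 3 := by decide
  have hJ : #(univ.image fun k => (SinkType.pattern .J k).1) = 3 ∧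
      #(univ.image fun k => (SinkType.pattern .J k).2) = 2 := by decide
  have hK : #(univ.image fun k => (SinkType.pattern .L k).1) = 2 ∧
      #(univ.image fun k => (SinkType.pattern .L k).2) = 2 := by decide
  have hY : #(univ.image fun k => (SinkType.pattern .Y k).1) = 3 ∧
      #(univ.image fun k => (SinkType.pattern .Y k).2) = 3 := by decide
  have hS : #(univ.image fun k => (SinkType.pattern .slash k).1) = 3 ∧
      #(univ.image fun k => (SinkType.pattern .slash k).2) = 3 := by decide
  generalize #(univ.image fun i => (B.sink i).1) = R at *
  generalize #(univ.image fun i => (B.sink i).2) = S at *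
  -- If both sides are at least 9, every bound holds. Otherwise one side has few possible values,
  -- and fixing it makes the product linear.
  cases T <;> simp only [SizeBound, SizeAtLeast] <;> simp only [hI, hC, hJ, hK, hY, hS] at key <;>
    generalize B.rows = m at * <;> generalize B.cols = n at * <;>
    rcases le_or_gt m 8 with hm | hm <;> rcases le_or_gt n 8 with hn | hn <;>
    first
    | (interval_cases m <;> omega)
    | (interval_cases n <;> omega)
    | omega

end LoadingGame

/-! ### Insertion of empty rows and columns -/

namespace LoadingGame

open Board Layout

/-- The direction in which a horizontal grid line is crossed. -/
def crossDir (b : Bool) : Dir := if b then .down else .up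

/-- The cell entered by crossing, in column `c`, the line between the rows `k - 1` and `k`. -/
def crossCell (k c : ℤ) (b : Bool) : Cell := if b then (k, c) else (k - 1, c)

/-- The cell that corresponds to `x` after insertion of a row with number `k`. -/
def shift (k : ℤ) (x : Cell) : Cell := (if x.1 < k then x.1 else x.1 + 1, x.2)

/-- The inverse of `shift` away from row `k`. -/
def unshift (k : ℤ) (x : Cell) : Cell := (if x.1 < k then x.1 else x.1 - 1, x.2)

theorem unshift_shift (k : ℤ) (x : Cell) : unshift k (shift k x) = x := by
  refine Prod.ext ?_ rfl
  simp only [shift, unshift]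
  split_ifs <;> omega

theorem shift_unshift {k : ℤ} {x : Cell} (h : x.1 ≠ k) : shift k (unshift k x) = x := by
  refine Prod.ext ?_ rfl
  simp only [shift, unshift]
  split_ifs <;> omega

theorem shift_injective (k : ℤ) : Function.Injective (shift k) :=
  Function.LeftInverse.injective (unshift_shift k)

theorem shift_fst_ne (k : ℤ) (x : Cell) : (shift k x).1 ≠ k := by
  simp only [shift]
  split_ifs <;> omega

/-- A step across the line of insertion becomes two steps with a stop in the new row; every other
step carries over unchanged. -/
theorem shift_add (k : ℤ) (x : Cell) (d : Dir) : shift k x + d.vec = shift k (x + d.vec) ∨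
    ∃ b, d = crossDir b ∧ x + d.vec = crossCell k x.2 b ∧ shift k x + d.vec = (k, x.2) := by
  cases d
  · by_cases h : x.1 = k
    · exact .inr ⟨false, rfl, by simp [crossCell, Dir.vec, Prod.ext_iff, h]; ring,
        by simp [shift, Dir.vec, h]⟩
    · left
      simp only [shift, Dir.vec, Prod.ext_iff, Prod.fst_add, Prod.snd_add, and_true]
      split_ifs <;> omega
  · by_cases h : x.1 = k - 1
    · exact .inr ⟨true, rfl, by simp [crossCell, Dir.vec, Prod.ext_iff, h],
        by simp [shift, Dir.vec, h]⟩
    · left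
      simp only [shift, Dir.vec, Prod.ext_iff, Prod.fst_add, Prod.snd_add, and_true]
      split_ifs <;> omega
  · left
    simp [shift, Dir.vec]
  · left
    simp [shift, Dir.vec]

theorem new_add_crossDir (k c : ℤ) (b : Bool) :
    ((k, c) : Cell) + (crossDir b).vec = shift k (crossCell k c b) := by
  cases b <;> simp [shift, crossDir, crossCell, Dir.vec, Prod.ext_iff]
  ring

namespace Board

theorem ext_of_eq {B B' : Board} (h1 : B.rows = B'.rows) (h2 : B.cols = B'.cols)
    (h3 : B.sink = B'.sink) : B = B' := by
  cases B; cases B'; simp_all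

/-- Insertion of an empty row with number `k`. -/
def insertRow (B : Board) (k : ℤ) : Board where
  rows := B.rows + 1
  cols := B.cols
  sink i := shift k (B.sink i)
  sink_mem i := by
    have := B.sink_mem i
    simp only [shift]
    push_cast
    split_ifs <;> omega
  sink_injective := (shift_injective k).comp B.sink_injective

variable {B : Board} {k : ℤ}

theorem inGrid_insertRow (h0 : 0 ≤ k) (hk : k ≤ B.rows) (x : Cell) :
    (B.insertRow k).InGrid (shift k x) ↔ B.InGrid x := by
  simp only [Board.InGrid, insertRow, shift]
  push_cast
  split_ifs <;> omega

theorem isSink_insertRow (x : Cell) : (B.insertRow k).IsSink (shift k x) ↔ B.IsSink x := by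
  constructor
  · rintro ⟨j, hj⟩
    exact ⟨j, shift_injective k hj⟩
  · rintro ⟨j, rfl⟩
    exact ⟨j, rfl⟩

theorem not_isSink_new (c : ℤ) : ¬ (B.insertRow k).IsSink (k, c) := by
  rintro ⟨j, hj⟩
  exact shift_fst_ne k (B.sink j) (congrArg Prod.fst hj).symm

theorem inGrid_new (h0 : 0 ≤ k) (hk : k ≤ B.rows) (c : ℤ) :
    (B.insertRow k).InGrid (k, c) ↔ 0 ≤ c ∧ c < B.cols := by
  simp only [Board.InGrid, insertRow]
  push_cast
  omega

end Board

namespace Layout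

variable {B : Board} {L : Layout B}

/-- Packets of the three colors cross the line above row `k` in distinct columns. -/
def RowRich (L : Layout B) (k : ℤ) : Prop :=
  ∃ (c : Color → ℤ) (b : Color → Bool), Function.Injective c ∧
    ∀ i, L.Reach i (crossCell k (c i) (b i)) (crossDir (b i))

/-- Packets of the three colors cross the line to the left of column `k` in distinct rows. -/
def ColRich (L : Layout B) (k : ℤ) : Prop :=
  ∃ (c : Color → ℤ) (b : Color → Bool), Function.Injective c ∧
    ∀ i, L.Reach i (crossCell k (c i) (b i)).swap (crossDir (b i)).transpose

open Classical in
/-- The layout with an additional row `k` whose arrows lead packets of color `i` across the line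
above row `k` in column `c i`. -/
noncomputable def insertRow (L : Layout B) (k : ℤ) (c : Color → ℤ) (b : Color → Bool)
    (h0 : 0 ≤ k) (hk : k ≤ B.rows) (hc : ∀ i, 0 ≤ c i ∧ c i < B.cols) :
    Layout (B.insertRow k) where
  arrow y := if y.1 = k then
      -- The chosen color is the only possible one when `c` is injective, as in all applications.
      if h : ∃ i, c i = y.2 then some ⟨h.choose, crossDir (b h.choose)⟩ else none
    else L.arrow (unshift k y)
  arrow_mem y hy := by
    split_ifs at hy with h1 h2
    · obtain ⟨y1, y2⟩ := y
      obtain ⟨i, hi⟩ := h2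
      dsimp only at h1 hi
      subst h1 hi
      exact ⟨(inGrid_new h0 hk _).2 (hc i), not_isSink_new _⟩
    · exact absurd rfl hy
    · have := L.arrow_mem _ hy
      rwa [← inGrid_insertRow h0 hk, ← isSink_insertRow (k := k), shift_unshift h1] at this

section

variable {k : ℤ} {c : Color → ℤ} {b : Color → Bool} {h0 : 0 ≤ k} {hk : k ≤ B.rows}
  {hc : ∀ i, 0 ≤ c i ∧ c i < B.cols}

theorem insertRow_turn_shift (i : Color) (x : Cell) (d : Dir) :
    (L.insertRow k c b h0 hk hc).turn i (shift k x) d = L.turn i x d := by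
  simp [turn, insertRow, shift_fst_ne, unshift_shift]

theorem insertRow_turn_self (hinj : Function.Injective c) (i : Color) (d : Dir) :
    (L.insertRow k c b h0 hk hc).turn i (k, c i) d = crossDir (b i) := by
  refine turn_of_arrow ?_ d
  have h : ∃ j, c j = c i := ⟨i, rfl⟩
  have h' : h.choose = i := hinj h.choose_spec
  simp only [insertRow, if_true, dif_pos h, h']

theorem insertRow_turn_other {i : Color} {z : ℤ} (hz : z ≠ c i) (d : Dir) :
    (L.insertRow k c b h0 hk hc).turn i (k, z) d = d := by
  refine turn_of_forall_ne (fun e he => ?_) d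
  simp only [insertRow, if_true] at he
  split_ifs at he with h
  simp only [Option.some.injEq, Arrow.mk.injEq] at he
  exact hz (by rw [← he.1, h.choose_spec])

/-- In the new row an old packet meets an arrow of its own color only in column `c i`. A packet of
this color is already known to cross there in direction `b i`, and by `not_reach_opp` all of them
cross in the same direction, so the arrow changes nothing. -/
theorem insertRow_turn_cross (hL : L.IsPerfect) (hinj : Function.Injective c)
    (hr : ∀ i, L.Reach i (crossCell k (c i) (b i)) (crossDir (b i))) {i : Color} {z : ℤ}
    {e : Bool} (h : L.Reach i (crossCell k z e) (crossDir e)) :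
    (L.insertRow k c b h0 hk hc).turn i (k, z) (crossDir e) = crossDir e := by
  by_cases hz : z = c i
  · subst hz
    rw [insertRow_turn_self hinj]
    congr 1
    by_contra hne
    have key : L.Reach i (k, c i) .down → L.Reach i (k - 1, c i) .up → False := by
      intro h1 h2
      refine hL.not_reach_opp h1 ?_
      simpa [Dir.vec, Dir.opp] using h2
    have hri := hr i
    cases e <;> cases hb : b i <;> simp_all [crossCell, crossDir]
  · exact insertRow_turn_other hz _

theorem delivered_cross (hL : L.IsPerfect) (hinj : Function.Injective c)
    (hr : ∀ i, L.Reach i (crossCell k (c i) (b i)) (crossDir (b i))) {i : Color} {z : ℤ}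
    {e : Bool} (h : L.Reach i (crossCell k z e) (crossDir e))
    (hd : (L.insertRow k c b h0 hk hc).Delivered i (shift k (crossCell k z e)) (crossDir e)) :
    (L.insertRow k c b h0 hk hc).Delivered i (k, z) (crossDir e) := by
  have hg : 0 ≤ z ∧ z < B.cols := by
    have := (hL.delivered h).inGrid.2
    cases e <;> exact this
  refine .move _ _ ((inGrid_new h0 hk z).2 hg) (not_isSink_new z) ?_
  rw [insertRow_turn_cross hL hinj hr h, new_add_crossDir]
  exact hd

theorem delivered_shift (hL : L.IsPerfect) (hinj : Function.Injective c)
    (hr : ∀ i, L.Reach i (crossCell k (c i) (b i)) (crossDir (b i))) {i : Color} {x : Cell}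
    {d : Dir} (h : L.Reach i x d) :
    (L.insertRow k c b h0 hk hc).Delivered i (shift k x) d := by
  have hd := hL.delivered h
  induction hd with
  | arrive d => exact .arrive (B := B.insertRow k) (L := L.insertRow k c b h0 hk hc) d
  | move x d hx hs _ ih =>
    have h' := h.step _ _ hx hs
    have ih := ih h'
    refine .move _ _ ((inGrid_insertRow h0 hk x).2 hx) (mt (isSink_insertRow x).1 hs) ?_
    rw [insertRow_turn_shift]
    rcases shift_add k x (L.turn i x d) with h1 | ⟨e, he, h1, h2⟩
    · rwa [h1]
    · rw [h1] at ih h'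
      rw [he] at ih h' ⊢
      rw [he] at h2
      rw [h2]
      exact delivered_cross hL hinj hr h' ih

/-- The packet ignores foreign arrows until it comes to column `c i`, `t` cells ahead, where its
arrow puts it on an old trajectory. -/
theorem delivered_new_right (hL : L.IsPerfect) (hinj : Function.Injective c)
    (hr : ∀ i, L.Reach i (crossCell k (c i) (b i)) (crossDir (b i))) (i : Color) (t : ℕ)
    (ht : 0 ≤ c i - t) : (L.insertRow k c b h0 hk hc).Delivered i (k, c i - t) .right := by
  have hci := hc i
  induction t with
  | zero =>
    rw [Nat.cast_zero, sub_zero]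
    refine .move _ _ ((inGrid_new h0 hk _).2 hci) (not_isSink_new _) ?_
    rw [insertRow_turn_self hinj, new_add_crossDir]
    exact delivered_shift hL hinj hr (hr i)
  | succ t ih =>
    refine .move _ _ ((inGrid_new h0 hk _).2 (by omega)) (not_isSink_new _) ?_
    rw [insertRow_turn_other (by omega)]
    convert ih (by omega) using 1
    simp [Dir.vec, Prod.ext_iff]
    ring

theorem delivered_new_left (hL : L.IsPerfect) (hinj : Function.Injective c)
    (hr : ∀ i, L.Reach i (crossCell k (c i) (b i)) (crossDir (b i))) (i : Color) (t : ℕ)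
    (ht : c i + t < B.cols) : (L.insertRow k c b h0 hk hc).Delivered i (k, c i + t) .left := by
  have hci := hc i
  induction t with
  | zero =>
    rw [Nat.cast_zero, add_zero]
    refine .move _ _ ((inGrid_new h0 hk _).2 hci) (not_isSink_new _) ?_
    rw [insertRow_turn_self hinj, new_add_crossDir]
    exact delivered_shift hL hinj hr (hr i)
  | succ t ih =>
    refine .move _ _ ((inGrid_new h0 hk _).2 (by omega)) (not_isSink_new _) ?_
    rw [insertRow_turn_other (by omega)]
    convert ih (by omega) using 1
    simp [Dir.vec, Prod.ext_iff]
    ring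

theorem reach_top {z : ℤ} (hz : 0 ≤ z ∧ z < B.cols) (i : Color) : L.Reach i (0, z) .down := by
  have := B.sink_mem i
  refine .entry _ _ ⟨?_, hz⟩ ?_
  · dsimp only; omega
  · simp [Board.InGrid, Dir.vec]

theorem reach_bottom {z : ℤ} (hz : 0 ≤ z ∧ z < B.cols) (i : Color) :
    L.Reach i (B.rows - 1, z) .up := by
  have := B.sink_mem i
  refine .entry _ _ ⟨?_, hz⟩ ?_
  · dsimp only; omega
  · simp [Board.InGrid, Dir.vec]

theorem isPerfect_insertRow (hL : L.IsPerfect) (hinj : Function.Injective c)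
    (hr : ∀ i, L.Reach i (crossCell k (c i) (b i)) (crossDir (b i))) :
    (L.insertRow k c b h0 hk hc).IsPerfect := by
  intro i y d hy hd
  by_cases hyk : y.1 = k
  · obtain ⟨y1, z⟩ := y
    dsimp only at hyk
    subst hyk
    rw [inGrid_new h0 hk] at hy
    have hci := hc i
    cases d with
    | up =>
      -- A packet can enter the new row vertically from outside only if this row is outermost; it
      -- then proceeds through an old boundary edge.
      have hk' : y1 = B.rows := by
        simp only [Board.InGrid, Dir.vec, Board.insertRow] at hd
        push_cast at hd
        dsimp only [Prod.fst_sub, Prod.snd_sub] at hd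
        omega
      have h : L.Reach i (crossCell y1 z false) (crossDir false) := by
        simp only [crossCell, crossDir, hk']
        exact reach_bottom hy i
      exact delivered_cross hL hinj hr h (delivered_shift hL hinj hr h)
    | down =>
      have hk' : y1 = 0 := by
        simp only [Board.InGrid, Dir.vec, Board.insertRow] at hd
        push_cast at hd
        dsimp only [Prod.fst_sub, Prod.snd_sub] at hd
        omega
      have h : L.Reach i (crossCell y1 z true) (crossDir true) := by
        simp only [crossCell, crossDir, hk']
        exact reach_top hy i
      exact delivered_cross hL hinj hr h (delivered_shift hL hinj hr h)
    | left =>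
      have := delivered_new_left (h0 := h0) (hk := hk) (hc := hc) hL hinj hr i (z - c i).toNat
      have hz : z = B.cols - 1 := by
        have : ((y1, z) : Cell) - Dir.left.vec = (y1, z + 1) := by simp [Dir.vec]
        rw [this, inGrid_new h0 hk] at hd
        omega
      rw [Int.toNat_of_nonneg (by omega), add_sub_cancel] at this
      exact this (by omega)
    | right =>
      have := delivered_new_right (h0 := h0) (hk := hk) (hc := hc) hL hinj hr i (c i - z).toNat
      rw [Int.toNat_of_nonneg, sub_sub_cancel] at this
      · exact this (by omega)
      · have : ((y1, z) : Cell) - Dir.right.vec = (y1, z - 1) := by simp [Dir.vec]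
        rw [this, inGrid_new h0 hk] at hd
        omega
  · rw [← shift_unshift hyk] at hy hd ⊢
    generalize unshift k y = x at *
    rw [inGrid_insertRow h0 hk] at hy
    refine delivered_shift hL hinj hr (.entry _ _ hy fun h => hd ?_)
    rw [← inGrid_insertRow h0 hk] at h
    rcases shift_add k (x - d.vec) d with h1 | ⟨e, -, -, h2⟩
    · rw [sub_add_cancel] at h1
      rwa [← h1, add_sub_cancel_right]
    · rw [Board.InGrid] at *
      simp only [shift, Board.insertRow] at *
      push_cast at *
      cases d <;> simp [Dir.vec] at * <;> split_ifs at * <;> omega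

/-- The second part records the stop in the new row. It provides the upward crossings of the line
just below this row when the insertion is repeated. -/
theorem reach_insertRow (hL : L.IsPerfect) (hinj : Function.Injective c)
    (hr : ∀ i, L.Reach i (crossCell k (c i) (b i)) (crossDir (b i))) {i : Color} {x : Cell}
    {d : Dir} (h : L.Reach i x d) : (L.insertRow k c b h0 hk hc).Reach i (shift k x) d ∧
      ∀ e, d = crossDir e → x = crossCell k x.2 e →
        (L.insertRow k c b h0 hk hc).Reach i (k, x.2) d := by
  have cross : ∀ {z e}, L.Reach i (crossCell k z e) (crossDir e) →
      (L.insertRow k c b h0 hk hc).Reach i (k, z) (crossDir e) →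
      (L.insertRow k c b h0 hk hc).Reach i (shift k (crossCell k z e)) (crossDir e) := by
    intro z e h h'
    have hg : 0 ≤ z ∧ z < B.cols := by
      have := (hL.delivered h).inGrid.2
      cases e <;> exact this
    have := h'.step _ _ ((inGrid_new h0 hk z).2 hg) (not_isSink_new z)
    rwa [insertRow_turn_cross hL hinj hr h, new_add_crossDir] at this
  induction h with
  | entry x d hx hd =>
    have hnew : ∀ e, d = crossDir e → x = crossCell k x.2 e →
        (L.insertRow k c b h0 hk hc).Reach i (k, x.2) d := by
      obtain ⟨x1, z⟩ := x
      rintro e rfl hx'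
      cases e
      · have h1 : x1 = k - 1 := congrArg Prod.fst hx'
        have h2 : k = (B.insertRow k).rows - 1 := by
          simp [Board.InGrid, Dir.vec, crossDir, Board.insertRow] at hx hd ⊢
          omega
        have := reach_bottom (L := L.insertRow k c b h0 hk hc) hx.2 i
        rwa [← h2] at this
      · have h1 : x1 = k := congrArg Prod.fst hx'
        have h2 : k = 0 := by
          simp [Board.InGrid, Dir.vec, crossDir] at hx hd ⊢
          omega
        have := reach_top (L := L.insertRow k c b h0 hk hc) hx.2 i
        rwa [← h2] at this
    refine ⟨?_, hnew⟩
    rcases shift_add k (x - d.vec) d with h1 | ⟨e, rfl, h1, h2⟩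
    · rw [sub_add_cancel] at h1
      refine .entry _ _ ((inGrid_insertRow h0 hk x).2 hx) ?_
      rw [← h1, add_sub_cancel_right, inGrid_insertRow h0 hk]
      exact hd
    · have hz : (x - (crossDir e).vec).2 = x.2 := by cases e <;> simp [crossDir, Dir.vec]
      rw [sub_add_cancel, hz] at h1
      have h3 := hnew e rfl h1
      have h4 := Reach.entry (L := L) (i := i) _ _ hx hd
      generalize x.2 = z at *
      subst h1
      exact cross h4 h3
  | step x d h hx hs ih =>
    have h' := h.step _ _ hx hs
    have hR := ih.1.step _ _ ((inGrid_insertRow h0 hk x).2 hx) (mt (isSink_insertRow x).1 hs)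
    rw [insertRow_turn_shift] at hR
    generalize L.turn i x d = d' at *
    constructor
    · rcases shift_add k x d' with h1 | ⟨e, rfl, h1, h2⟩
      · rwa [← h1]
      · rw [h1] at h' ⊢
        rw [h2] at hR
        exact cross h' hR
    · rintro e rfl h1
      convert hR using 1
      have h2 := congrArg Prod.fst h1
      cases e <;> simp [crossDir, crossCell, Dir.vec, shift, Prod.ext_iff] at h2 ⊢ <;>
        split_ifs <;> omega

end

/-- A perfect layout into which rows and columns can be inserted everywhere, up to moving the place
of insertion within a gap between the sinks. -/
structure IsRich (L : Layout B) : Prop where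
  isPerfect : L.IsPerfect
  row : ∀ k : ℤ, 0 ≤ k → k ≤ B.rows → ∃ k' : ℤ, 0 ≤ k' ∧ k' ≤ B.rows ∧
    (∀ i, (B.sink i).1 < k ↔ (B.sink i).1 < k') ∧ L.RowRich k'
  col : ∀ k : ℤ, 0 ≤ k → k ≤ B.cols → ∃ k' : ℤ, 0 ≤ k' ∧ k' ≤ B.cols ∧
    (∀ i, (B.sink i).2 < k ↔ (B.sink i).2 < k') ∧ L.ColRich k'

theorem IsRich.transpose (hL : L.IsRich) : (B.transposeIso.layout L).IsRich where
  isPerfect := B.transposeIso.isPerfect hL.isPerfect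
  row k h0 h1 := by
    obtain ⟨k', h2, h3, h4, c, b, hc, hr⟩ := hL.col k h0 h1
    exact ⟨k', h2, h3, h4, c, b, hc, fun i => by
      have := B.transposeIso.reach (hr i)
      cases hb : b i <;> rw [hb] at this <;> exact this⟩
  col k h0 h1 := by
    obtain ⟨k', h2, h3, h4, c, b, hc, hr⟩ := hL.row k h0 h1
    exact ⟨k', h2, h3, h4, c, b, hc, fun i => B.transposeIso.reach (hr i)⟩

/-- Richness is preserved, and this is what allows the insertion to be iterated. Row crossings are
transported by `reach_insertRow`; column crossings only have their row numbers shifted. -/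
theorem IsRich.exists_insertRow (hL : L.IsRich) {k : ℤ} (h0 : 0 ≤ k) (hk : k ≤ B.rows) :
    ∃ L' : Layout (B.insertRow k), L'.IsRich := by
  obtain ⟨k', h0', hk', hkk', c, b, hinj, hr⟩ := hL.row k h0 hk
  -- All lines of one gap give the same board, so the insertion may be moved to a rich line.
  have hB : B.insertRow k = B.insertRow k' := by
    refine Board.ext_of_eq rfl rfl (funext fun i => Prod.ext ?_ rfl)
    have := hkk' i
    simp only [Board.insertRow, shift]
    split_ifs <;> omega
  rw [hB]
  clear hB hkk' h0 hk
  have hc : ∀ i, 0 ≤ c i ∧ c i < B.cols := by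
    intro i
    have := (hL.isPerfect.delivered (hr i)).inGrid.2
    unfold crossCell at this
    split_ifs at this <;> exact this
  have hP := hL.isPerfect
  refine ⟨L.insertRow k' c b h0' hk' hc, isPerfect_insertRow hP hinj hr, ?_, ?_⟩
  · intro q hq0 hq1
    rw [show ((B.insertRow k').rows : ℤ) = B.rows + 1 from rfl] at *
    -- Both lines that bound the new row stem from the old line `k'`. They are in the same gap, so
    -- it suffices to serve the lower one.
    obtain ⟨p, hp0, hp1, hp2, c', b', hinj', hr'⟩ := hL.row (if q ≤ k' then q else q - 1)
      (by split_ifs <;> omega) (by split_ifs <;> omega)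
    refine ⟨if p < k' then p else p + 1, by split_ifs <;> omega, by split_ifs <;> omega, ?_,
      c', b', hinj', ?_⟩
    · intro i
      have := hp2 i
      simp only [Board.insertRow, shift]
      split_ifs at this ⊢ <;> omega
    · intro i
      have h1 := reach_insertRow (h0 := h0') (hk := hk') (hc := hc) hP hinj hr (hr' i)
      -- A packet crossing the line below the new row upwards enters a cell of the new row, which is
      -- not the shift of an old cell.
      by_cases hpk : p = k' ∧ b' i = false
      · obtain ⟨rfl, hb⟩ := hpk
        have := h1.2 (b' i) rfl (by rw [hb]; rfl)
        rw [hb] at this ⊢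
        simpa [crossCell] using this
      · convert h1.1 using 1
        have : ¬ p = k' ∨ b' i = true := by
          rw [← Bool.not_eq_false]
          tauto
        cases hb : b' i <;> simp [crossCell, shift, hb] at this ⊢ <;> split_ifs <;> omega
  · intro q hq0 hq1
    obtain ⟨p, hp0, hp1, hp2, c', b', hinj', hr'⟩ := hL.col q hq0 hq1
    refine ⟨p, hp0, hp1, hp2, fun i => if c' i < k' then c' i else c' i + 1, b', ?_, ?_⟩
    · intro i j hij
      refine hinj' ?_
      dsimp only at hij
      split_ifs at hij <;> omega
    · intro i
      convert (reach_insertRow (h0 := h0') (hk := hk') (hc := hc) hP hinj hr (hr' i)).1 using 1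
      cases b' i <;> simp [crossCell, shift]

end Layout

/-! ### Stretching boards with rich layouts -/

/-- The board has a rich perfect layout. -/
def Board.Rich (B : Board) : Prop := ∃ L : Layout B, L.IsRich

namespace Board

theorem Rich.hasPerfectLayout {B : Board} (h : B.Rich) : B.HasPerfectLayout :=
  let ⟨L, hL⟩ := h
  ⟨L, hL.isPerfect⟩

theorem Rich.transpose {B : Board} (h : B.Rich) : B.transpose.Rich :=
  let ⟨_, hL⟩ := h
  ⟨_, hL.transpose⟩

theorem Rich.insertRow {B : Board} (h : B.Rich) {k : ℤ} (h0 : 0 ≤ k) (hk : k ≤ B.rows) :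
    (B.insertRow k).Rich :=
  let ⟨_, hL⟩ := h
  hL.exists_insertRow h0 hk

/-- A rich layout can be stretched vertically. -/
theorem Rich.stretch_rows {B₀ B : Board} (h : B₀.Rich) (hc : B.cols = B₀.cols)
    (hs : ∀ i, (B.sink i).2 = (B₀.sink i).2) (h0 : ∀ i, (B₀.sink i).1 ≤ (B.sink i).1)
    (h1 : ∀ i, (B.sink i).1 - (B₀.sink i).1 ≤ (B.rows : ℤ) - B₀.rows)
    (hm : ∀ i j, (B₀.sink i).1 ≤ (B₀.sink j).1 →
      (B.sink i).1 - (B₀.sink i).1 ≤ (B.sink j).1 - (B₀.sink j).1) : B.Rich := by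
  obtain ⟨M, hM⟩ : ∃ M : ℕ, (B.rows : ℤ) = B₀.rows + M := by
    have h2 := h0 0
    have h3 := h1 0
    exact ⟨B.rows - B₀.rows, by omega⟩
  induction M generalizing B₀ with
  | zero =>
    have : B = B₀ := by
      refine ext_of_eq (by omega) hc (funext fun i => Prod.ext ?_ (hs i))
      have h2 := h0 i
      have h3 := h1 i
      omega
    rwa [this]
  | succ M ih =>
    -- Insert a row just above the topmost sink that still has to move by the full `M + 1` rows, or
    -- at the bottom if there is none. By monotonicity exactly the sinks with this displacement are
    -- moved.
    have hk : ∃ k : ℤ, 0 ≤ k ∧ k ≤ B₀.rows ∧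
        ∀ i, (B₀.sink i).1 < k ↔ (B.sink i).1 - (B₀.sink i).1 ≤ M := by
      rcases (Finset.univ.filter fun i => M < (B.sink i).1 - (B₀.sink i).1).eq_empty_or_nonempty
        with he | hne
      · refine ⟨B₀.rows, by omega, le_rfl, fun i => ?_⟩
        have h2 := (B₀.sink_mem i).1.2
        have h3 : i ∉ (Finset.univ.filter fun i => M < (B.sink i).1 - (B₀.sink i).1) := by
          rw [he]; simp
        simp only [Finset.mem_filter, Finset.mem_univ, true_and] at h3
        omega
      · obtain ⟨a, ha, ha'⟩ := Finset.exists_min_image _ (fun i => (B₀.sink i).1) hne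
        simp only [Finset.mem_filter, Finset.mem_univ, true_and] at ha ha'
        have h2 := (B₀.sink_mem a).1
        refine ⟨(B₀.sink a).1, h2.1, h2.2.le, fun i => ?_⟩
        have h3 := ha' i
        have h4 := hm a i
        omega
    obtain ⟨k, hk0, hk1, hk2⟩ := hk
    refine ih (h.insertRow hk0 hk1) hc hs ?_ ?_ ?_ ?_
    · intro i
      have h2 := hk2 i
      have h3 := h0 i
      simp only [Board.insertRow, shift]
      split_ifs <;> omega
    · intro i
      have h2 := hk2 i
      have h3 := h1 i
      simp only [Board.insertRow, shift]
      push_cast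
      split_ifs <;> omega
    · intro i j
      have h2 := hk2 i
      have h3 := hk2 j
      have h4 := hm i j
      have h5 := h1 i
      simp only [Board.insertRow, shift]
      split_ifs <;> omega
    · simp only [Board.insertRow]
      push_cast
      omega

/-- A rich layout can be stretched in both directions. -/
theorem Rich.stretch {B₀ B : Board} (h : B₀.Rich)
    (h0 : ∀ i, (B₀.sink i).1 ≤ (B.sink i).1)
    (h1 : ∀ i, (B.sink i).1 - (B₀.sink i).1 ≤ (B.rows : ℤ) - B₀.rows)
    (hm : ∀ i j, (B₀.sink i).1 ≤ (B₀.sink j).1 →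
      (B.sink i).1 - (B₀.sink i).1 ≤ (B.sink j).1 - (B₀.sink j).1)
    (h0' : ∀ i, (B₀.sink i).2 ≤ (B.sink i).2)
    (h1' : ∀ i, (B.sink i).2 - (B₀.sink i).2 ≤ (B.cols : ℤ) - B₀.cols)
    (hm' : ∀ i j, (B₀.sink i).2 ≤ (B₀.sink j).2 →
      (B.sink i).2 - (B₀.sink i).2 ≤ (B.sink j).2 - (B₀.sink j).2) : B.Rich := by
  -- The intermediate board has the new rows and the old columns. Its sinks are distinct: equal old
  -- columns force equal displacements, hence equal new columns.
  have hinj : Function.Injective fun i => ((B.sink i).1, (B₀.sink i).2) := by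
    intro i j hij
    simp only [Prod.mk.injEq] at hij
    refine B.sink_injective (Prod.ext hij.1 ?_)
    have h2 := hm' i j
    have h3 := hm' j i
    omega
  let B₁ : Board :=
    { rows := B.rows
      cols := B₀.cols
      sink := fun i => ((B.sink i).1, (B₀.sink i).2)
      sink_mem := fun i => ⟨(B.sink_mem i).1, (B₀.sink_mem i).2⟩
      sink_injective := hinj }
  have hB₁ : B₁.Rich := h.stretch_rows rfl (fun _ => rfl) h0 h1 hm
  exact (hB₁.transpose.stretch_rows (B := B.transpose) rfl (fun _ => rfl) h0' h1' hm').transpose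

end Board

end LoadingGame

/-! ### Numerical encoding and verification of layouts -/

namespace LoadingGame

open Board Layout

/-- The direction with a given number. -/
def dirOf : ℕ → Dir
  | 0 => .up
  | 1 => .down
  | 2 => .left
  | _ => .right

/-- The numerical description of a board with a layout.  Rows and columns are counted from `1`.
The cell in row `r` and column `c` corresponds to a hexadecimal digit of `code`, which is `0` for an
empty cell, `13` for a sink and `1 + 4 * i + d` for an arrow of color `i` and direction number
`d`. -/
structure Spec where
  rows : ℕ
  cols : ℕ
  sinkRow : Color → ℕ
  sinkCol : Color → ℕ
  code : ℕ

namespace Spec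

variable (S : Spec)

/-- The code of a cell. -/
def digit (r c : ℕ) : ℕ := Nat.mod (Nat.shiftRight S.code (Nat.mul 4 (Nat.add (Nat.mul (Nat.pred r) S.cols) (Nat.pred c)))) 16

/-- The arrow with a given code. -/
def decode (v : ℕ) : Option Arrow :=
  if 1 ≤ v ∧ v ≤ 12 then some ⟨Fin.ofNat 3 ((v - 1) / 4), dirOf ((v - 1) % 4)⟩ else none

/-- The direction in which a packet of color `i` leaves a cell with code `v`. -/
def codeTurn (i v : ℕ) (d : Dir) : Dir :=
  cond ((Nat.ble (Nat.succ (Nat.mul 4 i)) v).and (Nat.ble v (Nat.add (Nat.mul 4 i) 4)))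
    (dirOf (Nat.sub v (Nat.succ (Nat.mul 4 i)))) d

/-- The cell lies in the board and is no sink. -/
def free (r c : ℕ) : Bool :=
  (Nat.ble 1 r).and <| (Nat.ble r S.rows).and <| (Nat.ble 1 c).and <| (Nat.ble c S.cols).and <|
    (Nat.beq (S.digit r c) 13).not

/-- Application to a number that is first evaluated. -/
def force (k : ℕ → Bool) : ℕ → Bool
  | 0 => k 0
  | n + 1 => k (Nat.succ n)

/-- Continuation with the state after a move. -/
def advance (k : ℕ → ℕ → Dir → Bool) (r c : ℕ) : Dir → Bool
  | .up => force (fun s => k s c .up) (Nat.pred r)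
  | .down => force (fun s => k s c .down) (Nat.succ r)
  | .left => force (fun s => k r s .left) (Nat.pred c)
  | .right => force (fun s => k r s .right) (Nat.succ c)

/-- The packet reaches its sink within the given number of steps. -/
def run (i a b : ℕ) : ℕ → ℕ → ℕ → Dir → Bool
  | 0, _, _, _ => false
  | t + 1, r, c, d =>
    ((Nat.beq r a).and (Nat.beq c b)).or <| (S.free r c).and <|
      advance (run i a b t) r c (codeTurn i (S.digit r c) d)

/-- The packet passes through the state `(a, b, g)` within the given number of steps. -/
def visits (i a b : ℕ) (g : Dir) : ℕ → ℕ → ℕ → Dir → Bool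
  | 0, _, _, _ => false
  | t + 1, r, c, d =>
    ((Nat.beq r a).and <| (Nat.beq c b).and (decide (d = g))).or <| (S.free r c).and <|
      advance (visits i a b g t) r c (codeTurn i (S.digit r c) d)

/-- A predicate holds for the numbers from `1` to `n`. -/
def allUpTo (p : ℕ → Bool) : ℕ → Bool
  | 0 => true
  | n + 1 => (p (n + 1)).and (allUpTo p n)

/-- All packets of color `i` are delivered. -/
def deliversAll (i : Color) : Bool :=
  -- The number 70 limits the steps of a simulation. Exceeding it makes the verification fail, so
  -- soundness does not depend on it.
  (allUpTo (fun c => (S.run i (S.sinkRow i) (S.sinkCol i) 70 1 c .down).and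
    (S.run i (S.sinkRow i) (S.sinkCol i) 70 S.rows c .up)) S.cols).and
  (allUpTo (fun r => (S.run i (S.sinkRow i) (S.sinkCol i) 70 r 1 .right).and
    (S.run i (S.sinkRow i) (S.sinkCol i) 70 r S.cols .left)) S.rows)

/-- The packet of color `i` that enters in direction `d` through the `p`-th edge passes through the
given state. -/
def visitsFrom (i : Color) (d : Dir) (p a b : ℕ) (g : Dir) : Bool :=
  match d with
  | .down => (Nat.ble p S.cols).and (S.visits i a b g 70 1 p .down)
  | .up => (Nat.ble p S.cols).and (S.visits i a b g 70 S.rows p .up)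
  | .right => (Nat.ble p S.rows).and (S.visits i a b g 70 p 1 .right)
  | .left => (Nat.ble p S.rows).and (S.visits i a b g 70 p S.cols .left)

/-- Hexadecimal digits. -/
def hex (x n : ℕ) : ℕ := (x >>> (4 * n)) % 16

/-- `x` codes a line number `k`, and for every color a column in which a packet crosses the line
above the `k`-th row, the direction of crossing and the edge where the packet enters. -/
def rowCut (x : ℕ) : Bool :=
  (Nat.ble (hex x 0) S.rows).and <|
  (decide (∀ i j : Color, hex x (3 * i + 1) = hex x (3 * j + 1) → i = j)).and <|
  -- The three digits of a color are the column, twice the number of the entry direction plus a bit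
  -- for the crossing, and the entry edge. With rows counted from 1, a packet crossing line `k`
  -- downwards (bit 1) enters row `k + 1` and one crossing it upwards enters row `k`; this explains
  -- the sum of line number and bit.
  decide (∀ i : Color,
    1 ≤ hex x (3 * i + 3) ∧ S.visitsFrom i (dirOf (hex x (3 * i + 2) / 2)) (hex x (3 * i + 3))
      (hex x 0 + hex x (3 * i + 2) % 2) (hex x (3 * i + 1))
      (bif Nat.beq (hex x (3 * i + 2) % 2) 1 then .down else .up) = true)

/-- The analogue of `rowCut` for columns. -/
def colCut (x : ℕ) : Bool :=
  (Nat.ble (hex x 0) S.cols).and <|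
  (decide (∀ i j : Color, hex x (3 * i + 1) = hex x (3 * j + 1) → i = j)).and <|
  decide (∀ i : Color,
    1 ≤ hex x (3 * i + 3) ∧ S.visitsFrom i (dirOf (hex x (3 * i + 2) / 2)) (hex x (3 * i + 3))
      (hex x (3 * i + 1)) (hex x 0 + hex x (3 * i + 2) % 2)
      (bif Nat.beq (hex x (3 * i + 2) % 2) 1 then .right else .left) = true)

/-- Every line number in `1, …, n - 1` is outside of the sinks or equivalent to one from the
list. -/
def cutsSuffice (sink : Color → ℕ) (cuts : List ℕ) (n : ℕ) : Bool :=
  -- Here `k` stands for the line `k - 1`, hence the bound `n + 1`, whereas `hex x 0` is a line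
  -- number itself. This is why one comparison is strict and the other is not.
  allUpTo (fun k => (decide (∀ i, k ≤ sink i)).or <| (decide (∀ i, sink i < k)).or <|
    cuts.any fun x => decide (∀ i, sink i < k ↔ sink i ≤ hex x 0)) (n + 1)

/-- The complete verification of a layout. -/
def check (rowCuts colCuts : List ℕ) : Bool :=
  (Nat.ble 3 S.rows).and <| (Nat.ble 3 S.cols).and <|
  (decide (∀ i, 1 ≤ S.sinkRow i ∧ S.sinkRow i ≤ S.rows ∧ 1 ≤ S.sinkCol i ∧ S.sinkCol i ≤ S.cols ∧
    S.digit (S.sinkRow i) (S.sinkCol i) = 13)).and <|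
  (decide (∀ i j, S.sinkRow i = S.sinkRow j → S.sinkCol i = S.sinkCol j → i = j)).and <|
  (decide (∀ i, S.deliversAll i = true)).and <|
  (cutsSuffice S.sinkRow rowCuts S.rows).and <| (cutsSuffice S.sinkCol colCuts S.cols).and <|
  (rowCuts.all S.rowCut).and (colCuts.all S.colCut)

end Spec

/-- A spread of the pattern of a type, given by the numbers of empty rows and columns in the gaps,
together with a layout. -/
structure Entry where
  rowGaps : List ℕ
  colGaps : List ℕ
  code : ℕ
  rowCuts : List ℕ
  colCuts : List ℕ

/-- The position, counted from `0`, of the line with number `t` after the gap number `t`. -/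
def linePos (u : List ℕ) (t : ℕ) : ℕ := (u.take (t + 1)).sum + t

/-- The description of the board and layout of a table entry. -/
def Entry.spec (T : SinkType) (e : Entry) : Spec where
  rows := linePos e.rowGaps (e.rowGaps.length - 1)
  cols := linePos e.colGaps (e.colGaps.length - 1)
  sinkRow i := linePos e.rowGaps (T.pattern i).1 + 1
  sinkCol i := linePos e.colGaps (T.pattern i).2 + 1
  code := e.code

/-- The verification of a table entry. -/
def Entry.check (T : SinkType) (e : Entry) : Bool :=
  (e.spec T).check e.rowCuts e.colCuts

end LoadingGame

/-! ### Soundness of the numerical verification -/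

namespace LoadingGame

open Board Layout

/-- The cell in row `r` and column `c`, counted from `1`. -/
def toCell (r c : ℕ) : Cell := ((r : ℤ) - 1, (c : ℤ) - 1)

theorem exists_toCell {x : Cell} (h1 : 0 ≤ x.1) (h2 : 0 ≤ x.2) :
    ∃ r c : ℕ, 1 ≤ r ∧ 1 ≤ c ∧ x = toCell r c :=
  ⟨(x.1 + 1).toNat, (x.2 + 1).toNat, by omega, by omega,
    Prod.ext (by simp only [toCell]; omega) (by simp only [toCell]; omega)⟩

namespace Spec

theorem allUpTo_eq_true {p : ℕ → Bool} {n : ℕ} (h : allUpTo p n = true) {k : ℕ} (h1 : 1 ≤ k)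
    (hk : k ≤ n) : p k = true := by
  induction n with
  | zero => omega
  | succ n ih =>
    simp only [allUpTo, Bool.and_eq_true] at h
    rcases hk.lt_or_eq with hk | rfl
    · exact ih h.2 (by omega)
    · exact h.1

theorem force_eq (k : ℕ → Bool) (n : ℕ) : force k n = k n := by
  cases n <;> rfl

theorem advance_eq (k : ℕ → ℕ → Dir → Bool) {r c : ℕ} (hr : 1 ≤ r) (hc : 1 ≤ c) (d : Dir) :
    ∃ r' c', advance k r c d = k r' c' d ∧ toCell r c + d.vec = toCell r' c' := by
  cases d <;> simp only [advance, force_eq]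
  · exact ⟨_, _, rfl, by simp [toCell, Dir.vec, Nat.cast_pred hr]; ring⟩
  · exact ⟨_, _, rfl, by simp [toCell, Dir.vec]⟩
  · exact ⟨_, _, rfl, by simp [toCell, Dir.vec, Nat.cast_pred hc]; ring⟩
  · exact ⟨_, _, rfl, by simp [toCell, Dir.vec]⟩

theorem decode_turn (v : Fin 16) (i : Color) (d : Dir) :
    (match decode v with
      | none => d
      | some a => if a.color = i then a.dir else d) = codeTurn i v d := by
  revert v i d
  decide

variable {S : Spec}

theorem digit_lt (r c : ℕ) : S.digit r c < 16 := Nat.mod_lt _ (by norm_num)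

theorem free_iff {r c : ℕ} : S.free r c = true ↔
    1 ≤ r ∧ r ≤ S.rows ∧ 1 ≤ c ∧ c ≤ S.cols ∧ S.digit r c ≠ 13 := by
  cases hb : Nat.beq (S.digit r c) 13
  · simp [free, hb, Nat.ne_of_beq_eq_false hb]
  · simp [free, Nat.eq_of_beq_eq_true hb]

/-- The data describe sinks in distinct cells of the board. -/
structure Valid (S : Spec) : Prop where
  sink : ∀ i, 1 ≤ S.sinkRow i ∧ S.sinkRow i ≤ S.rows ∧ 1 ≤ S.sinkCol i ∧ S.sinkCol i ≤ S.cols ∧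
    S.digit (S.sinkRow i) (S.sinkCol i) = 13
  inj : ∀ i j, S.sinkRow i = S.sinkRow j → S.sinkCol i = S.sinkCol j → i = j

/-- The board that is described. -/
def board (S : Spec) (h : S.Valid) : Board where
  rows := S.rows
  cols := S.cols
  sink i := toCell (S.sinkRow i) (S.sinkCol i)
  sink_mem i := by
    have := h.sink i
    simp only [toCell]
    omega
  sink_injective i j hij := by
    simp only [toCell, Prod.mk.injEq] at hij
    exact h.inj i j (by omega) (by omega)

open Classical in
/-- The layout that is described. -/
noncomputable def layout (S : Spec) (h : S.Valid) : Layout (S.board h) where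
  arrow x := if (S.board h).InGrid x ∧ ¬ (S.board h).IsSink x then
    decode (S.digit (x.1 + 1).toNat (x.2 + 1).toNat) else none
  arrow_mem x hx := by
    by_contra hc
    exact hx (if_neg hc)

variable {h : S.Valid}

theorem inGrid_toCell {r c : ℕ} (hr : 1 ≤ r) (hr' : r ≤ S.rows) (hc : 1 ≤ c) (hc' : c ≤ S.cols) :
    (S.board h).InGrid (toCell r c) := by
  simp only [Board.InGrid, board, toCell]
  omega

theorem not_isSink_toCell {r c : ℕ} (hd : S.digit r c ≠ 13) :
    ¬ (S.board h).IsSink (toCell r c) := by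
  rintro ⟨j, hj⟩
  simp only [board, toCell, Prod.mk.injEq] at hj
  refine hd ?_
  rw [← (h.sink j).2.2.2.2]
  congr 1 <;> omega

theorem layout_turn {r c : ℕ} (hf : S.free r c = true) (i : Color) (d : Dir) :
    (S.layout h).turn i (toCell r c) d = codeTurn i (S.digit r c) d := by
  obtain ⟨hr, hr', hc, hc', hd⟩ := free_iff.1 hf
  have h1 : (S.layout h).arrow (toCell r c) = decode (S.digit r c) := by
    have : (S.board h).InGrid (toCell r c) ∧ ¬ (S.board h).IsSink (toCell r c) :=
      ⟨inGrid_toCell hr hr' hc hc', not_isSink_toCell hd⟩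
    simp only [layout]
    rw [if_pos this]
    simp only [toCell, sub_add_cancel, Int.toNat_natCast]
  have := decode_turn ⟨S.digit r c, digit_lt r c⟩ i d
  rw [← this]
  unfold turn
  rw [h1]

theorem delivered_of_run {i : Color} {t : ℕ} : ∀ {r c : ℕ} {d : Dir},
    S.run i (S.sinkRow i) (S.sinkCol i) t r c d = true →
      (S.layout h).Delivered i (toCell r c) d := by
  induction t with
  | zero => intro r c d hr; simp [run] at hr
  | succ t ih =>
    intro r c d hr
    simp only [run, Bool.or_eq_true, Bool.and_eq_true, Nat.beq_eq] at hr
    rcases hr with ⟨rfl, rfl⟩ | ⟨hf, hr⟩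
    · exact .arrive (B := S.board h) d
    · obtain ⟨h1, h1', h2, h2', h3⟩ := free_iff.1 hf
      obtain ⟨r', c', h4, h5⟩ := advance_eq (run S i (S.sinkRow i) (S.sinkCol i) t) h1 h2
        (codeTurn i (S.digit r c) d)
      rw [h4] at hr
      refine .move _ _ (inGrid_toCell h1 h1' h2 h2') (not_isSink_toCell h3) ?_
      rw [layout_turn hf, h5]
      exact ih hr

theorem reach_of_visits {i : Color} {a b : ℕ} {g : Dir} {t : ℕ} : ∀ {r c : ℕ} {d : Dir},
    S.visits i a b g t r c d = true → (S.layout h).Reach i (toCell r c) d →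
      (S.layout h).Reach i (toCell a b) g := by
  induction t with
  | zero => intro r c d hr; simp [visits] at hr
  | succ t ih =>
    intro r c d hr hR
    simp only [visits, Bool.or_eq_true, Bool.and_eq_true, Nat.beq_eq, decide_eq_true_eq] at hr
    rcases hr with ⟨rfl, rfl, rfl⟩ | ⟨hf, hr⟩
    · exact hR
    · obtain ⟨h1, h1', h2, h2', h3⟩ := free_iff.1 hf
      obtain ⟨r', c', h4, h5⟩ := advance_eq (visits S i a b g t) h1 h2
        (codeTurn i (S.digit r c) d)
      rw [h4] at hr
      refine ih hr ?_
      rw [← h5, ← layout_turn (h := h) hf]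
      exact hR.step _ _ (inGrid_toCell h1 h1' h2 h2') (not_isSink_toCell h3)

theorem isPerfect_layout (hd : ∀ i, S.deliversAll i = true) : (S.layout h).IsPerfect := by
  intro i x d hx hxd
  obtain ⟨r, c, hr, hc, rfl⟩ := exists_toCell hx.1.1 hx.2.1
  have hi := hd i
  simp only [deliversAll, Bool.and_eq_true] at hi
  simp only [Board.InGrid, board, toCell] at hx
  have h1 := allUpTo_eq_true hi.1 hc (by omega)
  have h2 := allUpTo_eq_true hi.2 hr (by omega)
  simp only [Bool.and_eq_true] at h1 h2
  cases d <;> simp [Board.InGrid, board, toCell, Dir.vec] at hxd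
  · obtain rfl : r = S.rows := by omega
    exact delivered_of_run h1.2
  · obtain rfl : r = 1 := by omega
    exact delivered_of_run h1.1
  · obtain rfl : c = S.cols := by omega
    exact delivered_of_run h2.2
  · obtain rfl : c = 1 := by omega
    exact delivered_of_run h2.1

theorem reach_of_visitsFrom {i : Color} {d g : Dir} {p a b : ℕ} (hp : 1 ≤ p)
    (hv : S.visitsFrom i d p a b g = true) : (S.layout h).Reach i (toCell a b) g := by
  have hi := h.sink i
  cases d <;> simp only [visitsFrom, Bool.and_eq_true, Nat.ble_eq] at hv <;>
    refine reach_of_visits hv.2 (.entry _ _ (inGrid_toCell ?_ ?_ ?_ ?_) ?_) <;>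
    first
    | omega
    | (simp only [Board.InGrid, board, toCell, Dir.vec, Prod.fst_sub, Prod.snd_sub]; omega)

theorem rowRich_of_rowCut {x : ℕ} (hx : S.rowCut x = true) : (S.layout h).RowRich (hex x 0) := by
  simp only [rowCut, Bool.and_eq_true, decide_eq_true_eq] at hx
  refine ⟨fun i => (hex x (3 * i + 1) : ℤ) - 1, fun i => Nat.beq (hex x (3 * i + 2) % 2) 1, ?_, ?_⟩
  · intro i j hij
    exact hx.2.1 i j (by simpa using hij)
  · intro i
    obtain ⟨h1, h2⟩ := hx.2.2 i
    have := reach_of_visitsFrom (h := h) h1 h2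
    rcases Nat.mod_two_eq_zero_or_one (hex x (3 * i + 2)) with h3 | h3 <;>
      simp only [h3] at this ⊢
    · simpa [show Nat.beq 0 1 = false from rfl, toCell, crossCell, crossDir] using this
    · simpa [toCell, crossCell, crossDir] using this

theorem colRich_of_colCut {x : ℕ} (hx : S.colCut x = true) : (S.layout h).ColRich (hex x 0) := by
  simp only [colCut, Bool.and_eq_true, decide_eq_true_eq] at hx
  refine ⟨fun i => (hex x (3 * i + 1) : ℤ) - 1, fun i => Nat.beq (hex x (3 * i + 2) % 2) 1, ?_, ?_⟩
  · intro i j hij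
    exact hx.2.1 i j (by simpa using hij)
  · intro i
    obtain ⟨h1, h2⟩ := hx.2.2 i
    have := reach_of_visitsFrom (h := h) h1 h2
    rcases Nat.mod_two_eq_zero_or_one (hex x (3 * i + 2)) with h3 | h3 <;>
      simp only [h3] at this ⊢
    · simpa [show Nat.beq 0 1 = false from rfl, toCell, crossCell, crossDir, Dir.transpose] using this
    · simpa [toCell, crossCell, crossDir, Dir.transpose] using this

end Spec

namespace Layout

variable {B : Board} {L : Layout B}

/-- Packets of every color enter through every boundary edge, so the outer lines are rich as soon as
there are three edges. The cuts of a table entry need to treat only the gaps between sinks. -/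
theorem rowRich_top (hc : 3 ≤ B.cols) : L.RowRich 0 := by
  refine ⟨fun i => (i : ℕ), fun _ => true, fun i j hij => by simpa [Fin.ext_iff] using hij,
    fun i => reach_top ⟨by dsimp only; omega, by dsimp only; omega⟩ i⟩

theorem rowRich_bottom (hc : 3 ≤ B.cols) : L.RowRich B.rows := by
  refine ⟨fun i => (i : ℕ), fun _ => false, fun i j hij => by simpa [Fin.ext_iff] using hij,
    fun i => reach_bottom ⟨by dsimp only; omega, by dsimp only; omega⟩ i⟩

theorem colRich_left (hr : 3 ≤ B.rows) : L.ColRich 0 := by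
  refine ⟨fun i => (i : ℕ), fun _ => true, fun i j hij => by simpa [Fin.ext_iff] using hij,
    fun i => .entry _ _ ?_ ?_⟩ <;>
    simp [crossCell, crossDir, Board.InGrid, Dir.vec, Dir.transpose]
  have := B.sink_mem i
  omega

theorem colRich_right (hr : 3 ≤ B.rows) : L.ColRich B.cols := by
  refine ⟨fun i => (i : ℕ), fun _ => false, fun i j hij => by simpa [Fin.ext_iff] using hij,
    fun i => .entry _ _ ?_ ?_⟩ <;>
    simp [crossCell, crossDir, Board.InGrid, Dir.vec, Dir.transpose]
  have := B.sink_mem i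
  omega

end Layout

namespace Spec

variable {S : Spec}

theorem exists_cut {sink : Color → ℕ} {cuts : List ℕ} {n : ℕ} {P : ℤ → Prop}
    (hs : ∀ i, 1 ≤ sink i ∧ sink i ≤ n) (hc : cutsSuffice sink cuts n = true)
    (hP : ∀ x ∈ cuts, hex x 0 ≤ n ∧ P (hex x 0)) (h0 : P 0) (hn : P n) (k : ℤ) (hk : 0 ≤ k)
    (hk' : k ≤ n) :
    ∃ k' : ℤ, 0 ≤ k' ∧ k' ≤ n ∧ (∀ i, (sink i : ℤ) - 1 < k ↔ (sink i : ℤ) - 1 < k') ∧ P k' := by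
  have h1 := allUpTo_eq_true hc (k := (k + 1).toNat) (by omega) (by omega)
  simp only [Bool.or_eq_true, decide_eq_true_eq, List.any_eq_true] at h1
  rcases h1 with h1 | h1 | ⟨x, hx, h1⟩
  · refine ⟨0, le_rfl, by omega, fun i => ?_, h0⟩
    have := h1 i
    have := hs i
    omega
  · refine ⟨n, by omega, le_rfl, fun i => ?_, hn⟩
    have := h1 i
    have := hs i
    omega
  · refine ⟨hex x 0, by omega, by exact_mod_cast (hP x hx).1, fun i => ?_, (hP x hx).2⟩
    have := h1 i
    omega

theorem valid_and_rich_of_check {rc cc : List ℕ} (hch : S.check rc cc = true) :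
    ∃ h : S.Valid, (S.board h).Rich := by
  simp only [check, Bool.and_eq_true, decide_eq_true_eq, Nat.ble_eq, List.all_eq_true] at hch
  obtain ⟨hr, hc, hs, hi, hd, h1, h2, h3, h4⟩ := hch
  have h : S.Valid := ⟨hs, hi⟩
  refine ⟨h, S.layout h, isPerfect_layout hd, ?_, ?_⟩
  · intro k h0 hk
    refine exists_cut (P := (S.layout h).RowRich) (fun i => ⟨(hs i).1, (hs i).2.1⟩) h1
      (fun x hx => ⟨?_, rowRich_of_rowCut (h3 x hx)⟩) (rowRich_top hc) (rowRich_bottom hc) k h0 hk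
    have := h3 x hx
    simp only [rowCut, Bool.and_eq_true, Nat.ble_eq] at this
    exact this.1
  · intro k h0 hk
    refine exists_cut (P := (S.layout h).ColRich) (fun i => ⟨(hs i).2.2.1, (hs i).2.2.2.1⟩) h2
      (fun x hx => ⟨?_, colRich_of_colCut (h4 x hx)⟩) (colRich_left hr) (colRich_right hr) k h0 hk
    have := h4 x hx
    simp only [colCut, Bool.and_eq_true, Nat.ble_eq] at this
    exact this.1

end Spec

/-! ### Gap lists and reduction to finitely many boards -/

theorem linePos_sub_le {u₀ u : List ℕ} (h : List.Forall₂ (· ≤ ·) u₀ u) {s t : ℕ} (hst : s ≤ t) :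
    (linePos u s : ℤ) - linePos u₀ s ≤ linePos u t - linePos u₀ t := by
  -- The displacement of a line is a partial sum of the nonnegative differences of the gaps, so it
  -- grows with the index. The inequality is arranged so as to avoid subtraction.
  have key : ∀ {u₀ u : List ℕ}, List.Forall₂ (· ≤ ·) u₀ u → ∀ {s t : ℕ}, s ≤ t →
      (u.take s).sum + (u₀.take t).sum ≤ (u.take t).sum + (u₀.take s).sum := by
    intro u₀ u h
    induction h with
    | nil => simp
    | cons hab _ ih =>
      intro s t hst
      match s, t with
      | 0, 0 => simp
      | 0, t + 1 =>
        have := ih (Nat.zero_le t)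
        simp at this ⊢
        omega
      | s + 1, t + 1 =>
        have := ih (s := s) (t := t) (by omega)
        simp
        omega
  have := key h (s := s + 1) (t := t + 1) (by omega)
  simp only [linePos, Nat.cast_add]
  omega

theorem linePos_strictMono (u : List ℕ) : StrictMono (linePos u) := by
  refine strictMono_nat_of_lt_succ fun t => ?_
  have : (u.take (t + 1)).sum ≤ (u.take (t + 1 + 1)).sum := by
    rw [List.take_add_one (i := t + 1), List.sum_append]
    omega
  simp only [linePos]
  omega

/-- The sinks of the board have the order of the pattern of `T`, and `u` and `v` are the numbers of
rows and columns in the gaps. -/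
structure Board.Spread (B : Board) (T : SinkType) (u v : List ℕ) : Prop where
  rows : B.rows = linePos u (u.length - 1)
  cols : B.cols = linePos v (v.length - 1)
  sink : ∀ i, B.sink i = ((linePos u (T.pattern i).1 : ℤ), (linePos v (T.pattern i).2 : ℤ))

theorem Board.Spread.rich_of_le {B₀ B : Board} {T : SinkType} {u₀ v₀ u v : List ℕ}
    (h₀ : B₀.Spread T u₀ v₀) (hB₀ : B₀.Rich) (h : B.Spread T u v)
    (hu : List.Forall₂ (· ≤ ·) u₀ u) (hv : List.Forall₂ (· ≤ ·) v₀ v)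
    (hT : ∀ i, (T.pattern i).1 + 1 < u.length ∧ (T.pattern i).2 + 1 < v.length) : B.Rich := by
  have hz : ∀ {u₀ u : List ℕ}, List.Forall₂ (· ≤ ·) u₀ u → ∀ t, linePos u₀ t ≤ linePos u t := by
    intro u₀ u hu t
    have h1 := linePos_sub_le hu (Nat.zero_le t)
    have h2 : linePos u₀ 0 ≤ linePos u 0 := by
      cases hu <;> simp_all [linePos]
    omega
  have hm : ∀ {u₀ u : List ℕ}, List.Forall₂ (· ≤ ·) u₀ u → ∀ s t : ℕ,
      (linePos u₀ s : ℤ) ≤ linePos u₀ t →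
      (linePos u s : ℤ) - linePos u₀ s ≤ linePos u t - linePos u₀ t := by
    intro u₀ u hu s t hst
    exact linePos_sub_le hu ((linePos_strictMono u₀).le_iff_le.1 (by exact_mod_cast hst))
  refine hB₀.stretch ?_ ?_ ?_ ?_ ?_ ?_ <;> simp only [h₀.sink, h.sink, h₀.rows, h.rows, h₀.cols,
    h.cols, hu.length_eq, hv.length_eq]
  · exact fun i => by exact_mod_cast hz hu _
  -- The number of rows is itself a line position, with an index beyond all sinks, so this bound is
  -- another case of the monotonicity of displacements.
  · exact fun i => linePos_sub_le hu (by have := hT i; omega)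
  · exact fun i j => hm hu _ _
  · exact fun i => by exact_mod_cast hz hv _
  · exact fun i => linePos_sub_le hv (by have := hT i; omega)
  · exact fun i j => hm hv _ _

theorem Entry.exists_rich {T : SinkType} {e : Entry} (h : e.check T = true) :
    ∃ B : Board, B.Spread T e.rowGaps e.colGaps ∧ B.Rich := by
  obtain ⟨hv, hr⟩ := Spec.valid_and_rich_of_check h
  refine ⟨_, ⟨rfl, rfl, fun i => ?_⟩, hr⟩
  simp [Spec.board, toCell, Entry.spec]

/-- The ways to add `k` to the sum of a list by increasing its entries. -/
def increments : List ℕ → ℕ → List (List ℕ)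
  | [], 0 => [[]]
  | [], _ + 1 => []
  | a :: l, k => (List.range (k + 1)).flatMap fun j => (increments l (k - j)).map ((a + j) :: ·)

/-- Greedy choice: as much of `k` as possible is spent on the first entry, and the rest goes to the
tail. -/
theorem exists_mem_increments {l u : List ℕ} (h : List.Forall₂ (· ≤ ·) l u) :
    ∀ {k : ℕ}, l.sum + k ≤ u.sum → ∃ w ∈ increments l k, List.Forall₂ (· ≤ ·) w u := by
  induction h with
  | nil =>
    intro k hk
    obtain rfl : k = 0 := by simpa using hk
    exact ⟨[], by simp [increments], .nil⟩
  | @cons a b l u hab hlu ih =>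
    intro k hk
    simp only [List.sum_cons] at hk
    have hs : l.sum ≤ u.sum := hlu.sum_le_sum
    obtain ⟨w, hw, hwu⟩ := ih (k := k - min k (b - a)) (by omega)
    refine ⟨(a + min k (b - a)) :: w, ?_, .cons (by omega) hwu⟩
    simp only [increments, List.mem_flatMap, List.mem_range, List.mem_map]
    exact ⟨min k (b - a), by omega, w, hw, rfl⟩

/-- Pointwise comparison of lists. -/
def leList : List ℕ → List ℕ → Bool
  | [], [] => true
  | a :: l, b :: u => (Nat.ble a b).and (leList l u)
  | _, _ => false

theorem forall₂_of_leList : ∀ {l w u : List ℕ}, leList l w = true →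
    List.Forall₂ (· ≤ ·) w u → List.Forall₂ (· ≤ ·) l u
  | [], [], _, _, h => h
  | a :: l, b :: w, c :: u, h, .cons h1 h2 => by
    simp only [leList, Bool.and_eq_true, Nat.ble_eq] at h
    exact .cons (h.1.trans h1) (forall₂_of_leList h.2 h2)
  | [], _ :: _, _, h, _ => by simp [leList] at h
  | _ :: _, [], _, h, _ => by simp [leList] at h

/-- The table contains boards below all boards with the given total increments. -/
def covers (table : List Entry) (l l' : List ℕ) (k k' : ℕ) : Bool :=
  (increments l k).all fun w => (increments l' k').all fun z =>
    table.any fun e => (leList e.rowGaps w).and (leList e.colGaps z)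

/-- Gap lists with large sums dominate lists in which the sums exceed those of `l` and `l'` by
exactly `k` and `k'`. There are finitely many of these, and each dominates a table entry, whose
layout can be stretched. -/
theorem Board.Spread.rich_of_covers {B : Board} {T : SinkType} {u v : List ℕ}
    (h : B.Spread T u v) {table : List Entry} (ht : table.all (Entry.check T) = true)
    (hT : ∀ i, (T.pattern i).1 + 1 < u.length ∧ (T.pattern i).2 + 1 < v.length)
    (l l' : List ℕ) (k k' : ℕ) (hc : covers table l l' k k' = true)
    (hl : List.Forall₂ (· ≤ ·) l u) (hl' : List.Forall₂ (· ≤ ·) l' v)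
    (hk : l.sum + k ≤ u.sum) (hk' : l'.sum + k' ≤ v.sum) : B.Rich := by
  obtain ⟨w, hw, hwu⟩ := exists_mem_increments hl hk
  obtain ⟨z, hz, hzv⟩ := exists_mem_increments hl' hk'
  simp only [covers, List.all_eq_true, List.any_eq_true, Bool.and_eq_true] at hc ht
  obtain ⟨e, he, h1, h2⟩ := hc w hw z hz
  obtain ⟨B₀, hB₀, hr⟩ := Entry.exists_rich (ht e he)
  exact hB₀.rich_of_le hr h (forall₂_of_leList h1 hwu) (forall₂_of_leList h2 hzv) hT

end LoadingGame

/-! ### Tables of layouts of small boards -/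

namespace LoadingGame

/-- Layouts of small boards of type `C`. -/
def tableC : List Entry := [
  ⟨[2, 0, 2], [2, 0, 0, 4], 0x93c15488cb917c76c81b544dc61a732d3d6a3a50c2c447a7c37726,
    [0x3593724613], [0x3323165213, 0x3323165214]⟩,
  ⟨[2, 0, 2], [2, 0, 1, 3], 0xb9c154ccc753398818632bbd681a72d38d6a1954248443b7b7ac26,
    [0x3593724613], [0x3163152323, 0x3165214324]⟩,
  ⟨[2, 0, 2], [2, 0, 2, 2], 0xb7519884c53b194cc43b351d682a2d833da57a33c2768a2cc77c6a,
    [0x3591013583], [0x3313165753, 0x3314164154]⟩,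
  ⟨[2, 0, 2], [2, 1, 0, 3], 0xb75938c1c369381844761bd61c8a17d83d5a24bb6b88a2b4446bac,
    [0x3717072593], [0x3163322153, 0x6224165315]⟩,
  ⟨[2, 0, 2], [2, 1, 1, 2], 0x51494ccc814b58a884725bd761c92d883d6a3b33a2762b7b24ac46,
    [0x3713725493], [0x3163152313, 0x4165155315]⟩,
  ⟨[2, 0, 2], [2, 2, 0, 2], 0x37b3351897b3759c18b62d71764a1d828d69244464849a6c2ccccc,
    [0x3593724043], [0x5316056065, 0x7066336326]⟩,
  ⟨[2, 0, 2], [3, 0, 0, 3], 0x5b33819c0b3bb379511775dcc153a2d3da5c7a6c284846a248c848,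
    [0x3584614493], [0x4314326064, 0x6055316065]⟩,
  ⟨[2, 0, 2], [3, 0, 1, 2], 0x1b454884975918c4c863b1d1c541ad38da5cbacc3c62c373768a82,
    [0x3584624043], [0x4154315224, 0x4156215165]⟩,
  ⟨[2, 0, 2], [3, 1, 0, 2], 0x3333589c19cc77154cb52d1cc582ad88d4a658b3b828a7a363c824,
    [0x3723713593], [0x5224165214, 0x7229217066]⟩,
  ⟨[2, 0, 2], [4, 0, 0, 2], 0x77371795836b3819442b5dcc52c2ad8d4796b3b68a3826a33c2cc6,
    [0x3583713593], [0x5316066055, 0x7058067216]⟩,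
  ⟨[2, 0, 3], [2, 0, 0, 3], 0x149c47457353818997c26cccb275d168091d3da639332c266b2b88a4,
    [0x3723714633], [0x3323312173, 0x5214164174]⟩,
  ⟨[2, 0, 3], [2, 0, 1, 2], 0xb3539188725b75b968b24b493632d726a2d88d692b464ba4aab6a82c,
    [0x3583723573], [0x5063315073, 0x5063315074]⟩,
  ⟨[2, 0, 3], [2, 1, 0, 2], 0x914588c493c7c1585b244b89725d314692d32d69b73a582c3ac77c62,
    [0x5613723573], [0x3313175753, 0x4161416225]⟩,
  ⟨[2, 0, 3], [3, 0, 0, 2], 0xb35189c8a5c81884a753144c524dcc2619d8d6a27246b62a3bb37a62,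
    [0x3724483713], [0x6214175054, 0x6215167075]⟩,
  ⟨[2, 1, 2], [2, 0, 0, 3], 0x3795814829544c8c7b15d524933c58c2b29d8d6aa2733726a6bbab2a,
    [0x4482713573], [0x3161174223, 0x5214174164]⟩,
  ⟨[2, 1, 2], [2, 0, 1, 2], 0x14954c5837377a1652bbd5149c53888292d33d96b73268b976ba2c4c,
    [0x4483713573], [0x3174062313, 0x3315064174]⟩,
  ⟨[2, 1, 2], [2, 1, 0, 2], 0x19c75884733351b96b2d31699727cb691ad38d69bac62ccc3632a848,
    [0x4483721313], [0x3323172313, 0x5454446215]⟩,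
  ⟨[2, 1, 2], [3, 0, 0, 2], 0x91c75844b3331975175d71c55b58b189a2d3d6a57a32c46832b68bac,
    [0x4614483573], [0x4325075064, 0x6212426065]⟩,
  ⟨[3, 0, 2], [2, 0, 0, 3], 0xbbb1719517ac4c151454d751a27d8d59a63c32443963288c7b26acc8,
    [0x4585625614], [0x3314074233, 0x6073324164]⟩,
  ⟨[3, 0, 2], [2, 0, 1, 2], 0x1759888159314c4c51b4d61491d88d95369c38c2bb32ac6873b0a246,
    [0x7075485624], [0x3323172163, 0x6214174164]⟩,
  ⟨[3, 0, 2], [2, 1, 0, 2], 0xbb371b9573b3519c175d3751a2d38d5a3a9ac5c12642ac846ac82848,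
    [0x4585625614], [0x3325072313, 0x6065316075]⟩,
  ⟨[3, 0, 2], [3, 0, 0, 2], 0x59c388311947c65c175d168891d8d9643963c328b3ba76c27b366ba2,
    [0x7074725484], [0x4164176214, 0x6224176215]⟩,
  ⟨[2, 0, 4], [2, 0, 0, 2], 0x335319425498c8b529b89775814952bd62c19d8da63b3ac267ac3762,
    [0x3724471313], [0x3323174083, 0x4443176084]⟩,
  ⟨[2, 1, 3], [2, 0, 0, 2], 0x53338915828b89325956c26bd5187b5a83192d3d6a6ac28c4ba37c26,
    [0x3713723563], [0x3313324083, 0x3314175084]⟩,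
  ⟨[2, 2, 2], [2, 0, 0, 2], 0x93589819c331c5725d164b72ac6816b58ac1ad8da6a6c3832333ac62,
    [0x3723714473], [0x3312184073, 0x5454185214]⟩,
  ⟨[3, 0, 3], [2, 0, 0, 2], 0x97531859c1776cb6b2b98164d6311ad3d9614b7b963a3a5c17ba2764,
    [0x4564715474], [0x2324074083, 0x5062185224]⟩,
  ⟨[3, 1, 2], [2, 0, 0, 2], 0x583314913581b91b5d725b6bac2c1ad8d5a1ac477532a6cc47b36a28,
    [0x3036616475], [0x3321314083, 0x6214175084]⟩,
  ⟨[4, 0, 2], [2, 0, 0, 2], 0x37379152bb4759245dc512ad8d597ac6c016a33248ba2a58c6a268c4,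
    [0x5566626615], [0x2314084233, 0x5074445084]⟩]

/-- Layouts of small boards of type `I`. -/
def tableI : List Entry := [
  ⟨[2, 0, 0, 2], [2, 4], 0x931588477b14696b81d1532a7d92ba63d956a328cca62cc48,
    [0x3565615623, 0x3565615624], []⟩,
  ⟨[2, 0, 0, 2], [3, 3], 0x7393c15688814916bd1541bad198963da76b6ac8c236284ac,
    [0x4623714473, 0x6615625474], []⟩,
  ⟨[2, 0, 0, 2], [4, 2], 0x3375918773351962dc35192d8b9196da7469c72684b2ba6cc,
    [0x4473564613, 0x3035625614], []⟩,
  ⟨[2, 0, 0, 4], [2, 3], 0x5189c459c81c1446a815a484b52d62197da2396da6a76c327b68a2,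
    [0x4453714463, 0x4725454714], []⟩,
  ⟨[2, 0, 0, 4], [3, 2], 0x15984c3581ba2b93157a3c5125d2542ad28a95da45b7726a24ba68,
    [0x2712326363, 0x4715624564], []⟩,
  ⟨[2, 0, 1, 3], [2, 3], 0x5818949614c8917689b16d165bba1c7a1d1a6a3da63a1746a33c62,
    [0x3553714623, 0x4715465624], []⟩,
  ⟨[2, 0, 1, 3], [3, 2], 0x15489c309145b7715a26dc257b51982ada81a6d46a637a2662bac4,
    [0x3563724613, 0x5625444564], []⟩,
  ⟨[2, 0, 2, 2], [2, 3], 0x9514cc59184815bd269145847b7a623a2da263ada6b36b2968a82c,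
    [0x3723561313, 0x6465725715], []⟩,
  ⟨[2, 0, 2, 2], [3, 2], 0x5b3b1931759851d15cb35ac177a176a1d8a1a6d46aa3c246a27264,
    [0x3563724613, 0x4563726614], []⟩,
  ⟨[2, 1, 0, 3], [2, 3], 0x1797c57154ac1bb9a5145d15924d1a9276883a6da6b2ac4662a824,
    [0x4463715353, 0x5716446465], []⟩,
  ⟨[2, 1, 0, 3], [3, 2], 0x91754435392c9b972551d1c52ad14ab169885ad46a588ba273b2a6,
    [0x3713724453, 0x5716466455], []⟩,
  ⟨[2, 1, 1, 2], [2, 3], 0x1b74953197c551bd5157a514b1ada25a314ca60d5a53288a76ac28,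
    [0x3714464633, 0x5726465715], []⟩,
  ⟨[2, 1, 1, 2], [3, 2], 0x1b49c577795161dc51145ba41ad189ba1475a6da453a752c6ac828,
    [0x3564614443, 0x5557626465], []⟩,
  ⟨[2, 2, 0, 2], [2, 3], 0x7b9351331759b25d51a71d19a6318c6a2144a68d6aa6ccc26ac828,
    [0x3563552713, 0x6567627616], []⟩,
  ⟨[2, 2, 0, 2], [3, 2], 0x17794579352916dc2591d1899c6824b31495a6d6983b729662bacc,
    [0x3564613333, 0x2027617466], []⟩,
  ⟨[3, 0, 0, 3], [2, 3], 0x735391b958313514946b1d25a27d29a5cd952732952a68c8a26c8c,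
    [0x4566616444, 0x5566615725], []⟩,
  ⟨[3, 0, 0, 3], [3, 2], 0x35391cb194c57775a126d27529d8a169dba53b26a82472a626ba44,
    [0x4724565614, 0x5726615565], []⟩,
  ⟨[3, 0, 1, 2], [2, 3], 0x19584897c326531d51715a8c197d2a396d969c6c24b1b5ba63382a,
    [0x5454715464, 0x8467627616], []⟩,
  ⟨[3, 0, 1, 2], [3, 2], 0x31499593715c52dc519c51c82ad8a195d45a27b6a67a5244b27a76,
    [0x6467625614, 0x8467627616], []⟩,
  ⟨[3, 1, 0, 2], [2, 3], 0x5194881797c6b61d611b9d19714649a63d691688a433296ca6cc28,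
    [0x5614725454, 0x4046067616], []⟩,
  ⟨[3, 1, 0, 2], [3, 2], 0x1944451b797551dc611ad29837681996d649b6ba81717a6c24a6c4,
    [0x5614555624, 0x6557467616], []⟩,
  ⟨[4, 0, 0, 2], [2, 3], 0xb353197558911b5d15a71d196a3d596a2888a62c446082b93ac26c,
    [0x6615566625, 0x6567617626], []⟩,
  ⟨[4, 0, 0, 2], [3, 2], 0xb7759153319452dc15a2d819a6d4955bba8276893236a92c6a2cc8,
    [0x5567616625, 0x6567617626], []⟩,
  ⟨[2, 1, 1, 4], [2, 2], 0x1954cb9751589c1a147551d61715a8a1da1a316469da61b7a63ac62,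
    [0x4554725614, 0x6727457616], []⟩,
  ⟨[2, 1, 2, 3], [2, 2], 0x75819359812549c61d61b5a31a3528a2d916b194a5d6aa58c2a7c26,
    [0x5624555614, 0x6557447616], []⟩,
  ⟨[2, 1, 3, 2], [2, 2], 0x588199c31551d15b6ac1715a8a351c1ad1a3a1466ad5a6288a2ac64,
    [0x4544715454, 0x7729458617], []⟩,
  ⟨[2, 2, 0, 4], [2, 2], 0x7589195331159883592c25d6129d916b194b762a6ad6a618ba63ba2,
    [0x6625556615, 0x4717446556], []⟩,
  ⟨[2, 2, 1, 3], [2, 2], 0x159c495382518ac51d62b75a2a1d1a716a83b16aa6d6a2a74663ba2,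
    [0x3713722553, 0x7728457717], []⟩,
  ⟨[2, 2, 2, 2], [2, 2], 0xb5391a581c15d5115ac839514a1da2a3682ac1465ada672b6a2776a,
    [0x5554716445, 0x6558446716], []⟩,
  ⟨[2, 3, 0, 3], [2, 2], 0xb14595189c359c125d51a1da1246a82b64a7a154a5da627b5a2a776,
    [0x3553714433, 0x7558628617], []⟩,
  ⟨[2, 3, 1, 2], [2, 2], 0x593311589c15d51b1a5819d91751943362a2768a69d966b892a6cc2,
    [0x4714534554, 0x8539629618], []⟩,
  ⟨[3, 0, 1, 4], [2, 2], 0x73951b5931a53c11b7a562d51325892ad296ad696a828a5c2ca7264,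
    [0x5614553724, 0x6614555725], []⟩,
  ⟨[3, 0, 2, 3], [2, 2], 0x17589b97157639116d1516acca1548a1da1a6d6aa326436b2a2b7a6,
    [0x4554725614, 0x6558618627], []⟩,
  ⟨[3, 0, 3, 2], [2, 2], 0x9531c9588151d61375919c53124ac52ada15ada52a768b6ba1762a4,
    [0x4543725614, 0x5726615555], []⟩,
  ⟨[3, 1, 0, 4], [2, 2], 0x915cc95818753a1b395115d1619da13761a69d5a69c14ac2462a776,
    [0x4714555624, 0x5717447456], []⟩,
  ⟨[3, 1, 1, 3], [2, 2], 0x71495b59c1618ac61d513b5a1a1da1a7618a6d5a6a881a6c14a3246,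
    [0x4554546614, 0x6558627616], []⟩,
  ⟨[3, 1, 2, 2], [2, 2], 0x59818b149615d1651a8c15a4419d2a796c269d6a6bb2a332a6688a2,
    [0x4714726454, 0x6717447456], []⟩,
  ⟨[3, 2, 0, 3], [2, 2], 0x197755b9c11a46415d6291da2936329762896d69362acb682a76ba2,
    [0x7456536716, 0x7728448457], []⟩,
  ⟨[3, 2, 1, 2], [2, 2], 0x31795b931551d1551a4ca1d917b62a631946ad952acc56a8282768a,
    [0x7628457616, 0x7559618447], []⟩,
  ⟨[4, 0, 1, 3], [2, 2], 0x5981891454b195c15d527751aa1d1a69d5a3624a6b9822a7c6a3c26,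
    [0x5715556445, 0x7718628457], []⟩,
  ⟨[4, 0, 2, 2], [2, 2], 0x5931c5381a52d15bba1517598a2d1a5ad5a5acc17a5141684a3628a,
    [0x5719456625, 0x6717437456], []⟩,
  ⟨[4, 1, 0, 3], [2, 2], 0x149c5b58a17935162d51a2da1a268869d696b2a46891ca683236ba2,
    [0x6556537616, 0x7558628617], []⟩,
  ⟨[4, 1, 1, 2], [2, 2], 0x5b3191589415d1551ac81ad19716496ada6b32a6628ac32ba627a76,
    [0x6615556445, 0x8539619458], []⟩]

/-- Layouts of small boards of type `J`. -/
def tableJ : List Entry := [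
  ⟨[2, 0, 0, 2], [2, 0, 4], 0xb351988c17b544ba3b51bd157a1cda186a33d54a6a8888817a22c464,
    [0x3713584623, 0x4575615624], [0x4053173313]⟩,
  ⟨[2, 0, 0, 2], [2, 1, 3], 0x791cc458333588912b746d51ba2d1ac8689d64ac6ac832446a2c6876,
    [0x3723585613, 0x4575625614], [0x2723313173]⟩,
  ⟨[2, 0, 0, 2], [2, 2, 2], 0xb9c14445753188983351bd26a2d9288469d4a2626b8ba329a7c726cc,
    [0x4343583713, 0x4582024574], [0x5225214174]⟩,
  ⟨[2, 0, 0, 2], [3, 0, 3], 0x1bb97795933c36815284dc61972da318369da6c4b6bb8a1676284a4c,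
    [0x4483575613, 0x2025485614], [0x5224744314]⟩,
  ⟨[2, 0, 0, 2], [3, 1, 2], 0x1548488977bb7915bb26d164a1d1ac486ada54cca683822233b732a6,
    [0x3573582713, 0x4586613034], [0x5065214174]⟩,
  ⟨[2, 0, 0, 2], [4, 0, 2], 0xb598184c53338b9152bd51c8a2d883a159d4b25a3bb26a0477724a76,
    [0x3335484613, 0x4725486614], [0x6225176065]⟩,
  ⟨[2, 0, 0, 3], [2, 0, 3], 0x519484c31954c8254b9a4b1b5d5227ad8a253ad45a79776822b6bac8,
    [0x3715625463, 0x3715624574], [0x4213183173]⟩,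
  ⟨[2, 0, 0, 3], [2, 1, 2], 0x53b1898154b98417584b93b51d622ad1a8c5ad45acb2b684a727746a,
    [0x3721316363, 0x6615454574], [0x4073183313]⟩,
  ⟨[2, 0, 0, 3], [3, 0, 2], 0x359833124b927527445b9b25d52ca2d18a8a6d46a40bb59227277b6a,
    [0x3573562323, 0x4577614564], [0x5074184334]⟩,
  ⟨[2, 0, 1, 2], [2, 0, 3], 0x591c4cc19c58843581d619c33315932d8a1975d64ab62ba247a77628,
    [0x4473334613, 0x5475615624], [0x4224213183]⟩,
  ⟨[2, 0, 1, 2], [2, 1, 2], 0x71598c81b9c45cb1b5d51633a1841ad17966ad544aa7c727636832ba,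
    [0x3562714473, 0x4565576615], [0x7773184213]⟩,
  ⟨[2, 0, 1, 2], [3, 0, 2], 0x933715137b3591b25dc517b58a31a2d3a28a6d4796628a1846ac24cc,
    [0x3573565613, 0x4576625614], [0x5074745084]⟩,
  ⟨[2, 1, 0, 2], [2, 0, 3], 0x7751498391c74661b4d26917d829b936351a36da543bac68224a76cc,
    [0x3574624613, 0x1015056465], [0x2724213183]⟩,
  ⟨[2, 1, 0, 2], [2, 1, 2], 0x37958812b494c571b5d612adba1cb3683a16ad6a446a832286ac2822,
    [0x3563574613, 0x5567615575], [0x1713183173]⟩,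
  ⟨[2, 1, 0, 2], [3, 0, 2], 0x1958c847333a6262bd16c92d88913b1a6c195d64a46a83248b7ba624,
    [0x3722574613, 0x2021015565], [0x5214185074]⟩,
  ⟨[3, 0, 0, 2], [2, 0, 3], 0x195444cb3598241b5bd52729d82a6a8d49517476ba3acc252a222688,
    [0x4564572714, 0x5716626475], [0x4063173183]⟩,
  ⟨[3, 0, 0, 2], [2, 1, 2], 0x93cc7513538391b254d51a2d2a8c59da86477b5a31a277468ac268c4,
    [0x2574726614, 0x5576626615], [0x4185225074]⟩,
  ⟨[3, 0, 0, 2], [3, 0, 2], 0x174795473b39521b5d5c292d198c6ad49583ac244562888a5b6a2c88,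
    [0x4564572024, 0x4561016475], [0x3316083434]⟩,
  ⟨[2, 0, 0, 4], [2, 0, 2], 0xb7b9513159cc53184a5b33a1521d51a2da81a6d5a47ac362a68828,
    [0x3563554613, 0x4565625614], [0x4093313733]⟩,
  ⟨[2, 0, 1, 3], [2, 0, 2], 0xb194c51797453b598151bd61244529a2d3a1a6da647a726862b8ac,
    [0x3563724613, 0x5616464554], [0x4214223193]⟩,
  ⟨[2, 0, 2, 2], [2, 0, 2], 0x91445c519848315d515921c4b3ba52a2d82aa5d4a67b7a52a7c682,
    [0x3563712323, 0x6456465715], [0x5453183193]⟩,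
  ⟨[2, 1, 0, 3], [2, 0, 2], 0x519884b1946c17469851bd16a1d39273681a69d64a39c6c16b8a24,
    [0x3713564623, 0x4716466455], [0x5213193183]⟩,
  ⟨[2, 1, 1, 2], [2, 0, 2], 0x79c3511958cc351d156831a829d1a4b3618a69d4a662b84a6b8a82,
    [0x3723714633, 0x6727615566], [0x5213183333]⟩,
  ⟨[2, 2, 0, 2], [2, 0, 2], 0x91c458751889614d1619d1b969184c67632a69d6a43b7a62b3ba62,
    [0x4714564724, 0x8615567626], [0x4213183193]⟩,
  ⟨[3, 0, 0, 3], [2, 0, 2], 0x59144819588c59c2c4514d2619d82a59d46ab32a6c7bb26a37726a,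
    [0x4714725464, 0x5716466455], [0x4224213193]⟩,
  ⟨[3, 0, 1, 2], [2, 0, 2], 0x3937519cc351b15d512a54cc2ada815ad5a0247a6872b76a682a44,
    [0x4553725614, 0x6557627616], [0x4225754093]⟩,
  ⟨[3, 1, 0, 2], [2, 0, 2], 0x1bb795b5149c154d511ad14a146ac85ad5a4777a523a27502ac476,
    [0x4557625464, 0x6717627466], [0x4095753313]⟩,
  ⟨[4, 0, 0, 2], [2, 0, 2], 0x95331c91588815bd6119d89195d64a795ac16b932437726ab3b6a2,
    [0x5717456465, 0x8467457616], [0x4213184093]⟩]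

/-- Layouts of small boards of type `L`. -/
def tableL : List Entry := [
  ⟨[2, 0, 3], [2, 0, 3], 0x51b84891479cc517a45485b1dda13a63d69b2a7c64763a82c,
    [0x3564474613], [0x3163313173]⟩,
  ⟨[2, 0, 3], [2, 1, 2], 0xb7175945b31b9c168444a51dcd2a3a76d5a7a62888244acc6,
    [0x3714474463], [0x3314073153]⟩,
  ⟨[2, 0, 3], [3, 0, 2], 0x393c581258449c2b95cc825dd8a153ad64ab2476a4777b62a,
    [0x2324464613], [0x4175214164]⟩,
  ⟨[2, 1, 2], [2, 0, 3], 0x91774c51444ba5b52dda1a7c76145ba3da53a62c4c72a6888,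
    [0x4575465614], [0x3323313173]⟩,
  ⟨[2, 1, 2], [2, 1, 2], 0x19754c8b335ba152d7da15ba318c37a6da62a4cc64768a832,
    [0x3724475613], [0x3323313173]⟩,
  ⟨[2, 1, 2], [3, 0, 2], 0x958cc147b3319515dda18b7361b9a35d4a6368b28926a884c,
    [0x3573715623], [0x4174315064]⟩,
  ⟨[3, 0, 2], [2, 1, 2], 0x7b35319b589c1c61d7d1aa336d5a352484a688298862accc4,
    [0x4571015624], [0x4314445074]⟩,
  ⟨[3, 0, 2], [3, 0, 2], 0x144b9541b74b9552dd819958d69c37a26c87638a32b26b48a,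
    [0x5615475624], [0x2425063314]⟩,
  ⟨[2, 0, 2], [2, 1, 4], 0x917475cc47b1b4544965b2d7d29633a3cd59b5a72688c376a83c28,
    [0x4613598083], [0x3163324213]⟩,
  ⟨[2, 0, 2], [2, 2, 3], 0xb7335938171b745b9c6b2dc7d1a337a5cd6a2a5484cc4a67726848,
    [0x3714344623], [0x5146216065]⟩,
  ⟨[2, 0, 2], [2, 3, 2], 0x337158b89b9358144852d71cd29a736c3d96768b1a8cc6ba333c24,
    [0x4614492323], [0x3312163153]⟩,
  ⟨[2, 0, 2], [3, 0, 4], 0x79c58331891594ccc4145bdd81939335da46688a8862cbb274b68a,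
    [0x4616064493], [0x4156216234]⟩,
  ⟨[2, 0, 2], [3, 1, 3], 0x9c371c75c17b454b8ab62d7d1987a736d6ba33a7cc6146a2248442,
    [0x3717075493], [0x4164314154]⟩,
  ⟨[2, 0, 2], [3, 2, 2], 0x51848bb49b339145cc52d7cda28ac763d45a3732ab4a676ac28884,
    [0x3714495053], [0x6318226166]⟩,
  ⟨[2, 0, 2], [4, 0, 3], 0x9154c488c51884b4ba351dd8914b76ad6b4a7b33761a863b8b032a,
    [0x3715494623], [0x7213165155]⟩,
  ⟨[2, 0, 2], [4, 1, 2], 0xb147458597776b1b4961dcd8198ac53d46b9333a72654628acc48c,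
    [0x3592024483], [0x5316067225]⟩,
  ⟨[2, 0, 2], [5, 0, 2], 0x7b33b9514698c1ccc815dd338196bad75a4cb37ba73523737a2686,
    [0x4613594623], [0x6158217066]⟩,
  ⟨[2, 0, 5], [2, 0, 2], 0x149c54b295cc7295321b44a5688b2a62dda23a5da52688a8264b8a,
    [0x3726616463], [0x3193323433]⟩,
  ⟨[2, 1, 4], [2, 0, 2], 0xb75391a1754c599cc13145a826dd2a7371a6ac6d5aa63881326ba4,
    [0x3564716454], [0x6094084223]⟩,
  ⟨[2, 2, 3], [2, 0, 2], 0x519c8895831c314a6451dd929776c20ba6315a3da6ba2c647368a2,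
    [0x6626465715], [0x3193317773]⟩,
  ⟨[2, 3, 2], [2, 0, 2], 0x5b8b195a33c151dd1957a145b316890a36285a8d6972ac6c36a824,
    [0x7617467626], [0x3323314083]⟩,
  ⟨[3, 0, 4], [2, 0, 2], 0x593318b75b19592588ac72c651dd195a3da671a746a17c6433a26c,
    [0x5615465624], [0x3323434093]⟩,
  ⟨[3, 1, 3], [2, 0, 2], 0x593c1c518a4859248451dd9177762a693d9663a2c4bbac6233276a,
    [0x5716466455], [0x3328784093]⟩,
  ⟨[3, 2, 2], [2, 0, 2], 0x314459258b9825dd919776819146c4593da6b1ac6cac276473264a,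
    [0x5464715454], [0x3338783193]⟩,
  ⟨[4, 0, 3], [2, 0, 2], 0x797514b53319a32c0515dd19ac5d956288b9a7368235a24c276ba8,
    [0x6616456465], [0x2724094083]⟩,
  ⟨[4, 1, 2], [2, 0, 2], 0x194c7551844951dd919316c8b5ad6972796cac32c637276aa32c64,
    [0x7627467616], [0x3314443183]⟩]

/-- Layouts of small boards of type `Y`. -/
def tableY : List Entry := [
  ⟨[2, 0, 0, 2], [2, 0, 0, 3], 0x733175493b9c315425b4d7522a4dac8297763d69b9247c686b2ba8cc,
    [0x4343721313, 0x4575624714], [0x3323312173, 0x5214742174]⟩,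
  ⟨[2, 0, 0, 2], [2, 0, 1, 2], 0xb1954cc81539888175b1d61ca1d8114a633bada6acc1476437638b2a,
    [0x2583714473, 0x4585476614], [0x3173165213, 0x3174314324]⟩,
  ⟨[2, 0, 0, 2], [2, 1, 0, 2], 0x95c8881891446c8c315dc6c129d8a1447b63ad6a23b24ba6b73627a6,
    [0x3713722583, 0x6487075614], [0x3163171713, 0x6225176215]⟩,
  ⟨[2, 0, 0, 2], [3, 0, 0, 2], 0x7937cc1517b4a7586b2d51c491d88a823ab6d4a663338a32b2b6bacc,
    [0x4483714473, 0x4732024714], [0x6215075224, 0x6217066075]⟩,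
  ⟨[2, 0, 0, 3], [2, 0, 0, 2], 0x79c3175b15984869381c6632dc2619d81a4ac63da568ba82c3a32c68,
    [0x4462324473, 0x4722571014], [0x3313174083, 0x5223175214]⟩,
  ⟨[2, 0, 1, 2], [2, 0, 0, 2], 0x51448945928c8815bd1c6b5a814ca1d3a22736ad6a7bb276a3732ba6,
    [0x3713724463, 0x4575464714], [0x3173181713, 0x5224174184]⟩,
  ⟨[2, 1, 0, 2], [2, 0, 0, 2], 0xb5b319819475441b5d1c6a1d88a27761ba93a63da673ba7522a46c8c,
    [0x3563716473, 0x5576065715], [0x3314074083, 0x5082423434]⟩,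
  ⟨[3, 0, 0, 2], [2, 0, 0, 2], 0x59c8c18b514889154d61919da14c7b6ad6aa5c88246331bba37632a2,
    [0x4714725474, 0x6616466475], [0x3183174213, 0x4444184174]⟩]

/-- Layouts of small boards of type `slash`. -/
def tableS : List Entry := [
  ⟨[2, 0, 0, 2], [2, 0, 0, 3], 0x3b581889ba16c4c877164d16ac1cda1ca6cd446aa3776814663bb24a,
    [0x3583574623, 0x4586065624], [0x4213173163, 0x5215224334]⟩,
  ⟨[2, 0, 0, 2], [2, 0, 1, 2], 0x3793c7155b18449c53bb2d517a72d1b96ad698486abac324b2764a8c,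
    [0x3573585613, 0x4575485614], [0x2722313163, 0x4172314164]⟩,
  ⟨[2, 0, 0, 2], [2, 1, 0, 2], 0x7b9cc31595c1888cb5144d611a7da8186adb644a6383222a37ba26c4,
    [0x3713584623, 0x4573585614], [0x4174165224, 0x5177215155]⟩,
  ⟨[2, 0, 0, 2], [3, 0, 0, 2], 0x795331c1679c77156bb2dc51917d8a316ad64a8833b326a4ba7c246c,
    [0x3573584613, 0x3575625614], [0x6226215074, 0x5166217225]⟩,
  ⟨[2, 0, 0, 3], [2, 0, 0, 2], 0x395c81879c59c19583331b362d51a71d3a1a6d68a4a68328c6bbb22a,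
    [0x3573564613, 0x4575625614], [0x4213184223, 0x5213185454]⟩,
  ⟨[2, 0, 1, 2], [2, 0, 0, 2], 0xb19945c759c88114b5d15a2548c8a27d1a4a5d64a417b4a463b7b6a2,
    [0x3572714633, 0x5576616625], [0x4213173183, 0x4175214324]⟩,
  ⟨[2, 1, 0, 2], [2, 0, 0, 2], 0xb79c3515bb38193611d15a15dac1268b8a4a6da4455383a2c7ac6288,
    [0x4724565614, 0x5576616625], [0x3732314073, 0x4183176224]⟩,
  ⟨[3, 0, 0, 2], [2, 0, 0, 2], 0x5b9c3813a7376171b5d15ba1da1c6ad6a44247666a62b4498276b8ba,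
    [0x3714575624, 0x5566616625], [0x4212184073, 0x4185074324]⟩]

/-- Evaluation in the kernel is feasible because the simulation uses primitive operations on number
literals, and `force` has the new coordinate evaluated at every step. -/
theorem tableC_check : tableC.all (Entry.check .C) = true := by decide +kernel

theorem tableI_check : tableI.all (Entry.check .I) = true := by decide +kernel

theorem tableJ_check : tableJ.all (Entry.check .J) = true := by decide +kernel

theorem tableL_check : tableL.all (Entry.check .L) = true := by decide +kernel

theorem tableY_check : tableY.all (Entry.check .Y) = true := by decide +kernel

theorem tableS_check : tableS.all (Entry.check .slash) = true := by decide +kernel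

end LoadingGame

/-! ### Sufficiency for each type in standard position -/

namespace LoadingGame

open Board

theorem exists_gaps_three {m x y z : ℤ} (hx : 2 ≤ x) (hxy : x < y) (hyz : y < z)
    (hz : 2 ≤ m - 1 - z) : ∃ a b c d : ℕ, 2 ≤ a ∧ 2 ≤ d ∧ x = linePos [a, b, c, d] 0 ∧
      y = linePos [a, b, c, d] 1 ∧ z = linePos [a, b, c, d] 2 ∧ m = linePos [a, b, c, d] 3 :=
  ⟨x.toNat, (y - x - 1).toNat, (z - y - 1).toNat, (m - 1 - z).toNat, by omega, by omega,
    by simp [linePos]; omega, by simp [linePos]; omega, by simp [linePos]; omega,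
    by simp [linePos]; omega⟩

theorem exists_gaps_two {m x y : ℤ} (hx : 2 ≤ x) (hxy : x < y) (hy : 2 ≤ m - 1 - y) :
    ∃ a b c : ℕ, 2 ≤ a ∧ 2 ≤ c ∧ x = linePos [a, b, c] 0 ∧
      y = linePos [a, b, c] 1 ∧ m = linePos [a, b, c] 2 :=
  ⟨x.toNat, (y - x - 1).toNat, (m - 1 - y).toNat, by omega, by omega,
    by simp [linePos]; omega, by simp [linePos]; omega, by simp [linePos]; omega⟩

theorem exists_gaps_one {m x : ℤ} (hx : 2 ≤ x) (hx' : 2 ≤ m - 1 - x) :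
    ∃ a b : ℕ, 2 ≤ a ∧ 2 ≤ b ∧ x = linePos [a, b] 0 ∧ m = linePos [a, b] 1 :=
  ⟨x.toNat, (m - 1 - x).toNat, by omega, by omega, by simp [linePos]; omega,
    by simp [linePos]; omega⟩

variable {B : Board} {f g : Fin 3 → ℤ}

set_option linter.unusedSimpArgs false in
theorem rich_of_C (hf : StrictMono f) (hg : StrictMono g)
    (hs : ∀ k, B.sink k = (f (SinkType.pattern .C k).1, g (SinkType.pattern .C k).2))
    (h1 : B.SinksAwayFromBoundary) (h3 : B.SizeBound .C) :
    B.Rich := by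
  have hs0 : B.sink 0 = (f 0, g 0) := hs 0
  have hs1 : B.sink 1 = (f 0, g 2) := hs 1
  have hs2 : B.sink 2 = (f 1, g 1) := hs 2
  have d1 := h1 0 .up
  have d2 := h1 2 .down
  have d3 := h1 0 .left
  have d4 := h1 1 .right
  simp only [distBoundary, hs0, hs1, hs2] at d1 d2 d3 d4
  obtain ⟨a, b, c, ha, hc, e1, e2, e3⟩ :=
    exists_gaps_two d1 (hf (by decide : (0 : Fin 3) < 1)) d2
  obtain ⟨p, q, r, s, hp, hs', e4, e5, e6, e7⟩ :=
    exists_gaps_three d3 (hg (by decide : (0 : Fin 3) < 1)) (hg (by decide : (1 : Fin 3) < 2)) d4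
  have h : B.Spread .C [a, b, c] [p, q, r, s] := by
    refine ⟨by exact_mod_cast e3, by exact_mod_cast e7, ?_⟩
    rw [Fin.forall_fin_succ, Fin.forall_fin_succ, Fin.forall_fin_one]
    exact ⟨by rw [hs0, e1, e4]; rfl,
      hs1.trans (by rw [e1, e6]; rfl),
      hs2.trans (by rw [e2, e5]; rfl)⟩
  have hT : ∀ i, ((SinkType.pattern .C i).1 : ℕ) + 1 < [a, b, c].length ∧
      ((SinkType.pattern .C i).2 : ℕ) + 1 < [p, q, r, s].length := by
    change ∀ i, ((SinkType.pattern .C i).1 : ℕ) + 1 < 3 ∧ ((SinkType.pattern .C i).2 : ℕ) + 1 < 4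
    decide
  have hR := h.rows
  have hC := h.cols
  simp [linePos] at hR hC
  simp only [SizeBound, SizeAtLeast] at h3
  -- The board has `a + b + c + 2` rows and `p + q + r + s + 3` columns, and both gap sums are at
  -- least 4. The size bound forces excesses over 4 of at least (1, 1), (2, 0) or (0, 2).
  have hcases : (5 ≤ a + b + c ∧ 5 ≤ p + q + r + s) ∨ 6 ≤ a + b + c ∨ 6 ≤ p + q + r + s := by omega
  rcases hcases with ⟨_, _⟩ | _ | _
  · exact h.rich_of_covers tableC_check hT [2, 0, 2] [2, 0, 0, 2] 1 1 (by decide +kernel)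
      (by simp; omega) (by simp; omega) (by simp; omega) (by simp; omega)
  · exact h.rich_of_covers tableC_check hT [2, 0, 2] [2, 0, 0, 2] 2 0 (by decide +kernel)
      (by simp; omega) (by simp; omega) (by simp; omega) (by simp; omega)
  · exact h.rich_of_covers tableC_check hT [2, 0, 2] [2, 0, 0, 2] 0 2 (by decide +kernel)
      (by simp; omega) (by simp; omega) (by simp; omega) (by simp; omega)

set_option linter.unusedSimpArgs false in
theorem rich_of_I (hf : StrictMono f) (_ : StrictMono g)
    (hs : ∀ k, B.sink k = (f (SinkType.pattern .I k).1, g (SinkType.pattern .I k).2))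
    (h1 : B.SinksAwayFromBoundary) (h2 : B.NoForbiddenConfiguration) (h3 : B.SizeBound .I) :
    B.Rich := by
  have hs0 : B.sink 0 = (f 0, g 0) := hs 0
  have hs1 : B.sink 1 = (f 1, g 0) := hs 1
  have hs2 : B.sink 2 = (f 2, g 0) := hs 2
  have d1 := h1 0 .up
  have d2 := h1 2 .down
  have d3 := h1 0 .left
  have d4 := h1 0 .right
  simp only [distBoundary, hs0, hs1, hs2] at d1 d2 d3 d4
  obtain ⟨a, b, c, d, ha, hd, e1, e2, e3, e4⟩ :=
    exists_gaps_three d1 (hf (by decide : (0 : Fin 3) < 1)) (hf (by decide : (1 : Fin 3) < 2)) d2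
  obtain ⟨p, q, hp, hq', e5, e6⟩ :=
    exists_gaps_one d3 d4
  have h : B.Spread .I [a, b, c, d] [p, q] := by
    refine ⟨by exact_mod_cast e4, by exact_mod_cast e6, ?_⟩
    rw [Fin.forall_fin_succ, Fin.forall_fin_succ, Fin.forall_fin_one]
    exact ⟨by rw [hs0, e1, e5]; rfl,
      hs1.trans (by rw [e2, e5]; rfl),
      hs2.trans (by rw [e3, e5]; rfl)⟩
  have hT : ∀ i, ((SinkType.pattern .I i).1 : ℕ) + 1 < [a, b, c, d].length ∧
      ((SinkType.pattern .I i).2 : ℕ) + 1 < [p, q].length := by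
    change ∀ i, ((SinkType.pattern .I i).1 : ℕ) + 1 < 4 ∧ ((SinkType.pattern .I i).2 : ℕ) + 1 < 2
    decide
  have hR := h.rows
  have hC := h.cols
  simp [linePos] at hR hC
  simp only [SizeBound, SizeAtLeast] at h3
  -- With `a + b + c + d + 3` rows and `p + q + 1` columns, the three cases are at least seven
  -- columns, at least nine rows and six columns, and at least eleven rows with exactly five
  -- columns.
  rcases (by omega : 6 ≤ p + q ∨ (5 ≤ p + q ∧ 6 ≤ a + b + c + d) ∨
    (p = 2 ∧ q = 2 ∧ 8 ≤ a + b + c + d)) with _ | ⟨_, _⟩ | ⟨hp2, hq2, _⟩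
  · exact h.rich_of_covers tableI_check hT [2, 0, 0, 2] [2, 2] 0 2 (by decide +kernel)
      (by simp; omega) (by simp; omega) (by simp; omega) (by simp; omega)
  · exact h.rich_of_covers tableI_check hT [2, 0, 0, 2] [2, 2] 2 1 (by decide +kernel)
      (by simp; omega) (by simp; omega) (by simp; omega) (by simp; omega)
  · have hx0 : B.sink 0 = ((a : ℤ), (p : ℤ)) := by rw [hs0, e1, e5]; simp [linePos]
    have hx1 : B.sink 1 = ((a + b + 1 : ℤ), (p : ℤ)) := by rw [hs1, e2, e5]; simp [linePos]
    have hx2 : B.sink 2 = ((a + b + c + 2 : ℤ), (p : ℤ)) := by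
      rw [hs2, e3, e5]; simp [linePos, add_assoc]
    have hRz : (B.rows : ℤ) = a + b + c + d + 3 := by omega
    have hCz : (B.cols : ℤ) = p + q + 1 := by omega
    -- With five columns every sink is two cells away from both lateral sides. Configurations (a),
    -- (c) and (d) then forbid certain small gaps, each of (a) and (d) in two mirror images.
    have hA : ¬ (a = 2 ∧ b = 0) := by
      rintro ⟨h4, h5⟩
      refine h2.1 ⟨0, 1, ⟨.down, fun x hx => ?_⟩, ⟨.down, ?_⟩⟩
      · cases x <;> first | exact absurd rfl hx | (simp only [distBoundary, hx0, hx1, hx2, hRz, hCz]; omega)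
      · exact Prod.ext (by simp only [hx0, hx1, Dir.vec, Prod.fst_add]; omega)
          (by simp only [hx0, hx1, Dir.vec, Prod.snd_add]; omega)
    have hA' : ¬ (d = 2 ∧ c = 0) := by
      rintro ⟨h4, h5⟩
      refine h2.1 ⟨2, 1, ⟨.up, fun x hx => ?_⟩, ⟨.up, ?_⟩⟩
      · cases x <;> first | exact absurd rfl hx | (simp only [distBoundary, hx0, hx1, hx2, hRz, hCz]; omega)
      · exact Prod.ext (by simp only [hx2, hx1, Dir.vec, Prod.fst_add]; omega)
          (by simp only [hx2, hx1, Dir.vec, Prod.snd_add]; omega)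
    have hC' : ¬ (b = 0 ∧ c = 0) := by
      rintro ⟨h4, h5⟩
      refine h2.2.2.1 ⟨1, 0, 2, by decide, ⟨.left, ?_, ?_⟩, ⟨.up, ?_⟩, ⟨.down, ?_⟩⟩
      · simp only [distBoundary, Dir.opp, hx0, hx1, hx2, hRz, hCz]; omega
      · simp only [distBoundary, Dir.opp, hx0, hx1, hx2, hRz, hCz]; omega
      · exact Prod.ext (by simp only [hx1, hx0, Dir.vec, Prod.fst_add]; omega)
          (by simp only [hx1, hx0, Dir.vec, Prod.snd_add]; omega)
      · exact Prod.ext (by simp only [hx1, hx2, Dir.vec, Prod.fst_add]; omega)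
          (by simp only [hx1, hx2, Dir.vec, Prod.snd_add]; omega)
    have hD : ¬ (a = 2 ∧ b = 1 ∧ c = 0) := by
      rintro ⟨h4, h5, h6⟩
      refine h2.2.2.2 ⟨0, 1, 2, by decide, ⟨.down, fun x hx => ?_⟩, ⟨.down, ?_, ?_⟩, ⟨.down, ?_⟩⟩
      · cases x <;> first | exact absurd rfl hx | (simp only [distBoundary, hx0, hx1, hx2, hRz, hCz]; omega)
      · rintro ⟨j, hj⟩
        have hj := congrArg Prod.fst hj
        rcases (by decide : ∀ j : Color, j = 0 ∨ j = 1 ∨ j = 2) j with rfl | rfl | rfl <;>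
          simp only [hx0, hx1, hx2, Dir.vec, Prod.fst_add] at hj <;> omega
      · exact Prod.ext (by simp only [hx0, hx1, Dir.vec, Prod.fst_add]; omega)
          (by simp only [hx0, hx1, Dir.vec, Prod.snd_add]; omega)
      · exact Prod.ext (by simp only [hx1, hx2, Dir.vec, Prod.fst_add]; omega)
          (by simp only [hx1, hx2, Dir.vec, Prod.snd_add]; omega)
    have hD' : ¬ (d = 2 ∧ c = 1 ∧ b = 0) := by
      rintro ⟨h4, h5, h6⟩
      refine h2.2.2.2 ⟨2, 1, 0, by decide, ⟨.up, fun x hx => ?_⟩, ⟨.up, ?_, ?_⟩, ⟨.up, ?_⟩⟩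
      · cases x <;> first | exact absurd rfl hx | (simp only [distBoundary, hx0, hx1, hx2, hRz, hCz]; omega)
      · rintro ⟨j, hj⟩
        have hj := congrArg Prod.fst hj
        rcases (by decide : ∀ j : Color, j = 0 ∨ j = 1 ∨ j = 2) j with rfl | rfl | rfl <;>
          simp only [hx0, hx1, hx2, Dir.vec, Prod.fst_add] at hj <;> omega
      · exact Prod.ext (by simp only [hx2, hx1, Dir.vec, Prod.fst_add]; omega)
          (by simp only [hx2, hx1, Dir.vec, Prod.snd_add]; omega)
      · exact Prod.ext (by simp only [hx1, hx0, Dir.vec, Prod.fst_add]; omega)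
          (by simp only [hx1, hx0, Dir.vec, Prod.snd_add]; omega)
    -- If `b = 0`, the exclusions give `1 ≤ c` and `3 ≤ a`, and moreover `2 ≤ c` or `3 ≤ d`; the
    -- case `c = 0` is the mirror image. The increments below bring each minimal list to gap sum 8,
    -- that is, to eleven rows.
    rcases (by omega : (1 ≤ b ∧ 1 ≤ c) ∨ (3 ≤ a ∧ 2 ≤ c) ∨ (3 ≤ a ∧ 1 ≤ c ∧ 3 ≤ d) ∨
      (2 ≤ b ∧ 3 ≤ d) ∨ (3 ≤ a ∧ 1 ≤ b ∧ 3 ≤ d)) with _ | _ | _ | _ | _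
    · exact h.rich_of_covers tableI_check hT [2, 1, 1, 2] [2, 2] 2 0 (by decide +kernel)
        (by simp; omega) (by simp; omega) (by simp; omega) (by simp; omega)
    · exact h.rich_of_covers tableI_check hT [3, 0, 2, 2] [2, 2] 1 0 (by decide +kernel)
        (by simp; omega) (by simp; omega) (by simp; omega) (by simp; omega)
    · exact h.rich_of_covers tableI_check hT [3, 0, 1, 3] [2, 2] 1 0 (by decide +kernel)
        (by simp; omega) (by simp; omega) (by simp; omega) (by simp; omega)
    · exact h.rich_of_covers tableI_check hT [2, 2, 0, 3] [2, 2] 1 0 (by decide +kernel)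
        (by simp; omega) (by simp; omega) (by simp; omega) (by simp; omega)
    · exact h.rich_of_covers tableI_check hT [3, 1, 0, 3] [2, 2] 1 0 (by decide +kernel)
        (by simp; omega) (by simp; omega) (by simp; omega) (by simp; omega)

set_option linter.unusedSimpArgs false in
theorem rich_of_J (hf : StrictMono f) (hg : StrictMono g)
    (hs : ∀ k, B.sink k = (f (SinkType.pattern .J k).1, g (SinkType.pattern .J k).2))
    (h1 : B.SinksAwayFromBoundary) (h3 : B.SizeBound .J) :
    B.Rich := by
  have hs0 : B.sink 0 = (f 0, g 1) := hs 0
  have hs1 : B.sink 1 = (f 1, g 1) := hs 1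
  have hs2 : B.sink 2 = (f 2, g 0) := hs 2
  have d1 := h1 0 .up
  have d2 := h1 2 .down
  have d3 := h1 2 .left
  have d4 := h1 0 .right
  simp only [distBoundary, hs0, hs1, hs2] at d1 d2 d3 d4
  obtain ⟨a, b, c, d, ha, hd, e1, e2, e3, e4⟩ :=
    exists_gaps_three d1 (hf (by decide : (0 : Fin 3) < 1)) (hf (by decide : (1 : Fin 3) < 2)) d2
  obtain ⟨p, q, r, hp, hr', e5, e6, e7⟩ :=
    exists_gaps_two d3 (hg (by decide : (0 : Fin 3) < 1)) d4
  have h : B.Spread .J [a, b, c, d] [p, q, r] := by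
    refine ⟨by exact_mod_cast e4, by exact_mod_cast e7, ?_⟩
    rw [Fin.forall_fin_succ, Fin.forall_fin_succ, Fin.forall_fin_one]
    exact ⟨by rw [hs0, e1, e6]; rfl,
      hs1.trans (by rw [e2, e6]; rfl),
      hs2.trans (by rw [e3, e5]; rfl)⟩
  have hT : ∀ i, ((SinkType.pattern .J i).1 : ℕ) + 1 < [a, b, c, d].length ∧
      ((SinkType.pattern .J i).2 : ℕ) + 1 < [p, q, r].length := by
    change ∀ i, ((SinkType.pattern .J i).1 : ℕ) + 1 < 4 ∧ ((SinkType.pattern .J i).2 : ℕ) + 1 < 3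
    decide
  have hR := h.rows
  have hC := h.cols
  simp [linePos] at hR hC
  simp only [SizeBound, SizeAtLeast] at h3
  -- The excesses over the minimal gap sums 4 are the same as for type C, now with `a + b + c + d +
  -- 3` rows and `p + q + r + 2` columns.
  have hcases : (5 ≤ a + b + c + d ∧ 5 ≤ p + q + r) ∨ 6 ≤ a + b + c + d ∨ 6 ≤ p + q + r := by omega
  rcases hcases with ⟨_, _⟩ | _ | _
  · exact h.rich_of_covers tableJ_check hT [2, 0, 0, 2] [2, 0, 2] 1 1 (by decide +kernel)
      (by simp; omega) (by simp; omega) (by simp; omega) (by simp; omega)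
  · exact h.rich_of_covers tableJ_check hT [2, 0, 0, 2] [2, 0, 2] 2 0 (by decide +kernel)
      (by simp; omega) (by simp; omega) (by simp; omega) (by simp; omega)
  · exact h.rich_of_covers tableJ_check hT [2, 0, 0, 2] [2, 0, 2] 0 2 (by decide +kernel)
      (by simp; omega) (by simp; omega) (by simp; omega) (by simp; omega)

set_option linter.unusedSimpArgs false in
theorem rich_of_L (hf : StrictMono f) (hg : StrictMono g)
    (hs : ∀ k, B.sink k = (f (SinkType.pattern .L k).1, g (SinkType.pattern .L k).2))
    (h1 : B.SinksAwayFromBoundary) (h2 : B.NoForbiddenConfiguration) (h3 : B.SizeBound .L) :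
    B.Rich := by
  have hs0 : B.sink 0 = (f 0, g 0) := hs 0
  have hs1 : B.sink 1 = (f 1, g 0) := hs 1
  have hs2 : B.sink 2 = (f 1, g 1) := hs 2
  have d1 := h1 0 .up
  have d2 := h1 1 .down
  have d3 := h1 0 .left
  have d4 := h1 2 .right
  simp only [distBoundary, hs0, hs1, hs2] at d1 d2 d3 d4
  obtain ⟨a, b, c, ha, hc, e1, e2, e3⟩ :=
    exists_gaps_two d1 (hf (by decide : (0 : Fin 3) < 1)) d2
  obtain ⟨p, q, r, hp, hr', e4, e5, e6⟩ :=
    exists_gaps_two d3 (hg (by decide : (0 : Fin 3) < 1)) d4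
  have h : B.Spread .L [a, b, c] [p, q, r] := by
    refine ⟨by exact_mod_cast e3, by exact_mod_cast e6, ?_⟩
    rw [Fin.forall_fin_succ, Fin.forall_fin_succ, Fin.forall_fin_one]
    exact ⟨by rw [hs0, e1, e4]; rfl,
      hs1.trans (by rw [e2, e4]; rfl),
      hs2.trans (by rw [e2, e5]; rfl)⟩
  have hT : ∀ i, ((SinkType.pattern .L i).1 : ℕ) + 1 < [a, b, c].length ∧
      ((SinkType.pattern .L i).2 : ℕ) + 1 < [p, q, r].length := by
    change ∀ i, ((SinkType.pattern .L i).1 : ℕ) + 1 < 3 ∧ ((SinkType.pattern .L i).2 : ℕ) + 1 < 3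
    decide
  have hR := h.rows
  have hC := h.cols
  simp [linePos] at hR hC
  simp only [SizeBound, SizeAtLeast] at h3
  -- If all four fail, the sink at the bend is adjacent to both others and two cells away from the
  -- lower and the left side, which is configuration (b).
  have hB : 1 ≤ b ∨ 1 ≤ q ∨ 3 ≤ c ∨ 3 ≤ p := by
    by_contra! hc
    obtain ⟨hb, hq, hc, hp'⟩ := hc
    refine h2.2.1 ⟨1, 0, 2, by decide, ⟨.down, .left, by decide, by decide, ?_, ?_⟩, ⟨.up, ?_⟩,
      ⟨.right, ?_⟩⟩ <;> simp [hs0, hs1, hs2, distBoundary, Dir.vec, e1, e2, e4, e5, hR, linePos] <;>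
      omega
  have hcases : (5 ≤ a + b + c ∧ 5 ≤ p + q + r) ∨ 7 ≤ a + b + c ∨ 7 ≤ p + q + r := by omega
  -- Each alternative makes one gap sum at least 5. The size bound then requires the other to be at
  -- least 5 or the first to be at least 7.
  rcases hB with _ | _ | _ | _
  · rcases (by omega : 5 ≤ p + q + r ∨ 7 ≤ a + b + c) with _ | _
    · exact h.rich_of_covers tableL_check hT [2, 1, 2] [2, 0, 2] 0 1 (by decide +kernel)
        (by simp; omega) (by simp; omega) (by simp; omega) (by simp; omega)
    · exact h.rich_of_covers tableL_check hT [2, 1, 2] [2, 0, 2] 2 0 (by decide +kernel)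
        (by simp; omega) (by simp; omega) (by simp; omega) (by simp; omega)
  · rcases (by omega : 5 ≤ a + b + c ∨ 7 ≤ p + q + r) with _ | _
    · exact h.rich_of_covers tableL_check hT [2, 0, 2] [2, 1, 2] 1 0 (by decide +kernel)
        (by simp; omega) (by simp; omega) (by simp; omega) (by simp; omega)
    · exact h.rich_of_covers tableL_check hT [2, 0, 2] [2, 1, 2] 0 2 (by decide +kernel)
        (by simp; omega) (by simp; omega) (by simp; omega) (by simp; omega)
  · rcases (by omega : 5 ≤ p + q + r ∨ 7 ≤ a + b + c) with _ | _
    · exact h.rich_of_covers tableL_check hT [2, 0, 3] [2, 0, 2] 0 1 (by decide +kernel)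
        (by simp; omega) (by simp; omega) (by simp; omega) (by simp; omega)
    · exact h.rich_of_covers tableL_check hT [2, 0, 3] [2, 0, 2] 2 0 (by decide +kernel)
        (by simp; omega) (by simp; omega) (by simp; omega) (by simp; omega)
  · rcases (by omega : 5 ≤ a + b + c ∨ 7 ≤ p + q + r) with _ | _
    · exact h.rich_of_covers tableL_check hT [2, 0, 2] [3, 0, 2] 1 0 (by decide +kernel)
        (by simp; omega) (by simp; omega) (by simp; omega) (by simp; omega)
    · exact h.rich_of_covers tableL_check hT [2, 0, 2] [3, 0, 2] 0 2 (by decide +kernel)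
        (by simp; omega) (by simp; omega) (by simp; omega) (by simp; omega)

set_option linter.unusedSimpArgs false in
theorem rich_of_Y (hf : StrictMono f) (hg : StrictMono g)
    (hs : ∀ k, B.sink k = (f (SinkType.pattern .Y k).1, g (SinkType.pattern .Y k).2))
    (h1 : B.SinksAwayFromBoundary) (h3 : B.SizeBound .Y) :
    B.Rich := by
  have hs0 : B.sink 0 = (f 0, g 0) := hs 0
  have hs1 : B.sink 1 = (f 1, g 2) := hs 1
  have hs2 : B.sink 2 = (f 2, g 1) := hs 2
  have d1 := h1 0 .up
  have d2 := h1 2 .down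
  have d3 := h1 0 .left
  have d4 := h1 1 .right
  simp only [distBoundary, hs0, hs1, hs2] at d1 d2 d3 d4
  obtain ⟨a, b, c, d, ha, hd, e1, e2, e3, e4⟩ :=
    exists_gaps_three d1 (hf (by decide : (0 : Fin 3) < 1)) (hf (by decide : (1 : Fin 3) < 2)) d2
  obtain ⟨p, q, r, s, hp, hs', e5, e6, e7, e8⟩ :=
    exists_gaps_three d3 (hg (by decide : (0 : Fin 3) < 1)) (hg (by decide : (1 : Fin 3) < 2)) d4
  have h : B.Spread .Y [a, b, c, d] [p, q, r, s] := by
    refine ⟨by exact_mod_cast e4, by exact_mod_cast e8, ?_⟩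
    rw [Fin.forall_fin_succ, Fin.forall_fin_succ, Fin.forall_fin_one]
    exact ⟨by rw [hs0, e1, e5]; rfl,
      hs1.trans (by rw [e2, e7]; rfl),
      hs2.trans (by rw [e3, e6]; rfl)⟩
  have hT : ∀ i, ((SinkType.pattern .Y i).1 : ℕ) + 1 < [a, b, c, d].length ∧
      ((SinkType.pattern .Y i).2 : ℕ) + 1 < [p, q, r, s].length := by
    change ∀ i, ((SinkType.pattern .Y i).1 : ℕ) + 1 < 4 ∧ ((SinkType.pattern .Y i).2 : ℕ) + 1 < 4
    decide
  have hR := h.rows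
  have hC := h.cols
  simp [linePos] at hR hC
  simp only [SizeBound, SizeAtLeast] at h3
  -- The tightest spread is 7 × 7, and the size bound asks for just one more row or column.
  have hcases : 5 ≤ a + b + c + d ∨ 5 ≤ p + q + r + s := by omega
  rcases hcases with _ | _
  · exact h.rich_of_covers tableY_check hT [2, 0, 0, 2] [2, 0, 0, 2] 1 0 (by decide +kernel)
      (by simp; omega) (by simp; omega) (by simp; omega) (by simp; omega)
  · exact h.rich_of_covers tableY_check hT [2, 0, 0, 2] [2, 0, 0, 2] 0 1 (by decide +kernel)
      (by simp; omega) (by simp; omega) (by simp; omega) (by simp; omega)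

set_option linter.unusedSimpArgs false in
theorem rich_of_slash (hf : StrictMono f) (hg : StrictMono g)
    (hs : ∀ k, B.sink k = (f (SinkType.pattern .slash k).1, g (SinkType.pattern .slash k).2))
    (h1 : B.SinksAwayFromBoundary) (h3 : B.SizeBound .slash) :
    B.Rich := by
  have hs0 : B.sink 0 = (f 0, g 2) := hs 0
  have hs1 : B.sink 1 = (f 1, g 1) := hs 1
  have hs2 : B.sink 2 = (f 2, g 0) := hs 2
  have d1 := h1 0 .up
  have d2 := h1 2 .down
  have d3 := h1 2 .left
  have d4 := h1 0 .right
  simp only [distBoundary, hs0, hs1, hs2] at d1 d2 d3 d4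
  obtain ⟨a, b, c, d, ha, hd, e1, e2, e3, e4⟩ :=
    exists_gaps_three d1 (hf (by decide : (0 : Fin 3) < 1)) (hf (by decide : (1 : Fin 3) < 2)) d2
  obtain ⟨p, q, r, s, hp, hs', e5, e6, e7, e8⟩ :=
    exists_gaps_three d3 (hg (by decide : (0 : Fin 3) < 1)) (hg (by decide : (1 : Fin 3) < 2)) d4
  have h : B.Spread .slash [a, b, c, d] [p, q, r, s] := by
    refine ⟨by exact_mod_cast e4, by exact_mod_cast e8, ?_⟩
    rw [Fin.forall_fin_succ, Fin.forall_fin_succ, Fin.forall_fin_one]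
    exact ⟨by rw [hs0, e1, e7]; rfl,
      hs1.trans (by rw [e2, e6]; rfl),
      hs2.trans (by rw [e3, e5]; rfl)⟩
  have hT : ∀ i, ((SinkType.pattern .slash i).1 : ℕ) + 1 < [a, b, c, d].length ∧
      ((SinkType.pattern .slash i).2 : ℕ) + 1 < [p, q, r, s].length := by
    change ∀ i, ((SinkType.pattern .slash i).1 : ℕ) + 1 < 4 ∧ ((SinkType.pattern .slash i).2 : ℕ) + 1 < 4
    decide
  have hR := h.rows
  have hC := h.cols
  simp [linePos] at hR hC
  simp only [SizeBound, SizeAtLeast] at h3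
  have hcases : 5 ≤ a + b + c + d ∨ 5 ≤ p + q + r + s := by omega
  rcases hcases with _ | _
  · exact h.rich_of_covers tableS_check hT [2, 0, 0, 2] [2, 0, 0, 2] 1 0 (by decide +kernel)
      (by simp; omega) (by simp; omega) (by simp; omega) (by simp; omega)
  · exact h.rich_of_covers tableS_check hT [2, 0, 0, 2] [2, 0, 0, 2] 0 1 (by decide +kernel)
      (by simp; omega) (by simp; omega) (by simp; omega) (by simp; omega)

end LoadingGame

/-! ### Reduction to standard position and classification of types -/

namespace LoadingGame

open Board

variable {B : Board}

theorem rich_of_standard {T : SinkType} {f g : Fin 3 → ℤ} (hf : StrictMono f) (hg : StrictMono g)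
    (hs : ∀ k, B.sink k = (f (T.pattern k).1, g (T.pattern k).2))
    (h1 : B.SinksAwayFromBoundary) (h2 : B.NoForbiddenConfiguration) (h3 : B.SizeBound T) :
    B.Rich := by
  cases T
  · exact rich_of_C hf hg hs h1 h3
  · exact rich_of_I hf hg hs h1 h2 h3
  · exact rich_of_J hf hg hs h1 h3
  · exact rich_of_L hf hg hs h1 h2 h3
  · exact rich_of_Y hf hg hs h1 h3
  · exact rich_of_slash hf hg hs h1 h3

theorem Board.sizeBound_transpose {T : SinkType} (h : B.SizeBound T) :
    B.transpose.SizeBound T := by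
  cases T <;> simp only [SizeBound, SizeAtLeast, transpose] at h ⊢ <;> omega

theorem hasPerfectLayout_of_flip {T : SinkType} {f g : Fin 3 → ℤ} (hf : StrictMono f ∨ StrictAnti f)
    (hg : StrictMono g) (hs : ∀ k, B.sink k = (f (T.pattern k).1, g (T.pattern k).2))
    (h1 : B.SinksAwayFromBoundary) (h2 : B.NoForbiddenConfiguration) (h3 : B.SizeBound T) :
    B.HasPerfectLayout := by
  rcases hf with hf | hf
  · exact (rich_of_standard hf hg hs h1 h2 h3).hasPerfectLayout
  · refine B.flipIso.symm.hasPerfectLayout (Rich.hasPerfectLayout ?_)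
    refine rich_of_standard (T := T) (f := fun t => B.rows - 1 - f t) (fun s t hst => ?_) hg
      (fun k => ?_) (B.flipIso.sinksAwayFromBoundary h1) (B.flipIso.noForbiddenConfiguration h2) h3
    · have := hf hst
      dsimp only
      omega
    · simp only [Board.flip, hs]

theorem hasPerfectLayout_of_flips {T : SinkType} {f g : Fin 3 → ℤ}
    (hf : StrictMono f ∨ StrictAnti f) (hg : StrictMono g ∨ StrictAnti g)
    (hs : ∀ k, B.sink k = (f (T.pattern k).1, g (T.pattern k).2))
    (h1 : B.SinksAwayFromBoundary) (h2 : B.NoForbiddenConfiguration) (h3 : B.SizeBound T) :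
    B.HasPerfectLayout := by
  rcases hg with hg | hg
  · exact hasPerfectLayout_of_flip hf hg hs h1 h2 h3
  -- The exchange of left and right is composed of a transposition, a flip and another
  -- transposition.
  · have e1 := B.transposeIso
    have e2 := B.transpose.flipIso
    have e3 := B.transpose.flip.transposeIso
    refine e1.symm.hasPerfectLayout (e2.symm.hasPerfectLayout (e3.symm.hasPerfectLayout ?_))
    refine hasPerfectLayout_of_flip (T := T) (g := fun t => B.cols - 1 - g t) hf
      (fun s t hst => ?_) (fun k => ?_)
      (e3.sinksAwayFromBoundary (e2.sinksAwayFromBoundary (e1.sinksAwayFromBoundary h1)))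
      (e3.noForbiddenConfiguration (e2.noForbiddenConfiguration (e1.noForbiddenConfiguration h2)))
      h3
    · have := hg hst
      dsimp only
      omega
    · simp only [Board.flip, Board.transpose, hs, Prod.swap]

theorem hasPerfectLayout_of_hasType {T : SinkType} (hT : B.HasType T)
    (h1 : B.SinksAwayFromBoundary) (h2 : B.NoForbiddenConfiguration) (h3 : B.SizeBound T) :
    B.HasPerfectLayout := by
  obtain ⟨σ, f, g, hf, hg, h⟩ := hT
  have e := B.recolorIso σ
  have h1 := e.sinksAwayFromBoundary h1
  have h2 := e.noForbiddenConfiguration h2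
  refine e.symm.hasPerfectLayout ?_
  rcases h with h | h
  · exact hasPerfectLayout_of_flips hf hg h h1 h2 h3
  · have e' := (B.recolor σ).transposeIso
    refine e'.symm.hasPerfectLayout ?_
    refine hasPerfectLayout_of_flips hf hg (fun k => ?_) (e'.sinksAwayFromBoundary h1)
      (e'.noForbiddenConfiguration h2) (Board.sizeBound_transpose (B := B.recolor σ) h3)
    simp only [Board.transpose, Board.recolor, h, Prod.swap]

namespace Board

theorem HasType.of_recolor {T : SinkType} {σ : Equiv.Perm Color} (h : (B.recolor σ).HasType T) :
    B.HasType T := by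
  obtain ⟨τ, f, g, hf, hg, h⟩ := h
  exact ⟨τ.trans σ, f, g, hf, hg, h⟩

theorem strictMono_or_strictAnti {a b c : ℤ} (h : (a < b ∧ b < c) ∨ (b < a ∧ c < b)) :
    StrictMono ![a, b, c] ∨ StrictAnti ![a, b, c] := by
  rcases h with h | h
  · left
    rw [Fin.strictMono_iff_lt_succ, Fin.forall_fin_two]
    exact h
  · right
    rw [Fin.strictAnti_iff_succ_lt, Fin.forall_fin_two]
    exact h

/-- The values of `f` and `g` are given explicitly. A pattern with fewer than three rows or columns
leaves some of them unused, and these may be any numbers that continue the monotone sequence. -/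
theorem HasType.of_values {T : SinkType} (i j k : Color) (hinj : Function.Injective ![i, j, k])
    (f₀ f₁ f₂ g₀ g₁ g₂ : ℤ) (hf : (f₀ < f₁ ∧ f₁ < f₂) ∨ (f₁ < f₀ ∧ f₂ < f₁))
    (hg : (g₀ < g₁ ∧ g₁ < g₂) ∨ (g₁ < g₀ ∧ g₂ < g₁))
    (h : (B.sink i = (![f₀, f₁, f₂] (T.pattern 0).1, ![g₀, g₁, g₂] (T.pattern 0).2) ∧
        B.sink j = (![f₀, f₁, f₂] (T.pattern 1).1, ![g₀, g₁, g₂] (T.pattern 1).2) ∧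
        B.sink k = (![f₀, f₁, f₂] (T.pattern 2).1, ![g₀, g₁, g₂] (T.pattern 2).2)) ∨
      (B.sink i = (![g₀, g₁, g₂] (T.pattern 0).2, ![f₀, f₁, f₂] (T.pattern 0).1) ∧
        B.sink j = (![g₀, g₁, g₂] (T.pattern 1).2, ![f₀, f₁, f₂] (T.pattern 1).1) ∧
        B.sink k = (![g₀, g₁, g₂] (T.pattern 2).2, ![f₀, f₁, f₂] (T.pattern 2).1))) :
    B.HasType T := by
  refine ⟨Equiv.ofBijective _ (Finite.injective_iff_bijective.1 hinj), _, _,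
    strictMono_or_strictAnti hf, strictMono_or_strictAnti hg, ?_⟩
  rcases h with ⟨h0, h1, h2⟩ | ⟨h0, h1, h2⟩
  · left
    rw [Fin.forall_fin_succ, Fin.forall_fin_two]
    exact ⟨h0, h1, h2⟩
  · right
    rw [Fin.forall_fin_succ, Fin.forall_fin_two]
    exact ⟨h0, h1, h2⟩

theorem exists_hasType_of_sorted {x0 x1 x2 y0 y1 y2 : ℤ} (h0 : B.sink 0 = (x0, y0))
    (h1 : B.sink 1 = (x1, y1)) (h2 : B.sink 2 = (x2, y2))
    (h01 : x0 < x1 ∨ x0 = x1 ∧ y0 < y1) (h12 : x1 < x2 ∨ x1 = x2 ∧ y1 < y2) :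
    ∃ T, B.HasType T := by
  rcases h01 with h01 | ⟨rfl, h01⟩ <;> rcases h12 with h12 | ⟨rfl, h12⟩
  · rcases (by omega : (y0 = y1 ∧ y0 = y2) ∨
        (y0 = y1 ∧ y0 < y2) ∨
        (y0 = y2 ∧ y0 < y1) ∨
        (y1 = y2 ∧ y0 < y1) ∨
        (y0 < y1 ∧ y1 < y2) ∨
        (y0 < y2 ∧ y2 < y1) ∨
        (y1 = y2 ∧ y1 < y0) ∨
        (y0 = y2 ∧ y1 < y0) ∨
        (y1 < y0 ∧ y0 < y2) ∨
        (y0 = y1 ∧ y2 < y0) ∨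
        (y2 < y0 ∧ y0 < y1) ∨
        (y1 < y2 ∧ y2 < y0) ∨
        (y2 < y1 ∧ y1 < y0)) with
      ⟨rfl, rfl⟩ | ⟨rfl, _⟩ | ⟨rfl, _⟩ | ⟨rfl, _⟩ | ⟨_, _⟩ | ⟨_, _⟩ | ⟨rfl, _⟩ | ⟨rfl, _⟩ | ⟨_, _⟩ | ⟨rfl, _⟩ | ⟨_, _⟩ | ⟨_, _⟩ | ⟨_, _⟩
    · exact ⟨.I, .of_values 0 1 2 (by decide) x0 x1 x2 y0 (y0 + 1) (y0 + 2) (by omega) (by omega)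
        (.inl ⟨h0, h1, h2⟩)⟩
    · exact ⟨.J, .of_values 0 1 2 (by decide) x0 x1 x2 y2 y0 (y0 - 1) (by omega) (by omega)
        (.inl ⟨h0, h1, h2⟩)⟩
    · exact ⟨.C, .of_values 0 2 1 (by decide) y0 y1 (y1 + 1) x0 x1 x2 (by omega) (by omega)
        (.inr ⟨h0, h2, h1⟩)⟩
    · exact ⟨.J, .of_values 2 1 0 (by decide) x2 x1 x0 y0 y1 (y1 + 1) (by omega) (by omega)
        (.inl ⟨h2, h1, h0⟩)⟩
    · exact ⟨.slash, .of_values 0 1 2 (by decide) x0 x1 x2 y2 y1 y0 (by omega) (by omega)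
        (.inl ⟨h0, h1, h2⟩)⟩
    · exact ⟨.Y, .of_values 0 1 2 (by decide) x0 x1 x2 y0 y2 y1 (by omega) (by omega)
        (.inl ⟨h0, h1, h2⟩)⟩
    · exact ⟨.J, .of_values 2 1 0 (by decide) x2 x1 x0 y0 y1 (y1 - 1) (by omega) (by omega)
        (.inl ⟨h2, h1, h0⟩)⟩
    · exact ⟨.C, .of_values 0 2 1 (by decide) y0 y1 (y1 - 1) x0 x1 x2 (by omega) (by omega)
        (.inr ⟨h0, h2, h1⟩)⟩
    · exact ⟨.Y, .of_values 2 0 1 (by decide) y2 y0 y1 x2 x1 x0 (by omega) (by omega)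
        (.inr ⟨h2, h0, h1⟩)⟩
    · exact ⟨.J, .of_values 0 1 2 (by decide) x0 x1 x2 y2 y0 (y0 + 1) (by omega) (by omega)
        (.inl ⟨h0, h1, h2⟩)⟩
    · exact ⟨.Y, .of_values 2 0 1 (by decide) y2 y0 y1 x2 x1 x0 (by omega) (by omega)
        (.inr ⟨h2, h0, h1⟩)⟩
    · exact ⟨.Y, .of_values 0 1 2 (by decide) x0 x1 x2 y0 y2 y1 (by omega) (by omega)
        (.inl ⟨h0, h1, h2⟩)⟩
    · exact ⟨.slash, .of_values 0 1 2 (by decide) x0 x1 x2 y2 y1 y0 (by omega) (by omega)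
        (.inl ⟨h0, h1, h2⟩)⟩
  · rcases (by omega : (y0 = y1 ∧ y0 < y2) ∨
        (y0 < y1 ∧ y1 < y2) ∨
        (y0 = y2 ∧ y1 < y0) ∨
        (y1 < y0 ∧ y0 < y2) ∨
        (y1 < y2 ∧ y2 < y0)) with
      ⟨rfl, _⟩ | ⟨_, _⟩ | ⟨rfl, _⟩ | ⟨_, _⟩ | ⟨_, _⟩
    · exact ⟨.L, .of_values 0 1 2 (by decide) x0 x1 (x1 + 1) y0 y2 (y2 + 1) (by omega) (by omega)
        (.inl ⟨h0, h1, h2⟩)⟩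
    · exact ⟨.J, .of_values 2 1 0 (by decide) y2 y1 y0 x0 x1 (x1 + 1) (by omega) (by omega)
        (.inr ⟨h2, h1, h0⟩)⟩
    · exact ⟨.L, .of_values 0 2 1 (by decide) x0 x1 (x1 + 1) y0 y1 (y1 - 1) (by omega) (by omega)
        (.inl ⟨h0, h2, h1⟩)⟩
    · exact ⟨.C, .of_values 1 2 0 (by decide) x1 x0 (x0 - 1) y1 y0 y2 (by omega) (by omega)
        (.inl ⟨h1, h2, h0⟩)⟩
    · exact ⟨.J, .of_values 1 2 0 (by decide) y1 y2 y0 x0 x1 (x1 + 1) (by omega) (by omega)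
        (.inr ⟨h1, h2, h0⟩)⟩
  · rcases (by omega : (y0 = y2 ∧ y0 < y1) ∨
        (y1 = y2 ∧ y0 < y1) ∨
        (y0 < y1 ∧ y1 < y2) ∨
        (y0 < y2 ∧ y2 < y1) ∨
        (y2 < y0 ∧ y0 < y1)) with
      ⟨rfl, _⟩ | ⟨rfl, _⟩ | ⟨_, _⟩ | ⟨_, _⟩ | ⟨_, _⟩
    · exact ⟨.L, .of_values 1 0 2 (by decide) y1 y0 (y0 - 1) x0 x2 (x2 + 1) (by omega) (by omega)
        (.inr ⟨h1, h0, h2⟩)⟩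
    · exact ⟨.L, .of_values 0 1 2 (by decide) y0 y1 (y1 + 1) x0 x2 (x2 + 1) (by omega) (by omega)
        (.inr ⟨h0, h1, h2⟩)⟩
    · exact ⟨.J, .of_values 0 1 2 (by decide) y0 y1 y2 x2 x0 (x0 - 1) (by omega) (by omega)
        (.inr ⟨h0, h1, h2⟩)⟩
    · exact ⟨.C, .of_values 0 1 2 (by decide) x0 x2 (x2 + 1) y0 y2 y1 (by omega) (by omega)
        (.inl ⟨h0, h1, h2⟩)⟩
    · exact ⟨.J, .of_values 1 0 2 (by decide) y1 y0 y2 x2 x0 (x0 - 1) (by omega) (by omega)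
        (.inr ⟨h1, h0, h2⟩)⟩
  · rcases (by omega : (y0 < y1 ∧ y1 < y2)) with
      ⟨_, _⟩
    · exact ⟨.I, .of_values 0 1 2 (by decide) y0 y1 y2 x0 (x0 + 1) (x0 + 2) (by omega) (by omega)
        (.inr ⟨h0, h1, h2⟩)⟩

/-- Recoloring puts the sinks into lexicographic order, strictly since they are distinct, and the
type does not depend on colors. -/
theorem exists_hasType (B : Board) : ∃ T, B.HasType T := by
  have hm := Tuple.monotone_sort fun i => toLex (B.sink i)
  have hlt : ∀ i j : Color, i < j →
      (B.sink (Tuple.sort (fun i => toLex (B.sink i)) i)).1 <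
        (B.sink (Tuple.sort (fun i => toLex (B.sink i)) j)).1 ∨
      (B.sink (Tuple.sort (fun i => toLex (B.sink i)) i)).1 =
        (B.sink (Tuple.sort (fun i => toLex (B.sink i)) j)).1 ∧
      (B.sink (Tuple.sort (fun i => toLex (B.sink i)) i)).2 <
        (B.sink (Tuple.sort (fun i => toLex (B.sink i)) j)).2 := by
    intro i j hij
    have h1 := lt_of_le_of_ne (hm hij.le) fun h => hij.ne
      ((Tuple.sort fun i => toLex (B.sink i)).injective (B.sink_injective (toLex.injective h)))
    rcases Prod.Lex.toLex_lt_toLex.1 h1 with h | ⟨h, h'⟩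
    · exact .inl h
    · exact .inr ⟨h, h'⟩
  obtain ⟨T, hT⟩ := exists_hasType_of_sorted
    (B := B.recolor (Tuple.sort fun i => toLex (B.sink i))) rfl rfl rfl
    (hlt 0 1 (by decide)) (hlt 1 2 (by decide))
  exact ⟨T, hT.of_recolor⟩

end Board

end LoadingGame

theorem mainTheorem1 (B : LoadingGame.Board) :
    B.HasPerfectLayout ↔
      (B.SinksAwayFromBoundary ∧ B.NoForbiddenConfiguration ∧ B.ObeysSizeBounds) := by
  constructor
  · rintro ⟨L, hL⟩
    exact ⟨hL.sinksAwayFromBoundary, hL.noForbiddenConfiguration, hL.obeysSizeBounds⟩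
  · rintro ⟨h1, h2, h3⟩
    obtain ⟨T, hT⟩ := B.exists_hasType
    exact LoadingGame.hasPerfectLayout_of_hasType hT h1 h2 (h3 T hT)
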